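/- Let $\Bbbk$ be a field of characteristic zero. An associative conformal algebra is a $\Bbbk[\partial]$-module $C$ with bilinear products $(a\circ_n b)$, $n\ge 0$, such that for all $a,b,c\in C$ and $n,m\ge0$: $(a\circ_n b)=0$ for all sufficiently large $n$; $(\partial a\circ_n b)=-n(a\circ_{n-1}b)$; $(a\circ_n\partial b)=\partial(a\circ_n b)+n(a\circ_{n-1}b)$; and $a\circ_n(b\circ_m c)=\sum_{s\ge0}\binom ns (a\circ_{n-s}b)\circ_{m+s}c$. Write $(a_\lambda b)=\sum_{n\ge0}\frac{\lambda^n}{n!}(a\circ_n b)$. Let $U(3)$ be the associative conformal algebra generated by one element $v$ with the defining relations $v\circ_n v=0$ for $n\ge 3$ and $2(v\circ_1 v)-\partial(v\circ_2 v)=2v$ (the universal enveloping associative conformal algebra of the Virasoro Lie conformal algebra relative to the locality bound $N=3$). Let $M_{(0,0)}=\Bbbk[\partial]u$ be the free $\Bbbk[\partial]$-module of rank one with the left conformal $U(3)$-module structure determined by $v_\lambda u=\partial u$, where in a conformal module every $a_\lambda w$ is a polynomial in $\lambda$ with coefficients in the module and $(\partial a)_\lambda w=-\lambda\,(a_\lambda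 w)$, $a_\lambda(\partial w)=(\partial+\lambda)(a_\lambda w)$ and $a_\lambda(b_\mu w)=(a_\lambda b)_{\lambda+\mu}w$. For a left conformal $C$-module $M$ and $n\ge0$, let $\tilde C^n(C,M)$ be the space of $\Bbbk$-linear maps $\varphi_{\bar\lambda}:C^{\otimes n}\to M[\lambda_1,\dots,\lambda_n]$ with $\varphi_{\bar\lambda}(a_1,\dots,\partial a_i,\dots,a_n)=-\lambda_i\varphi_{\bar\lambda}(a_1,\dots,a_n)$ for all $i$ (so $\tilde C^0(C,M)=M$), with the differential $$(d_n\varphi)_{\lambda_1,\dots,\lambda_{n+1}}(a_1,\dots,a_{n+1})=a_{1\,\lambda_1}\varphi_{\lambda_2,\dots,\lambda_{n+1}}(a_2,\dots,a_{n+1})+\sum_{i=1}^n(-1)^i\varphi_{\lambda_1,\dots,\lambda_i+\lambda_{i+1},\dots,\lambda_{n+1}}(a_1,\dots,a_{i\,\lambda_i}a_{i+1},\dots,a_{n+1})$$ and with the operator $(\partial\varphi)_{\bar\lambda}=(\partial+\lambda_1+\dots+\lambda_n)\varphi_{\bar\lambda}$, which commutes with $d$. The reduced Hochschild cohomology $H^\bullet(C,M)$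 is the cohomology of the quotient complex $\tilde C^\bullet(C,M)/\partial\tilde C^\bullet(C,M)$, $\bullet\ge0$. Theorem. $$\dim_\Bbbk H^n(U(3),M_{(0,0)})=\begin{cases}1,& n=1,\\ 2,& n=2,\\ 1,& n=3,\\ 0,& n\ge4.\end{cases}$$ -/

import Mathlib

open Finset

/-- An associative conformal algebra over a field `k`, given by its `n`-products
`prod n a b = (a ₍ₙ₎ b)`, `n ≥ 0`, and its translation operator `D = ∂`.
In every axiom a term with `n - 1` carries the factor `n`, so it vanishes for `n = 0`. -/
class AssocConformalAlgebra (k : Type*) (C : Type*) [Field k] [AddCommGroup C] [Module k C] where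
  D : C →ₗ[k] C
  prod : ℕ → C →ₗ[k] C →ₗ[k] C
  locality : ∀ a b : C, ∃ N : ℕ, ∀ n, N ≤ n → prod n a b = 0
  D_prod : ∀ (n : ℕ) (a b : C), prod n (D a) b = -(n • prod (n - 1) a b)
  prod_D : ∀ (n : ℕ) (a b : C), prod n a (D b) = D (prod n a b) + n • prod (n - 1) a b
  prod_assoc : ∀ (n m : ℕ) (a b c : C),
    prod n a (prod m b c) = ∑ s ∈ range (n + 1), n.choose s • prod (m + s) (prod (n - s) a b) c

/-- A left conformal module over an associative conformal algebra `C`. The operator `act n a`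
is `a(n)`, so that `a_λ u = ∑ₙ (λⁿ / n!) • act n a u`, which is a polynomial in `λ` by `locality`;
the last axiom is `a_λ (b_μ u) = (a_λ b)_{λ+μ} u`, read off at `λⁿ μᵐ / (n! m!)`. -/
class ConformalModule (k : Type*) (C : Type*) (M : Type*) [Field k]
    [AddCommGroup C] [Module k C] [AssocConformalAlgebra k C] [AddCommGroup M] [Module k M] where
  D : M →ₗ[k] M
  act : ℕ → C →ₗ[k] M →ₗ[k] M
  locality : ∀ (a : C) (u : M), ∃ N : ℕ, ∀ n, N ≤ n → act n a u = 0
  D_act : ∀ (n : ℕ) (a : C) (u : M),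
    act n (AssocConformalAlgebra.D (k := k) a) u = -(n • act (n - 1) a u)
  act_D : ∀ (n : ℕ) (a : C) (u : M), act n a (D u) = D (act n a u) + n • act (n - 1) a u
  act_act : ∀ (n m : ℕ) (a b : C) (u : M),
    act n a (act m b u) = ∑ s ∈ range (n + 1),
      n.choose s • act (m + s) (AssocConformalAlgebra.prod (k := k) (n - s) a b) u

/-! ### The universal enveloping associative conformal algebra `U(3)` -/

namespace U3

/-- Monomials in one generator `v` with respect to `∂` and all `n`-products. -/
inductive Mon : Type
  | v : Mon
  | D : Mon → Mon
  | prod : ℕ → Mon → Mon → Mon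

/-- The free (non-associative) algebra with a linear operator `∂` and bilinear `n`-products
on one generator `v`. -/
abbrev Free (k : Type*) [Field k] := Mon →₀ k

section

variable (k : Type*) [Field k]

noncomputable def Free.v : Free k := Finsupp.single Mon.v 1

noncomputable def Free.D : Free k →ₗ[k] Free k := Finsupp.lmapDomain k k Mon.D

noncomputable def Free.prod (n : ℕ) : Free k →ₗ[k] Free k →ₗ[k] Free k :=
  Finsupp.linearCombination k (fun a : Mon => Finsupp.lmapDomain k k (Mon.prod n a))

/-- The defining relators of `U(3)`: the axioms of associative conformal algebras, the locality
`(v ₍ₙ₎ v) = 0` for `n ≥ 3` and the Virasoro commutation relation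
`2 (v ₍₁₎ v) - ∂ (v ₍₂₎ v) = 2 v`. Locality of the other pairs is a consequence. -/
inductive Relator : Free k → Prop
  | D_prod (n : ℕ) (a b : Free k) :
      Relator (Free.prod k n (Free.D k a) b + n • Free.prod k (n - 1) a b)
  | prod_D (n : ℕ) (a b : Free k) :
      Relator (Free.prod k n a (Free.D k b) -
        (Free.D k (Free.prod k n a b) + n • Free.prod k (n - 1) a b))
  | assoc (n m : ℕ) (a b c : Free k) :
      Relator (Free.prod k n a (Free.prod k m b c) -
        ∑ s ∈ range (n + 1), n.choose s • Free.prod k (m + s) (Free.prod k (n - s) a b) c)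
  | loc (n : ℕ) (hn : 3 ≤ n) : Relator (Free.prod k n (Free.v k) (Free.v k))
  | vir : Relator ((2 : ℕ) • Free.prod k 1 (Free.v k) (Free.v k) -
        Free.D k (Free.prod k 2 (Free.v k) (Free.v k)) - (2 : ℕ) • Free.v k)

/-- Ideals: subspaces stable under `∂` and under all products with arbitrary elements. -/
structure IsIdeal (J : Submodule k (Free k)) : Prop where
  D_mem : ∀ x ∈ J, Free.D k x ∈ J
  prod_left : ∀ n, ∀ x ∈ J, ∀ y, Free.prod k n x y ∈ J
  prod_right : ∀ n, ∀ x ∈ J, ∀ y, Free.prod k n y x ∈ J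

/-- The ideal generated by the relators. -/
noncomputable def relIdeal : Submodule k (Free k) := sInf {J | IsIdeal k J ∧ ∀ x, Relator k x → x ∈ J}

end

end U3

/-- `U(3)`: the universal enveloping associative conformal algebra of the Virasoro Lie conformal
algebra relative to the locality bound `N = 3` on the generator `v`. -/
abbrev U3 (k : Type*) [Field k] := U3.Free k ⧸ U3.relIdeal k

namespace U3

section

variable (k : Type*) [Field k]

lemma relIdeal_le {J : Submodule k (Free k)} (hJ : IsIdeal k J)
    (h : ∀ x, Relator k x → x ∈ J) : relIdeal k ≤ J := sInf_le ⟨hJ, h⟩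

lemma relator_mem {x : Free k} (h : Relator k x) : x ∈ relIdeal k := by
  simp only [relIdeal, Submodule.mem_sInf]
  exact fun J hJ => hJ.2 x h

lemma isIdeal_relIdeal : IsIdeal k (relIdeal k) where
  D_mem x hx := by
    simp only [relIdeal, Submodule.mem_sInf] at hx ⊢
    exact fun J hJ => hJ.1.D_mem x (hx J hJ)
  prod_left n x hx y := by
    simp only [relIdeal, Submodule.mem_sInf] at hx ⊢
    exact fun J hJ => hJ.1.prod_left n x (hx J hJ) y
  prod_right n x hx y := by
    simp only [relIdeal, Submodule.mem_sInf] at hx ⊢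
    exact fun J hJ => hJ.1.prod_right n x (hx J hJ) y

/-- The generator of `U(3)`. -/
noncomputable def v : U3 k := Submodule.Quotient.mk (Free.v k)

noncomputable def D : U3 k →ₗ[k] U3 k :=
  (relIdeal k).mapQ (relIdeal k) (Free.D k) (fun x hx => (isIdeal_relIdeal k).D_mem x hx)

noncomputable def prod (n : ℕ) : U3 k →ₗ[k] U3 k →ₗ[k] U3 k :=
  (relIdeal k).liftQ
    (((relIdeal k).liftQ ((Free.prod k n).compr₂ (relIdeal k).mkQ).flip (fun x hx => by
      refine LinearMap.ext fun y => ?_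
      exact (Submodule.Quotient.mk_eq_zero _).2 ((isIdeal_relIdeal k).prod_right n x hx y))).flip)
    (fun x hx => by
      refine LinearMap.ext fun y => ?_
      obtain ⟨y, rfl⟩ := Submodule.Quotient.mk_surjective _ y
      exact (Submodule.Quotient.mk_eq_zero _).2 ((isIdeal_relIdeal k).prod_left n x hx y))

@[simp] lemma D_mk (x : Free k) :
    D k (Submodule.Quotient.mk x) = Submodule.Quotient.mk (Free.D k x) := rfl

@[simp] lemma prod_mk (n : ℕ) (x y : Free k) :
    prod k n (Submodule.Quotient.mk x) (Submodule.Quotient.mk y) =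
      Submodule.Quotient.mk (Free.prod k n x y) := rfl

lemma D_prod (n : ℕ) (a b : U3 k) : prod k n (D k a) b = -(n • prod k (n - 1) a b) := by
  obtain ⟨a, rfl⟩ := Submodule.Quotient.mk_surjective _ a
  obtain ⟨b, rfl⟩ := Submodule.Quotient.mk_surjective _ b
  have := (Submodule.Quotient.mk_eq_zero _).2 (relator_mem k (Relator.D_prod n a b))
  rw [Submodule.Quotient.mk_add, Submodule.Quotient.mk_smul] at this
  simpa using eq_neg_of_add_eq_zero_left this

lemma prod_D (n : ℕ) (a b : U3 k) :
    prod k n a (D k b) = D k (prod k n a b) + n • prod k (n - 1) a b := by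
  obtain ⟨a, rfl⟩ := Submodule.Quotient.mk_surjective _ a
  obtain ⟨b, rfl⟩ := Submodule.Quotient.mk_surjective _ b
  exact (Submodule.Quotient.eq _).2 (relator_mem k (Relator.prod_D n a b))

lemma prod_assoc (n m : ℕ) (a b c : U3 k) : prod k n a (prod k m b c) =
    ∑ s ∈ range (n + 1), n.choose s • prod k (m + s) (prod k (n - s) a b) c := by
  obtain ⟨a, rfl⟩ := Submodule.Quotient.mk_surjective _ a
  obtain ⟨b, rfl⟩ := Submodule.Quotient.mk_surjective _ b
  obtain ⟨c, rfl⟩ := Submodule.Quotient.mk_surjective _ c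
  refine ((Submodule.Quotient.eq _).2 (relator_mem k (Relator.assoc n m a b c))).trans ?_
  exact map_sum (relIdeal k).mkQ _ _

lemma prod_v_v (n : ℕ) (hn : 3 ≤ n) : prod k n (v k) (v k) = 0 :=
  (Submodule.Quotient.mk_eq_zero _).2 (relator_mem k (Relator.loc n hn))

lemma vir : (2 : ℕ) • prod k 1 (v k) (v k) - D k (prod k 2 (v k) (v k)) = (2 : ℕ) • v k :=
  (Submodule.Quotient.eq _).2 (relator_mem k Relator.vir)

/-- Induction on elements of `U(3)`. -/
lemma induction {p : U3 k → Prop} (hv : p (v k)) (hD : ∀ a, p a → p (D k a))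
    (hprod : ∀ n a b, p a → p b → p (prod k n a b)) (h0 : p 0)
    (hadd : ∀ a b, p a → p b → p (a + b)) (hsmul : ∀ (c : k) a, p a → p (c • a))
    (a : U3 k) : p a := by
  have hmon : ∀ x : Mon, p (Submodule.Quotient.mk (Finsupp.single x 1)) := by
    intro x
    induction x with
    | v => exact hv
    | D x ih => simpa [Free.D] using hD _ ih
    | prod n x y ihx ihy => simpa [Free.prod] using hprod n _ _ ihx ihy
  obtain ⟨a, rfl⟩ := Submodule.Quotient.mk_surjective _ a
  induction a using Finsupp.induction_linear with
  | zero => exact h0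
  | add x y hx hy => exact hadd _ _ hx hy
  | single x c => simpa [← Submodule.Quotient.mk_smul] using hsmul c _ (hmon x)

/-- Mutual locality of two elements. -/
def Local (a b : U3 k) : Prop := ∃ N : ℕ, ∀ n, N ≤ n → prod k n a b = 0

lemma prod_prod_eq_zero {b c : U3 k} {N : ℕ} (h : ∀ n, N ≤ n → prod k n b c = 0) (a : U3 k)
    (n : ℕ) : ∀ m, N ≤ m → prod k m (prod k n a b) c = 0 := by
  induction n using Nat.strong_induction_on with
  | _ n ih =>
    intro m hm
    have := prod_assoc k n m a b c
    rw [h m hm, map_zero, Finset.sum_range_succ', Finset.sum_eq_zero] at this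
    · simpa using this.symm
    · intro s hs
      rw [Finset.mem_range] at hs
      rw [ih (n - (s + 1)) (by omega) _ (by omega), smul_zero]

lemma Local.prod_left {b c : U3 k} (h : Local k b c) (n : ℕ) (a : U3 k) :
    Local k (prod k n a b) c := by
  obtain ⟨N, hN⟩ := h
  exact ⟨N, prod_prod_eq_zero k hN a n⟩

lemma Local.prod_right {a b c : U3 k} (hab : Local k a b) (hbc : Local k b c) (n : ℕ) :
    Local k a (prod k n b c) := by
  obtain ⟨N, hN⟩ := hab
  obtain ⟨N', hN'⟩ := hbc
  refine ⟨N + N', fun m hm => ?_⟩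
  rw [prod_assoc]
  refine Finset.sum_eq_zero fun s hs => ?_
  rw [Finset.mem_range] at hs
  by_cases h : N' ≤ n + s
  · rw [prod_prod_eq_zero k hN' a (m - s) _ h, smul_zero]
  · rw [hN (m - s) (by omega)]
    simp

lemma Local.D_left {a b : U3 k} (h : Local k a b) : Local k (D k a) b := by
  obtain ⟨N, hN⟩ := h
  refine ⟨N + 1, fun n hn => ?_⟩
  rw [D_prod, hN (n - 1) (by omega)]
  simp

lemma Local.D_right {a b : U3 k} (h : Local k a b) : Local k a (D k b) := by
  obtain ⟨N, hN⟩ := h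
  refine ⟨N + 1, fun n hn => ?_⟩
  rw [prod_D, hN (n - 1) (by omega), hN n (by omega)]
  simp

lemma Local.add_left {a b c : U3 k} (h : Local k a c) (h' : Local k b c) :
    Local k (a + b) c := by
  obtain ⟨N, hN⟩ := h
  obtain ⟨N', hN'⟩ := h'
  exact ⟨N + N', fun n hn => by simp [hN n (by omega), hN' n (by omega)]⟩

lemma Local.add_right {a b c : U3 k} (h : Local k a b) (h' : Local k a c) :
    Local k a (b + c) := by
  obtain ⟨N, hN⟩ := h
  obtain ⟨N', hN'⟩ := h'
  exact ⟨N + N', fun n hn => by simp [hN n (by omega), hN' n (by omega)]⟩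

lemma local_all (a b : U3 k) : Local k a b := by
  have key : ∀ a, Local k a (v k) := by
    intro a
    induction a using U3.induction with
    | hv => exact ⟨3, prod_v_v k⟩
    | hD a h => exact h.D_left
    | hprod n a b _ h => exact h.prod_left k n a
    | h0 => exact ⟨0, by simp⟩
    | hadd a b h h' => exact h.add_left k h'
    | hsmul c a h =>
      obtain ⟨N, hN⟩ := h
      exact ⟨N, fun n hn => by simp [hN n hn]⟩
  induction b using U3.induction generalizing a with
  | hv => exact key a
  | hD b h => exact (h a).D_right
  | hprod n b c h h' => exact (h a).prod_right k (h' b) n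
  | h0 => exact ⟨0, by simp⟩
  | hadd b c h h' => exact (h a).add_right k (h' a)
  | hsmul c b h =>
    obtain ⟨N, hN⟩ := h a
    exact ⟨N, fun n hn => by simp [hN n hn]⟩

noncomputable instance : AssocConformalAlgebra k (U3 k) where
  D := D k
  prod := prod k
  locality := local_all k
  D_prod := D_prod k
  prod_D := prod_D k
  prod_assoc := prod_assoc k

end

end U3

/-! ### Sequences in an associative algebra

For a module `M` an element `a` acts by the sequence of operators `n ↦ a(n)` on `M`; the action of
`U(3)` determined by the action of `v` is built through the `n`-products of such sequences,
`(a ₍ₙ₎ b)(m) = ∑ₛ (-1)ˢ (n choose s) a(n - s) b(m + s)`. -/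

namespace OpSeq

section

variable (k : Type*) {A : Type*} [Field k] [Ring A] [Algebra k A]

/-- The shift `(S a)(n) = a(n + 1)`. -/
def shift : (ℕ → A) →ₗ[k] (ℕ → A) := LinearMap.funLeft k A Nat.succ

/-- The operator `(∂ a)(n) = - n a(n - 1)`. -/
def D : (ℕ → A) →ₗ[k] (ℕ → A) where
  toFun a n := -(n • a (n - 1))
  map_add' a b := by funext n; simp only [Pi.add_apply, smul_add]; abel
  map_smul' c a := by
    funext n
    simp only [Pi.smul_apply, RingHom.id_apply, smul_neg, smul_comm n c]

/-- The `n`-products of sequences, by the recursion `a ₍ₙ₊₁₎ b = S a ₍ₙ₎ b - a ₍ₙ₎ S b`. -/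
def prod : ℕ → (ℕ → A) →ₗ[k] (ℕ → A) →ₗ[k] (ℕ → A)
  | 0 => LinearMap.mk₂ k (fun a b m => a 0 * b m)
      (fun a b c => by funext m; simp [add_mul]) (fun c a b => by funext m; simp)
      (fun a b c => by funext m; simp [mul_add]) (fun c a b => by funext m; simp)
  | n + 1 => prod n ∘ₗ shift k - (prod n).compl₂ (shift k)

@[simp] lemma shift_apply (a : ℕ → A) (n : ℕ) : shift k a n = a (n + 1) := rfl

lemma D_apply (a : ℕ → A) (n : ℕ) : D k a n = -(n • a (n - 1)) := rfl

lemma prod_zero (a b : ℕ → A) (m : ℕ) : prod k 0 a b m = a 0 * b m := rfl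

lemma prod_succ (n : ℕ) (a b : ℕ → A) :
    prod k (n + 1) a b = prod k n (shift k a) b - prod k n a (shift k b) := rfl

lemma prod_apply (n : ℕ) (a b : ℕ → A) (m : ℕ) : prod k n a b m =
    ∑ s ∈ range (n + 1), ((-1 : ℤ) ^ s * n.choose s) • (a (n - s) * b (m + s)) := by
  induction n generalizing a b m with
  | zero => simp [prod_zero]
  | succ n ih =>
    have h := Finset.sum_choose_succ_nsmul
      (fun i j => ((-1 : ℤ) ^ i) • (a j * b (m + i))) n
    simp only [← natCast_zsmul, smul_smul, mul_comm _ ((-1 : ℤ) ^ _)] at h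
    rw [h, prod_succ, Pi.sub_apply, ih, ih, sub_eq_add_neg, ← Finset.sum_neg_distrib]
    congr 1
    · refine Finset.sum_congr rfl fun s hs => ?_
      rw [Finset.mem_range] at hs
      rw [shift_apply, show n - s + 1 = n + 1 - s by omega]
    · refine Finset.sum_congr rfl fun s hs => ?_
      rw [shift_apply, pow_succ, ← neg_smul, add_assoc]
      congr 1
      ring

lemma shift_prod (n : ℕ) (a b : ℕ → A) : shift k (prod k n a b) = prod k n a (shift k b) := by
  induction n generalizing a b with
  | zero => rfl
  | succ n ih => rw [prod_succ, map_sub, ih, ih, prod_succ]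

lemma shift_D (a : ℕ → A) : shift k (D k a) = D k (shift k a) - a := by
  funext n
  cases n with
  | zero => simp [D_apply]
  | succ n => simp [D_apply, add_smul]; abel

lemma D_prod (n : ℕ) (a b : ℕ → A) : prod k n (D k a) b = -(n • prod k (n - 1) a b) := by
  induction n generalizing a b with
  | zero => funext m; simp [prod_zero, D_apply]
  | succ n ih =>
    rw [prod_succ, shift_D, map_sub, LinearMap.sub_apply, ih, ih]
    cases n with
    | zero => simp
    | succ n => 
      simp only [Nat.add_sub_cancel, prod_succ k n, smul_sub, add_smul, one_smul]
      abel

lemma prod_D (n : ℕ) (a b : ℕ → A) :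
    prod k n a (D k b) = D k (prod k n a b) + n • prod k (n - 1) a b := by
  induction n generalizing a b with
  | zero => funext m; simp [prod_zero, D_apply, -nsmul_eq_mul]
  | succ n ih =>
    rw [prod_succ, shift_D, map_sub, ih, ih, prod_succ, map_sub]
    cases n with
    | zero => simp; abel
    | succ n => 
      simp only [Nat.add_sub_cancel, prod_succ k n, smul_sub, add_smul, one_smul]
      abel

/-- The relation `a(n) b(m) = ∑ₛ (n choose s) (a ₍ₙ₋ₛ₎ b)(m + s)`. -/
lemma mul_eq (n m : ℕ) (a b : ℕ → A) : a n * b m =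
    ∑ s ∈ range (n + 1), n.choose s • prod k (n - s) a b (m + s) := by
  induction n generalizing a m with
  | zero => simp [prod_zero]
  | succ n ih =>
    have h := Finset.sum_choose_succ_nsmul (fun i j => prod k j a b (m + i)) n
    rw [h, ← Finset.sum_add_distrib, show a (n + 1) = shift k a n from rfl, ih]
    refine Finset.sum_congr rfl fun s hs => ?_
    rw [Finset.mem_range] at hs
    rw [show n + 1 - s = n - s + 1 by omega, prod_succ, ← shift_prod, ← smul_add]
    simp [add_assoc]

lemma prod_assoc (n m : ℕ) (a b c : ℕ → A) : prod k n a (prod k m b c) =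
    ∑ s ∈ range (n + 1), n.choose s • prod k (m + s) (prod k (n - s) a b) c := by
  induction n generalizing a c with
  | zero =>
    simp only [Finset.range_one, Finset.sum_singleton, Nat.choose_self, one_smul, zero_add,
      Nat.sub_self, add_zero]
    have h0 : ∀ x y : ℕ → A, shift k (prod k 0 x y) = prod k 0 x (shift k y) :=
      fun x y => shift_prod k 0 x y
    induction m generalizing b c with
    | zero => funext p; simp [prod_zero, mul_assoc]
    | succ m ih => rw [prod_succ, map_sub, ih, ih, prod_succ, h0]
  | succ n ih =>
    have h := Finset.sum_choose_succ_nsmul (fun i j => prod k (m + i) (prod k j a b) c) n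
    rw [h, ← Finset.sum_add_distrib, prod_succ, shift_prod, ih, ih, ← Finset.sum_sub_distrib]
    refine Finset.sum_congr rfl fun s hs => ?_
    rw [Finset.mem_range] at hs
    rw [show n + 1 - s = n - s + 1 by omega, prod_succ k (n - s), map_sub, LinearMap.sub_apply,
      ← add_assoc, prod_succ k (m + s), shift_prod, ← smul_add, ← smul_sub]
    congr 1
    abel

end

end OpSeq

namespace U3

section

variable {k : Type*} {A : Type*} [Field k] [Ring A] [Algebra k A]

/-- The sequence attached to a monomial when the generator goes to `w`. -/
def monSeq (k : Type*) {A : Type*} [Field k] [Ring A] [Algebra k A] (w : ℕ → A) : Mon → (ℕ → A)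
  | Mon.v => w
  | Mon.D a => OpSeq.D k (monSeq k w a)
  | Mon.prod n a b => OpSeq.prod k n (monSeq k w a) (monSeq k w b)

noncomputable def freeSeq (w : ℕ → A) : Free k →ₗ[k] (ℕ → A) :=
  Finsupp.linearCombination k (monSeq k w)

lemma freeSeq_v (w : ℕ → A) : freeSeq w (Free.v k) = w := by
  simp [freeSeq, Free.v, monSeq]

lemma freeSeq_D (w : ℕ → A) (x : Free k) : freeSeq w (Free.D k x) = OpSeq.D k (freeSeq w x) := by
  induction x using Finsupp.induction_linear with
  | zero => simp
  | add x y hx hy => simp [hx, hy]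
  | single x c => simp [freeSeq, Free.D, monSeq]

lemma freeSeq_prod (w : ℕ → A) (n : ℕ) (x y : Free k) :
    freeSeq w (Free.prod k n x y) = OpSeq.prod k n (freeSeq w x) (freeSeq w y) := by
  induction x using Finsupp.induction_linear with
  | zero => simp
  | add x x' hx hy => simp [hx, hy]
  | single x c =>
    induction y using Finsupp.induction_linear with
    | zero => simp
    | add x x' hx hy => simp only [map_add, hx, hy]
    | single y d => 
      simp only [freeSeq, Free.prod, Finsupp.linearCombination_single, LinearMap.smul_apply,
        map_smul, Finsupp.lmapDomain_apply, Finsupp.mapDomain_single, monSeq, smul_smul,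
        mul_comm c d]

/-- A sequence `w` in an associative algebra that satisfies the defining relations of the
generator. -/
structure IsGenSeq (k : Type*) {A : Type*} [Field k] [Ring A] [Algebra k A] (w : ℕ → A) :
    Prop where
  loc : ∀ n, 3 ≤ n → OpSeq.prod k n w w = 0
  vir : (2 : ℕ) • OpSeq.prod k 1 w w - OpSeq.D k (OpSeq.prod k 2 w w) = (2 : ℕ) • w

lemma relIdeal_le_ker {w : ℕ → A} (hw : IsGenSeq k w) :
    relIdeal k ≤ LinearMap.ker (freeSeq (k := k) w) := by
  refine relIdeal_le k ⟨fun x hx => ?_, fun n x hx y => ?_, fun n x hx y => ?_⟩ fun x hx => ?_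
  · rw [LinearMap.mem_ker] at hx ⊢
    rw [freeSeq_D, hx, map_zero]
  · rw [LinearMap.mem_ker] at hx ⊢
    rw [freeSeq_prod, hx, map_zero, LinearMap.zero_apply]
  · rw [LinearMap.mem_ker] at hx ⊢
    rw [freeSeq_prod, hx, map_zero]
  · rw [LinearMap.mem_ker]
    cases hx with
    | D_prod n a b =>
      rw [map_add, map_nsmul, freeSeq_prod, freeSeq_prod, freeSeq_D, OpSeq.D_prod]
      exact neg_add_cancel _
    | prod_D n a b =>
      rw [map_sub, map_add, map_nsmul, freeSeq_D, freeSeq_prod, freeSeq_prod, freeSeq_prod,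
        freeSeq_D, OpSeq.prod_D, sub_self]
    | assoc n m a b c =>
      simp only [map_sub, map_sum, map_nsmul, freeSeq_prod]
      rw [OpSeq.prod_assoc, sub_self]
    | loc n hn => rw [freeSeq_prod, freeSeq_v, hw.loc n hn]
    | vir =>
      rw [map_sub, map_sub, map_nsmul, map_nsmul, freeSeq_D, freeSeq_prod, freeSeq_prod,
        freeSeq_v, hw.vir, sub_self]

/-- The sequence of coefficients attached to an element of `U(3)` when the generator goes to `w`. -/
noncomputable def seq {w : ℕ → A} (hw : IsGenSeq k w) : U3 k →ₗ[k] (ℕ → A) :=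
  (relIdeal k).liftQ (freeSeq w) (relIdeal_le_ker hw)

lemma seq_v {w : ℕ → A} (hw : IsGenSeq k w) : seq hw (v k) = w := freeSeq_v w

lemma seq_D {w : ℕ → A} (hw : IsGenSeq k w) (a : U3 k) :
    seq hw (D k a) = OpSeq.D k (seq hw a) := by
  obtain ⟨a, rfl⟩ := Submodule.Quotient.mk_surjective _ a
  exact freeSeq_D w a

lemma seq_prod {w : ℕ → A} (hw : IsGenSeq k w) (n : ℕ) (a b : U3 k) :
    seq hw (prod k n a b) = OpSeq.prod k n (seq hw a) (seq hw b) := by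
  obtain ⟨a, rfl⟩ := Submodule.Quotient.mk_surjective _ a
  obtain ⟨b, rfl⟩ := Submodule.Quotient.mk_surjective _ b
  exact freeSeq_prod w n a b

end

end U3

/-! ### The conformal modules `M_(α, Δ)` -/

/-- The underlying space `k[∂] u` of the module `M_(α, Δ)`; the variable `X` stands for `∂` and
`p(∂) u` is the polynomial `p`. -/
def VirModule (k : Type*) [Field k] (_α _Δ : k) := Polynomial k

namespace VirModule

section

open Polynomial

variable {k : Type*} [Field k] (α Δ : k)

noncomputable instance : AddCommGroup (VirModule k α Δ) := inferInstanceAs (AddCommGroup k[X])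

noncomputable instance : Module k (VirModule k α Δ) := inferInstanceAs (Module k k[X])

/-- Multiplication by a polynomial in `∂`. -/
noncomputable def mulOp (q : k[X]) : Module.End k (VirModule k α Δ) := LinearMap.mulLeft k q

/-- The derivative with respect to `∂`. -/
noncomputable def diff : Module.End k (VirModule k α Δ) := Polynomial.derivative

/-- The operators `v(n)` on `M_(α, Δ)`:
`v(n) p = (∂ + α) p⁽ⁿ⁾ + n Δ p⁽ⁿ⁻¹⁾`, that is, `n!` times the coefficient at `λⁿ` of
`v_λ (p(∂) u) = p(∂ + λ) (∂ + α + Δ λ) u`. -/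
noncomputable def vOp (n : ℕ) : Module.End k (VirModule k α Δ) :=
  mulOp α Δ (X + C α) * diff α Δ ^ n + (n : k) • Δ • diff α Δ ^ (n - 1)


/-- `v(n) p` is `n!` times the coefficient at `λⁿ` of `p(∂ + λ) (∂ + α + Δ λ)`; here the outer
variable is `λ`, the inner one is `∂`, and `taylor X (p.map C)` is `p(λ + ∂)`. -/
lemma vOp_eq_coeff (n : ℕ) (p : k[X]) : @Eq k[X] (vOp α Δ n p)
    (n.factorial • (taylor (X : k[X]) (p.map C) * (C (X + C α) + C (C Δ) * X)).coeff n) := by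
  have hm : ∀ n, hasseDeriv n (p.map (C : k →+* k[X])) = (hasseDeriv n p).map C := by
    intro n
    ext1 m
    simp only [hasseDeriv_coeff, coeff_map, map_mul, map_natCast]
  have hc : ∀ n, (taylor (X : k[X]) (p.map C)).coeff n = hasseDeriv n p := by
    intro n
    rw [taylor_coeff, hm, eval_map, eval₂_C_X]
  have hd : ∀ n, ((derivative : Module.End k k[X]) ^ n) p = n.factorial • hasseDeriv n p := by
    intro n
    have h := congrFun (factorial_smul_hasseDeriv (R := k) (k := n)) p
    rw [LinearMap.smul_apply] at h
    rw [h, Module.End.pow_apply]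
  have hv : @Eq k[X] (vOp α Δ n p)
      ((X + C α) * ((derivative : Module.End k k[X]) ^ n) p +
        (n : k) • Δ • ((derivative : Module.End k k[X]) ^ (n - 1)) p) := rfl
  refine hv.trans ?_
  rw [hd, hd, mul_add, coeff_add, coeff_mul_C, hc]
  cases n with
  | zero => simp [mul_comm p]
  | succ n =>
    rw [← mul_assoc, coeff_mul_X, coeff_mul_C, hc, Nat.add_sub_cancel, Nat.factorial_succ,
      smul_add]
    simp only [nsmul_eq_mul, smul_eq_C_mul, Nat.cast_mul, map_natCast]
    ring

/-- The sequences `E i n = n (n - 1) ⋯ (n - i + 1) ∂ⁿ⁻ⁱ`, where `∂` is `diff`. -/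
noncomputable def E (i n : ℕ) : Module.End k (VirModule k α Δ) :=
  n.descFactorial i • diff α Δ ^ (n - i)

lemma E_apply_eq (i n : ℕ) : E α Δ i n = n.descFactorial i • diff α Δ ^ (n - i) := rfl

/-- Multiplication of a sequence by an operator on the right. -/
noncomputable def mulR (T : Module.End k (VirModule k α Δ)) (a : ℕ → Module.End k (VirModule k α Δ)) :
    ℕ → Module.End k (VirModule k α Δ) := fun n => a n * T

noncomputable def mulL (T : Module.End k (VirModule k α Δ)) (a : ℕ → Module.End k (VirModule k α Δ)) :
    ℕ → Module.End k (VirModule k α Δ) := fun n => T * a n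

lemma shift_E_zero : OpSeq.shift k (E α Δ 0) = mulR α Δ (diff α Δ) (E α Δ 0) := by
  funext n
  simp [E, mulR, pow_succ]

lemma shift_E_succ (i : ℕ) : OpSeq.shift k (E α Δ (i + 1)) =
    mulR α Δ (diff α Δ) (E α Δ (i + 1)) + (i + 1) • E α Δ i := by
  funext n
  simp only [OpSeq.shift_apply, E, mulR, Pi.add_apply, Pi.smul_apply, smul_mul_assoc, smul_smul,
    Nat.add_sub_add_right]
  rcases Nat.lt_or_ge n (i + 1) with h | h
  · rw [Nat.descFactorial_of_lt h, zero_smul, zero_add]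
    congr 1
    rcases Nat.lt_or_ge n i with h' | h'
    · rw [Nat.descFactorial_of_lt h', Nat.descFactorial_of_lt (by omega), mul_zero]
    · obtain rfl : n = i := by omega
      rw [Nat.descFactorial_self, Nat.descFactorial_self, Nat.factorial_succ]
  · rw [← pow_succ, show n - (i + 1) + 1 = n - i by omega, ← add_smul]
    congr 1
    rw [Nat.succ_descFactorial_succ, Nat.descFactorial_succ]
    zify [show i ≤ n by omega]
    ring

lemma prod_mulR_left (n : ℕ) (T : Module.End k (VirModule k α Δ))
    (a b : ℕ → Module.End k (VirModule k α Δ)) :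
    OpSeq.prod k n (mulR α Δ T a) b = OpSeq.prod k n a (mulL α Δ T b) := by
  funext m
  simp only [OpSeq.prod_apply, mulR, mulL, mul_assoc]

lemma prod_mulL_left (n : ℕ) (T : Module.End k (VirModule k α Δ))
    (a b : ℕ → Module.End k (VirModule k α Δ)) :
    OpSeq.prod k n (mulL α Δ T a) b = mulL α Δ T (OpSeq.prod k n a b) := by
  funext m
  simp only [OpSeq.prod_apply, mulL, mul_assoc, Finset.mul_sum, mul_smul_comm]

lemma mulL_diff_E (i : ℕ) : mulL α Δ (diff α Δ) (E α Δ i) = mulR α Δ (diff α Δ) (E α Δ i) := by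
  funext n
  simp only [mulL, mulR, E, ← pow_succ, ← pow_succ', mul_smul_comm, smul_mul_assoc]

/-- `E i ₍ₙ₊₁₎ E j = i E (i-1) ₍ₙ₎ E j - j E i ₍ₙ₎ E (j-1)`. -/
lemma prod_E_succ (n i j : ℕ) : OpSeq.prod k (n + 1) (E α Δ i) (E α Δ j) =
    i • OpSeq.prod k n (E α Δ (i - 1)) (E α Δ j) -
      j • OpSeq.prod k n (E α Δ i) (E α Δ (j - 1)) := by
  rw [OpSeq.prod_succ]
  have hs : ∀ i, OpSeq.shift k (E α Δ i) = mulR α Δ (diff α Δ) (E α Δ i) + i • E α Δ (i - 1) := by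
    intro i
    cases i with
    | zero => simp [shift_E_zero]
    | succ i => exact shift_E_succ α Δ i
  rw [hs, hs, map_add, LinearMap.add_apply, prod_mulR_left, mulL_diff_E, map_add, map_nsmul,
    LinearMap.smul_apply, map_nsmul]
  abel

lemma prod_E_eq_zero (n i j : ℕ) (h : i + j < n) :
    OpSeq.prod k n (E α Δ i) (E α Δ j) = 0 := by
  induction n generalizing i j with
  | zero => omega
  | succ n ih =>
    rw [prod_E_succ]
    have h1 : i • OpSeq.prod k n (E α Δ (i - 1)) (E α Δ j) = 0 := by
      rcases Nat.eq_zero_or_pos i with rfl | hi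
      · exact zero_smul _ _
      · rw [ih _ _ (by omega), smul_zero]
    have h2 : j • OpSeq.prod k n (E α Δ i) (E α Δ (j - 1)) = 0 := by
      rcases Nat.eq_zero_or_pos j with rfl | hj
      · exact zero_smul _ _
      · rw [ih _ _ (by omega), smul_zero]
    rw [h1, h2, sub_zero]

lemma prod_zero_E_zero (j : ℕ) : OpSeq.prod k 0 (E α Δ 0) (E α Δ j) = E α Δ j := by
  funext m
  simp [OpSeq.prod_zero, E_apply_eq α Δ 0]

lemma prod_zero_E_succ (i j : ℕ) : OpSeq.prod k 0 (E α Δ (i + 1)) (E α Δ j) = 0 := by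
  funext m
  simp [OpSeq.prod_zero, E_apply_eq α Δ (i + 1)]

lemma diff_mulOp (q : k[X]) : diff α Δ * mulOp α Δ q =
    mulOp α Δ q * diff α Δ + mulOp α Δ (derivative q) := by
  refine LinearMap.ext fun (p : k[X]) => ?_
  change derivative (q * p) = q * derivative p + derivative q * p
  rw [derivative_mul, add_comm]

lemma diff_pow_mulOp (c : k) (n : ℕ) : diff α Δ ^ n * mulOp α Δ (X + C c) =
    mulOp α Δ (X + C c) * diff α Δ ^ n + n • diff α Δ ^ (n - 1) := by
  have h1 : mulOp α Δ (1 : k[X]) = 1 := LinearMap.ext fun (p : k[X]) => one_mul p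
  induction n with
  | zero => simp
  | succ n ih =>
    have h2 : n • diff α Δ ^ (n - 1) * diff α Δ = n • diff α Δ ^ n := by
      cases n with
      | zero => simp
      | succ n => rw [smul_mul_assoc, ← pow_succ, Nat.add_sub_cancel]
    rw [pow_succ, mul_assoc, diff_mulOp, mul_add, ← mul_assoc, ih, add_mul, h2]
    simp only [derivative_add, derivative_X, derivative_C, add_zero, h1, mul_one,
      Nat.add_sub_cancel, add_smul, one_smul, mul_assoc]
    abel

lemma mulR_E (c : k) (i : ℕ) : mulR α Δ (mulOp α Δ (X + C c)) (E α Δ i) =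
    mulL α Δ (mulOp α Δ (X + C c)) (E α Δ i) + E α Δ (i + 1) := by
  funext n
  simp only [mulR, mulL, E, Pi.add_apply, smul_mul_assoc, mul_smul_comm, diff_pow_mulOp, smul_add,
    Nat.descFactorial_succ, smul_smul]
  rw [Nat.sub_sub, mul_comm]

lemma vOp_eq : vOp α Δ = mulL α Δ (mulOp α Δ (X + C α)) (E α Δ 0) + Δ • E α Δ 1 := by
  funext n
  simp only [vOp, mulL, E, Pi.add_apply, Pi.smul_apply, Nat.descFactorial_zero, one_smul,
    Nat.descFactorial_one, Nat.sub_zero, Nat.cast_smul_eq_nsmul k]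
  rw [smul_comm]

lemma D_E_zero : OpSeq.D k (E α Δ 0) = -E α Δ 1 := by
  funext n
  simp [OpSeq.D_apply, E]

lemma prod_vOp (n : ℕ) : OpSeq.prod k n (vOp α Δ) (vOp α Δ) =
    mulL α Δ (mulOp α Δ (X + C α)) (mulL α Δ (mulOp α Δ (X + C α))
        (OpSeq.prod k n (E α Δ 0) (E α Δ 0)) + OpSeq.prod k n (E α Δ 1) (E α Δ 0) +
        Δ • OpSeq.prod k n (E α Δ 0) (E α Δ 1) + Δ • OpSeq.prod k n (E α Δ 1) (E α Δ 0)) +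
      Δ • OpSeq.prod k n (E α Δ 2) (E α Δ 0) +
      (Δ * Δ) • OpSeq.prod k n (E α Δ 1) (E α Δ 1) := by
  have hL : ∀ (T : Module.End k (VirModule k α Δ)) a b, mulL α Δ T (a + b) =
      mulL α Δ T a + mulL α Δ T b := fun T a b => by funext m; simp [mulL, mul_add]
  have hS : ∀ (T : Module.End k (VirModule k α Δ)) (c : k) a, mulL α Δ T (c • a) =
      c • mulL α Δ T a := fun T c a => by funext m; simp [mulL]
  have hR : ∀ T a, mulR α Δ T (mulL α Δ T a) = mulL α Δ T (mulR α Δ T a) :=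
    fun T a => by funext m; simp [mulL, mulR, mul_assoc]
  simp only [vOp_eq, map_add, map_smul, LinearMap.add_apply, LinearMap.smul_apply,
    ← prod_mulR_left, hR, mulR_E, prod_mulL_left, hL, hS, smul_add, smul_smul]
  rw [show (1 : ℕ) + 1 = 2 from rfl, show (0 : ℕ) + 1 = 1 from rfl]
  abel

lemma isGenSeq_vOp : U3.IsGenSeq k (vOp α Δ) where
  loc n hn := by
    have h0 : ∀ T : Module.End k (VirModule k α Δ), mulL α Δ T 0 = 0 :=
      fun T => by funext m; simp [mulL]
    rw [prod_vOp, prod_E_eq_zero α Δ n 0 0 (by omega), prod_E_eq_zero α Δ n 1 0 (by omega),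
      prod_E_eq_zero α Δ n 0 1 (by omega), prod_E_eq_zero α Δ n 2 0 (by omega),
      prod_E_eq_zero α Δ n 1 1 (by omega)]
    simp [h0]
  vir := by
    have h0 : ∀ T : Module.End k (VirModule k α Δ), mulL α Δ T 0 = 0 :=
      fun T => by funext m; simp [mulL]
    rw [prod_vOp, prod_vOp, prod_E_eq_zero α Δ 2 0 0 (by omega),
      prod_E_eq_zero α Δ 2 1 0 (by omega), prod_E_eq_zero α Δ 2 0 1 (by omega),
      prod_E_eq_zero α Δ 1 0 0 (by omega)]
    have f10 : OpSeq.prod k 1 (E α Δ 1) (E α Δ 0) = E α Δ 0 := by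
      simp [prod_E_succ, prod_zero_E_zero]
    have f01 : OpSeq.prod k 1 (E α Δ 0) (E α Δ 1) = -E α Δ 0 := by
      simp [prod_E_succ, prod_zero_E_zero]
    have f20 : OpSeq.prod k 1 (E α Δ 2) (E α Δ 0) = 0 := by
      simp [prod_E_succ, prod_zero_E_succ α Δ 0]
    have f11 : OpSeq.prod k 1 (E α Δ 1) (E α Δ 1) = E α Δ 1 := by
      simp [prod_E_succ, prod_zero_E_zero, prod_zero_E_succ α Δ 0]
    have e20 : OpSeq.prod k 2 (E α Δ 2) (E α Δ 0) = (2 : ℕ) • E α Δ 0 := by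
      rw [prod_E_succ α Δ 1, f10, zero_smul, sub_zero]
    have e11 : OpSeq.prod k 2 (E α Δ 1) (E α Δ 1) = -((2 : ℕ) • E α Δ 0) := by
      rw [prod_E_succ α Δ 1, f10, f01, one_smul, one_smul, two_smul]
      abel
    rw [e20, e11, f10, f01, f20, f11, vOp_eq]
    simp only [h0, map_add, map_smul, map_neg, map_nsmul, D_E_zero, zero_add, smul_zero, add_zero,
      smul_neg, neg_add_cancel_right, neg_neg]
    module

/-- The operators `a(n)` on `M_(α, Δ)` for `a ∈ U(3)`. -/
noncomputable def act (n : ℕ) : U3 k →ₗ[k] Module.End k (VirModule k α Δ) :=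
  LinearMap.proj n ∘ₗ U3.seq (isGenSeq_vOp α Δ)

/-- The translation operator: multiplication by `∂`. -/
noncomputable def D : Module.End k (VirModule k α Δ) := mulOp α Δ X

lemma act_v (n : ℕ) : act α Δ n (U3.v k) = vOp α Δ n := congrFun (U3.seq_v (isGenSeq_vOp α Δ)) n

lemma act_Dl (n : ℕ) (a : U3 k) : act α Δ n (U3.D k a) = -(n • act α Δ (n - 1) a) :=
  congrFun (U3.seq_D (isGenSeq_vOp α Δ) a) n

lemma act_prod (n m : ℕ) (a b : U3 k) : act α Δ m (U3.prod k n a b) =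
    ∑ s ∈ range (n + 1), ((-1 : ℤ) ^ s * n.choose s) • (act α Δ (n - s) a * act α Δ (m + s) b) := by
  have h := congrFun (U3.seq_prod (isGenSeq_vOp α Δ) n a b) m
  rw [OpSeq.prod_apply] at h
  exact h

lemma act_mul_act (n m : ℕ) (a b : U3 k) : act α Δ n a * act α Δ m b =
    ∑ s ∈ range (n + 1), n.choose s • act α Δ (m + s) (U3.prod k (n - s) a b) := by
  have h := OpSeq.mul_eq k n m (U3.seq (isGenSeq_vOp α Δ) a) (U3.seq (isGenSeq_vOp α Δ) b)
  simp only [← U3.seq_prod] at h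
  exact h

lemma diff_pow_eq_zero (p : VirModule k α Δ) : ∃ N, ∀ n, N ≤ n → (diff α Δ ^ n) p = 0 := by
  refine ⟨natDegree (p : k[X]) + 1, fun n hn => ?_⟩
  rw [Module.End.pow_apply]
  exact iterate_derivative_eq_zero hn

lemma act_locality (a : U3 k) (p : VirModule k α Δ) :
    ∃ N, ∀ n, N ≤ n → act α Δ n a p = 0 := by
  induction a using U3.induction generalizing p with
  | hv =>
    obtain ⟨N, hN⟩ := diff_pow_eq_zero α Δ p
    refine ⟨N + 1, fun n hn => ?_⟩
    rw [act_v, vOp, LinearMap.add_apply, Module.End.mul_apply, hN n (by omega),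
      LinearMap.smul_apply, LinearMap.smul_apply, hN (n - 1) (by omega)]
    simp
  | hD a h =>
    obtain ⟨N, hN⟩ := h p
    refine ⟨N + 1, fun n hn => ?_⟩
    rw [act_Dl, LinearMap.neg_apply, LinearMap.smul_apply, hN (n - 1) (by omega)]
    simp
  | hprod n a b _ h =>
    obtain ⟨N, hN⟩ := h p
    refine ⟨N, fun m hm => ?_⟩
    rw [act_prod, LinearMap.sum_apply]
    refine Finset.sum_eq_zero fun s _ => ?_
    rw [LinearMap.smul_apply, Module.End.mul_apply, hN (m + s) (by omega)]
    simp
  | h0 => exact ⟨0, by simp⟩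
  | hadd a b h h' =>
    obtain ⟨N, hN⟩ := h p
    obtain ⟨N', hN'⟩ := h' p
    exact ⟨N + N', fun n hn => by simp [hN n (by omega), hN' n (by omega)]⟩
  | hsmul c a h =>
    obtain ⟨N, hN⟩ := h p
    exact ⟨N, fun n hn => by simp [hN n hn]⟩

lemma act_D (n : ℕ) (a : U3 k) : act α Δ n a * D α Δ =
    D α Δ * act α Δ n a + n • act α Δ (n - 1) a := by
  suffices h : ∀ n, act α Δ n a * D α Δ - D α Δ * act α Δ n a + act α Δ n (U3.D k a) = 0 by
    have := h n
    rw [act_Dl] at this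
    rw [← sub_eq_zero, ← this]
    abel
  induction a using U3.induction with
  | hv =>
    intro n
    have hX : D α Δ = mulOp α Δ (X + C 0) := by rw [C_0, add_zero, D]
    have hc : mulOp α Δ (X + C 0) * mulOp α Δ (X + C α) =
        mulOp α Δ (X + C α) * mulOp α Δ (X + C 0) := by
      refine LinearMap.ext fun (p : k[X]) => ?_
      change (X + C 0) * ((X + C α) * p) = (X + C α) * ((X + C 0) * p)
      ring
    rw [act_Dl, act_v, act_v, hX]
    simp only [vOp, add_mul, mul_add, smul_mul_assoc, mul_smul_comm, mul_assoc, diff_pow_mulOp]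
    rw [← mul_assoc, ← mul_assoc, hc]
    rcases n with _ | n
    · simp
    · simp only [Nat.add_sub_cancel, ← Nat.cast_smul_eq_nsmul k, smul_add]
      rw [smul_comm Δ (n : k)]
      abel
  | hD a h =>
    intro n
    have := congrArg (fun x => -(n • x)) (h (n - 1))
    simp only [smul_zero, neg_zero] at this
    rw [act_Dl α Δ n (U3.D k a), act_Dl α Δ n a, ← this]
    simp only [smul_add, smul_sub, neg_mul, mul_neg, smul_mul_assoc, mul_smul_comm]
    abel
  | hprod n a b ha hb =>
    intro m
    have hder : U3.D k (U3.prod k n a b) =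
        U3.prod k n (U3.D k a) b + U3.prod k n a (U3.D k b) := by
      rw [U3.D_prod, U3.prod_D]
      abel
    rw [hder, map_add, act_prod, act_prod, act_prod, Finset.sum_mul, Finset.mul_sum,
      ← Finset.sum_sub_distrib, ← Finset.sum_add_distrib, ← Finset.sum_add_distrib]
    refine Finset.sum_eq_zero fun s _ => ?_
    rw [smul_mul_assoc, mul_smul_comm, ← smul_sub, ← smul_add, ← smul_add]
    have h1 := congrArg (fun x => x * act α Δ (m + s) b) (ha (n - s))
    have h2 := congrArg (fun x => act α Δ (n - s) a * x) (hb (m + s))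
    simp only [zero_mul, mul_zero] at h1 h2
    refine (congrArg _ ?_).trans (smul_zero _)
    refine Eq.trans ?_ ((congrArg₂ (· + ·) h1 h2).trans (add_zero 0))
    noncomm_ring
  | h0 => simp
  | hadd a b h h' =>
    intro n
    refine Eq.trans ?_ ((congrArg₂ (· + ·) (h n) (h' n)).trans (add_zero 0))
    simp only [map_add, add_mul, mul_add]
    abel
  | hsmul c a h =>
    intro n
    refine Eq.trans ?_ ((congrArg (c • ·) (h n)).trans (smul_zero c))
    simp only [map_smul, smul_mul_assoc, mul_smul_comm, smul_add, smul_sub]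

noncomputable instance : ConformalModule k (U3 k) (VirModule k α Δ) where
  D := D α Δ
  act := act α Δ
  locality := act_locality α Δ
  D_act n a u := LinearMap.congr_fun (act_Dl α Δ n a) u
  act_D n a u := LinearMap.congr_fun (act_D α Δ n a) u
  act_act n m a b u := by
    have h := LinearMap.congr_fun (act_mul_act α Δ n m a b) u
    rw [LinearMap.sum_apply] at h
    exact h

end

end VirModule

/-! ### Hochschild cohomology -/

namespace ConformalHochschild

section

variable (k : Type*) (C : Type*) (M : Type*) [Field k] [AddCommGroup C] [Module k C]
  [AssocConformalAlgebra k C] [AddCommGroup M] [Module k M] [ConformalModule k C M]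

/-- The space of the basic `n`-cochains `φ_λ̄ : C^{⊗ n} → M[λ₁, …, λₙ]`.
A polynomial `∑ₘ (λ₁^{m₁} ⋯ λₙ^{mₙ} / (m₁! ⋯ mₙ!)) u_m` with coefficients in `M` is stored as the
finitely supported family `m ↦ u_m`; multiplication by `-λᵢ` then sends the family `u` to
`m ↦ -mᵢ u_{m - eᵢ}`, and the second condition is the conformal anti-linearity
`φ_λ̄ (a₁, …, ∂ aᵢ, …, aₙ) = -λᵢ φ_λ̄ (a₁, …, aₙ)`. -/
def basicCochain (n : ℕ) : Submodule k (MultilinearMap k (fun _ : Fin n => C) ((Fin n → ℕ) → M)) where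
  carrier := {φ | (∀ a, {m | φ a m ≠ 0}.Finite) ∧
    ∀ (a : Fin n → C) (i : Fin n) (m : Fin n → ℕ),
      φ (Function.update a i (AssocConformalAlgebra.D (k := k) (a i))) m =
        -(m i • φ a (Function.update m i (m i - 1)))}
  add_mem' := by
    rintro φ ψ ⟨h1, h2⟩ ⟨h3, h4⟩
    refine ⟨fun a => ((h1 a).union (h3 a)).subset fun m hm => ?_, fun a i m => ?_⟩
    · by_contra h
      simp only [Set.mem_union, Set.mem_ofPred_eq, not_or, not_not] at h
      exact hm (by simp [h.1, h.2])
    · simp only [add_apply, Pi.add_apply, h2, h4, smul_add]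
      abel
  zero_mem' := ⟨fun a => by simp, fun a i m => by simp⟩
  smul_mem' := by
    rintro c φ ⟨h1, h2⟩
    refine ⟨fun a => (h1 a).subset fun m hm h => hm (by simp_all), fun a i m => ?_⟩
    simp only [smul_apply, Pi.smul_apply, h2, smul_neg, smul_comm c]

variable {k C M}

/-- The Hochschild differential
`(d φ)_λ̄ (a₁, …, aₙ₊₁) = a₁ _{λ₁} φ (a₂, …, aₙ₊₁) +
  ∑ᵢ (-1)ⁱ φ_{(…, λᵢ + λᵢ₊₁, …)} (a₁, …, aᵢ _{λᵢ} aᵢ₊₁, …, aₙ₊₁)`,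
in terms of the coefficients at `λ₁^{m₁} ⋯ / (m₁! ⋯)`: the coefficient of
`φ_{(…, λᵢ + λᵢ₊₁, …)} (…, aᵢ _{λᵢ} aᵢ₊₁, …)` is
`∑ₛ (mᵢ choose s) φ (…, aᵢ ₍ₛ₎ aᵢ₊₁, …)` at `(…, mᵢ + mᵢ₊₁ - s, …)`. The index `i` below starts
from `0`. -/
def dFun {n : ℕ} (φ : (Fin n → C) → (Fin n → ℕ) → M) (a : Fin (n + 1) → C)
    (m : Fin (n + 1) → ℕ) : M :=
  ConformalModule.act (k := k) (m 0) (a 0) (φ (Fin.tail a) (Fin.tail m)) +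
    ∑ i : Fin n, (-1 : ℤ) ^ ((i : ℕ) + 1) • ∑ s ∈ range (m i.castSucc + 1),
      (m i.castSucc).choose s •
        φ (Fin.contractNth i.castSucc (fun x y => AssocConformalAlgebra.prod (k := k) s x y) a)
          (Fin.contractNth i.castSucc (fun p q => p + q - s) m)

/-! Contraction of adjacent entries and `Function.update`. -/

section Contract

variable {α : Type*} {n : ℕ}

lemma contract_self (op : α → α → α) (i : Fin n) (a : Fin (n + 1) → α) :
    Fin.contractNth i.castSucc op a i = op (a i.castSucc) (a i.succ) :=
  Fin.contractNth_apply_of_eq _ _ _ _ rfl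

lemma contract_of_lt (op : α → α → α) {i j : Fin n} (h : j < i) (a : Fin (n + 1) → α) :
    Fin.contractNth i.castSucc op a j = a j.castSucc :=
  Fin.contractNth_apply_of_lt _ _ _ _ h

lemma contract_of_gt (op : α → α → α) {i j : Fin n} (h : i < j) (a : Fin (n + 1) → α) :
    Fin.contractNth i.castSucc op a j = a j.succ :=
  Fin.contractNth_apply_of_gt _ _ _ _ h

lemma contract_update_left (op : α → α → α) (i : Fin n) (a : Fin (n + 1) → α) (x : α) :
    Fin.contractNth i.castSucc op (Function.update a i.castSucc x) =
      Function.update (Fin.contractNth i.castSucc op a) i (op x (a i.succ)) := by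
  funext j
  rcases lt_trichotomy j i with h | rfl | h
  · rw [contract_of_lt op h, Function.update_of_ne h.ne, contract_of_lt op h,
      Function.update_of_ne (by simpa using h.ne)]
  · rw [contract_self, Function.update_self, Function.update_self,
      Function.update_of_ne (by simp [Fin.ext_iff])]
  · rw [contract_of_gt op h, Function.update_of_ne h.ne', contract_of_gt op h,
      Function.update_of_ne]
    rw [Ne, Fin.ext_iff, Fin.val_succ, Fin.val_castSucc]
    have : (i : ℕ) < j := h
    omega

lemma contract_update_right (op : α → α → α) (i : Fin n) (a : Fin (n + 1) → α) (x : α) :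
    Fin.contractNth i.castSucc op (Function.update a i.succ x) =
      Function.update (Fin.contractNth i.castSucc op a) i (op (a i.castSucc) x) := by
  funext j
  rcases lt_trichotomy j i with h | rfl | h
  · rw [contract_of_lt op h, Function.update_of_ne h.ne, contract_of_lt op h,
      Function.update_of_ne]
    rw [Ne, Fin.ext_iff, Fin.val_succ, Fin.val_castSucc]
    have : (j : ℕ) < i := h
    omega
  · rw [contract_self, Function.update_self, Function.update_self,
      Function.update_of_ne (by simp [Fin.ext_iff])]
  · rw [contract_of_gt op h, Function.update_of_ne h.ne', contract_of_gt op h,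
      Function.update_of_ne (by simpa using h.ne')]

lemma contract_update_of_lt (op : α → α → α) {i j : Fin n} (hj : j < i) (a : Fin (n + 1) → α)
    (x : α) : Fin.contractNth i.castSucc op (Function.update a j.castSucc x) =
      Function.update (Fin.contractNth i.castSucc op a) j x := by
  have hj' : (j : ℕ) < i := hj
  funext l
  rcases lt_trichotomy l i with h | rfl | h
  · rw [contract_of_lt op h]
    rcases eq_or_ne l j with rfl | hl
    · simp
    · rw [Function.update_of_ne hl, contract_of_lt op h, Function.update_of_ne (by simpa using hl)]
  · rw [contract_self, Function.update_of_ne hj.ne', contract_self, Function.update_of_ne,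
      Function.update_of_ne] <;>
    · rw [Ne, Fin.ext_iff]
      simp
      omega
  · have hl : (i : ℕ) < l := h
    rw [contract_of_gt op h, Function.update_of_ne (hj.trans h).ne', contract_of_gt op h,
      Function.update_of_ne]
    rw [Ne, Fin.ext_iff]
    simp
    omega

lemma contract_update_of_gt (op : α → α → α) {i j : Fin n} (hj : i < j) (a : Fin (n + 1) → α)
    (x : α) : Fin.contractNth i.castSucc op (Function.update a j.succ x) =
      Function.update (Fin.contractNth i.castSucc op a) j x := by
  have hj' : (i : ℕ) < j := hj
  funext l
  rcases lt_trichotomy l i with h | rfl | h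
  · have hl : (l : ℕ) < i := h
    rw [contract_of_lt op h, Function.update_of_ne (h.trans hj).ne, contract_of_lt op h,
      Function.update_of_ne]
    rw [Ne, Fin.ext_iff]
    simp
    omega
  · rw [contract_self, Function.update_of_ne hj.ne, contract_self, Function.update_of_ne,
      Function.update_of_ne] <;>
    · rw [Ne, Fin.ext_iff]
      simp
      omega
  · rw [contract_of_gt op h]
    rcases eq_or_ne l j with rfl | hl
    · simp
    · rw [Function.update_of_ne hl, contract_of_gt op h, Function.update_of_ne (by simpa using hl)]

lemma index_cases (i : Fin n) (j : Fin (n + 1)) : (∃ l, l < i ∧ j = l.castSucc) ∨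
    j = i.castSucc ∨ j = i.succ ∨ ∃ l, i < l ∧ j = l.succ := by
  rcases lt_trichotomy (j : ℕ) i with h | h | h
  · exact Or.inl ⟨⟨j, by omega⟩, h, rfl⟩
  · exact Or.inr (Or.inl (Fin.ext h))
  · rcases Nat.lt_or_ge ((i : ℕ) + 1) j with h' | h'
    · refine Or.inr (Or.inr (Or.inr ⟨⟨j - 1, by omega⟩, ?_, ?_⟩))
      · change (i : ℕ) < j - 1
        omega
      · rw [Fin.ext_iff, Fin.val_succ]
        simp
        omega
    · refine Or.inr (Or.inr (Or.inl (Fin.ext ?_)))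
      rw [Fin.val_succ]
      omega

lemma tail_update_zero (a : Fin (n + 1) → α) (x : α) :
    Fin.tail (Function.update a 0 x) = Fin.tail a := by
  funext j
  simp [Fin.tail, Fin.succ_ne_zero]

lemma tail_update_succ (a : Fin (n + 1) → α) (j : Fin n) (x : α) :
    Fin.tail (Function.update a j.succ x) = Function.update (Fin.tail a) j x := by
  funext l
  rcases eq_or_ne l j with rfl | hl
  · simp [Fin.tail]
  · rw [Function.update_of_ne hl, Fin.tail, Function.update_of_ne (by simpa using hl), Fin.tail]

end Contract

/-- Replacing one argument before a contraction amounts to replacing one argument after it, by an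
expression that is linear in the new entry. -/
lemma exists_contract_update {n : ℕ} (s : ℕ) (i : Fin n) (j : Fin (n + 1)) (a : Fin (n + 1) → C) :
    ∃ (l : Fin n) (f : C →ₗ[k] C) (b : Fin n → C), ∀ x : C,
      Fin.contractNth i.castSucc (fun x y => AssocConformalAlgebra.prod (k := k) s x y)
        (Function.update a j x) = Function.update b l (f x) := by
  rcases index_cases i j with ⟨l, hl, rfl⟩ | rfl | rfl | ⟨l, hl, rfl⟩
  · exact ⟨l, LinearMap.id, _, fun x => contract_update_of_lt _ hl a x⟩
  · exact ⟨i, (AssocConformalAlgebra.prod (k := k) s).flip (a i.succ), _,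
      fun x => contract_update_left _ i a x⟩
  · exact ⟨i, AssocConformalAlgebra.prod (k := k) s (a i.castSucc), _,
      fun x => contract_update_right _ i a x⟩
  · exact ⟨l, LinearMap.id, _, fun x => contract_update_of_gt _ hl a x⟩

lemma isLinearMap_dFun {n : ℕ} (φ : MultilinearMap k (fun _ : Fin n => C) ((Fin n → ℕ) → M))
    (a : Fin (n + 1) → C) (j : Fin (n + 1)) (m : Fin (n + 1) → ℕ) :
    ∃ f : C →ₗ[k] M, ∀ x, dFun (k := k) φ (Function.update a j x) m = f x := by
  have h1 : ∃ f : C →ₗ[k] M, ∀ x, ConformalModule.act (k := k) (m 0) (Function.update a j x 0)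
      (φ (Fin.tail (Function.update a j x)) (Fin.tail m)) = f x := by
    rcases Fin.eq_zero_or_eq_succ j with rfl | ⟨j, rfl⟩
    · exact ⟨(ConformalModule.act (k := k) (m 0)).flip (φ (Fin.tail a) (Fin.tail m)),
        fun x => by rw [tail_update_zero, Function.update_self]; rfl⟩
    · refine ⟨ConformalModule.act (k := k) (m 0) (a 0) ∘ₗ
        LinearMap.proj (Fin.tail m) ∘ₗ φ.toLinearMap (Fin.tail a) j, fun x => ?_⟩
      rw [tail_update_succ, Function.update_of_ne (Fin.succ_ne_zero j).symm]
      rfl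
  have h2 : ∀ (i : Fin n) (s : ℕ), ∃ f : C →ₗ[k] M, ∀ x,
      φ (Fin.contractNth i.castSucc (fun x y => AssocConformalAlgebra.prod (k := k) s x y)
        (Function.update a j x)) (Fin.contractNth i.castSucc (fun p q => p + q - s) m) = f x := by
    intro i s
    obtain ⟨l, f, b, h⟩ := exists_contract_update (k := k) s i j a
    exact ⟨LinearMap.proj (Fin.contractNth i.castSucc (fun p q => p + q - s) m) ∘ₗ
      φ.toLinearMap b l ∘ₗ f, fun x => by rw [h]; rfl⟩
  obtain ⟨f, hf⟩ := h1
  choose g hg using h2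
  refine ⟨f + ∑ i : Fin n, (-1 : ℤ) ^ ((i : ℕ) + 1) • ∑ s ∈ range (m i.castSucc + 1),
    (m i.castSucc).choose s • g i s, fun x => ?_⟩
  simp only [dFun, hf, hg, LinearMap.add_apply, LinearMap.sum_apply, LinearMap.smul_apply]

/-- The Hochschild differential on multilinear maps. -/
def dMulti (n : ℕ) : MultilinearMap k (fun _ : Fin n => C) ((Fin n → ℕ) → M) →ₗ[k]
    MultilinearMap k (fun _ : Fin (n + 1) => C) ((Fin (n + 1) → ℕ) → M) where
  toFun φ :=
    { toFun := dFun (k := k) φ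
      map_update_add' := by
        intro inst a j x y
        rw [Subsingleton.elim inst (instDecidableEqFin (n + 1))]
        funext m
        obtain ⟨f, hf⟩ := isLinearMap_dFun φ a j m
        simp only [Pi.add_apply, hf, map_add]
      map_update_smul' := by
        intro inst a j c x
        rw [Subsingleton.elim inst (instDecidableEqFin (n + 1))]
        funext m
        obtain ⟨f, hf⟩ := isLinearMap_dFun φ a j m
        simp only [Pi.smul_apply, hf, map_smul] }
  map_add' φ ψ := by
    ext a m
    simp only [MultilinearMap.coe_mk, add_apply, Pi.add_apply, dFun, map_add,
      smul_add, Finset.sum_add_distrib]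
    abel
  map_smul' c φ := by
    ext a m
    simp only [MultilinearMap.coe_mk, smul_apply, Pi.smul_apply, dFun, map_smul,
      smul_add, Finset.smul_sum, RingHom.id_apply, smul_comm c]

lemma dMulti_apply {n : ℕ} (φ : MultilinearMap k (fun _ : Fin n => C) ((Fin n → ℕ) → M))
    (a : Fin (n + 1) → C) (m : Fin (n + 1) → ℕ) :
    dMulti (k := k) n φ a m = dFun (k := k) φ a m := rfl

lemma contract_sub_eq {n : ℕ} (s : ℕ) (i : Fin n) (m : Fin (n + 1) → ℕ) :
    Fin.contractNth i.castSucc (fun p q => p + q - s) m =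
      Function.update (Fin.contractNth i.castSucc (fun p q => p + q) m) i
        (m i.castSucc + m i.succ - s) := by
  funext j
  rcases lt_trichotomy j i with h | rfl | h
  · rw [contract_of_lt _ h, Function.update_of_ne h.ne, contract_of_lt _ h]
  · rw [contract_self, Function.update_self]
  · rw [contract_of_gt _ h, Function.update_of_ne h.ne', contract_of_gt _ h]

lemma update_contract_prod {n : ℕ} (s t : ℕ) (i : Fin n) (a : Fin (n + 1) → C) :
    Function.update (Fin.contractNth i.castSucc
        (fun x y => AssocConformalAlgebra.prod (k := k) s x y) a) i
      (AssocConformalAlgebra.prod (k := k) t (a i.castSucc) (a i.succ)) =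
    Fin.contractNth i.castSucc (fun x y => AssocConformalAlgebra.prod (k := k) t x y) a := by
  funext j
  rcases lt_trichotomy j i with h | rfl | h
  · rw [contract_of_lt _ h, Function.update_of_ne h.ne, contract_of_lt _ h]
  · rw [contract_self, Function.update_self]
  · rw [contract_of_gt _ h, Function.update_of_ne h.ne', contract_of_gt _ h]

/-- The term of the differential that multiplies two neighbours. -/
def dTerm {n : ℕ} (φ : (Fin n → C) → (Fin n → ℕ) → M) (i : Fin n) (a : Fin (n + 1) → C)
    (m : Fin (n + 1) → ℕ) : M :=
  ∑ s ∈ range (m i.castSucc + 1), (m i.castSucc).choose s •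
    φ (Fin.contractNth i.castSucc (fun x y => AssocConformalAlgebra.prod (k := k) s x y) a)
      (Fin.contractNth i.castSucc (fun p q => p + q - s) m)

lemma dFun_eq {n : ℕ} (φ : (Fin n → C) → (Fin n → ℕ) → M) (a : Fin (n + 1) → C)
    (m : Fin (n + 1) → ℕ) : dFun (k := k) φ a m =
      ConformalModule.act (k := k) (m 0) (a 0) (φ (Fin.tail a) (Fin.tail m)) +
        ∑ i : Fin n, (-1 : ℤ) ^ ((i : ℕ) + 1) • dTerm (k := k) φ i a m := rfl

lemma sum_left {N : Type*} [AddCommGroup N] (G : ℕ → ℕ → N) (p q : ℕ) :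
    ∑ s ∈ range (p + 1), p.choose s • s • G (s - 1) (p + q - s) =
      p • ∑ s ∈ range (p - 1 + 1), (p - 1).choose s • G s (p - 1 + q - s) := by
  cases p with
  | zero => simp
  | succ p =>
    rw [Finset.sum_range_succ', zero_smul, smul_zero, add_zero, Nat.add_sub_cancel,
      Finset.smul_sum]
    refine Finset.sum_congr rfl fun s _ => ?_
    rw [smul_smul, smul_smul, Nat.add_sub_cancel, ← Nat.add_one_mul_choose_eq,
      show p + 1 + q - (s + 1) = p + q - s by omega]

lemma sum_right {N : Type*} [AddCommGroup N] (G : ℕ → ℕ → N) (p q : ℕ) :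
    ∑ s ∈ range (p + 1), p.choose s • (-((p + q - s) • G s (p + q - s - 1)) +
      s • G (s - 1) (p + q - s)) =
      -(q • ∑ s ∈ range (p + 1), p.choose s • G s (p + (q - 1) - s)) := by
  have h : ∑ s ∈ range (p + 1), p.choose s • s • G (s - 1) (p + q - s) =
      ∑ s ∈ range (p + 1), p.choose s • (p - s) • G s (p + q - s - 1) := by
    rw [Finset.sum_range_succ', Finset.sum_range_succ]
    simp only [zero_smul, smul_zero, add_zero, Nat.sub_self]
    refine Finset.sum_congr rfl fun s _ => ?_
    rw [smul_smul, smul_smul, Nat.add_sub_cancel, Nat.choose_succ_right_eq, Nat.sub_add_eq]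
  simp only [smul_add, Finset.sum_add_distrib]
  rw [h, ← Finset.sum_add_distrib, Finset.smul_sum, ← Finset.sum_neg_distrib]
  refine Finset.sum_congr rfl fun s hs => ?_
  rw [Finset.mem_range] at hs
  rw [show p + q - s = q + (p - s) by omega, add_smul, smul_neg, smul_add, smul_comm q]
  rcases Nat.eq_zero_or_pos q with rfl | hq
  · simp
  · rw [show p + (q - 1) - s = q + (p - s) - 1 by omega]
    abel

section

variable {n : ℕ} {φ : MultilinearMap k (fun _ : Fin n => C) ((Fin n → ℕ) → M)}

lemma dTerm_antilinear
    (hφ : ∀ (a : Fin n → C) (i : Fin n) (m : Fin n → ℕ),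
      φ (Function.update a i (AssocConformalAlgebra.D (k := k) (a i))) m =
        -(m i • φ a (Function.update m i (m i - 1))))
    (i : Fin n) (a : Fin (n + 1) → C) (j : Fin (n + 1)) (m : Fin (n + 1) → ℕ) :
    dTerm (k := k) φ i (Function.update a j (AssocConformalAlgebra.D (k := k) (a j))) m =
      -(m j • dTerm (k := k) φ i a (Function.update m j (m j - 1))) := by
  rcases index_cases i j with ⟨l, hl, rfl⟩ | rfl | rfl | ⟨l, hl, rfl⟩
  · have h1 : i.castSucc ≠ l.castSucc := by simpa using hl.ne'
    simp only [dTerm, contract_update_of_lt _ hl, Function.update_of_ne h1, Finset.smul_sum]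
    rw [← Finset.sum_neg_distrib]
    refine Finset.sum_congr rfl fun s _ => ?_
    have h2 := hφ (Fin.contractNth i.castSucc
      (fun x y => AssocConformalAlgebra.prod (k := k) s x y) a) l
      (Fin.contractNth i.castSucc (fun p q => p + q - s) m)
    rw [contract_of_lt _ hl, contract_of_lt _ hl] at h2
    rw [h2, smul_neg, smul_comm]
  · let G : ℕ → ℕ → M := fun s r => φ (Fin.contractNth i.castSucc
      (fun x y => AssocConformalAlgebra.prod (k := k) s x y) a)
      (Function.update (Fin.contractNth i.castSucc (fun p q => p + q) m) i r)
    have h1 : i.succ ≠ i.castSucc := by simp [Fin.ext_iff]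
    have hL : dTerm (k := k) φ i
        (Function.update a i.castSucc (AssocConformalAlgebra.D (k := k) (a i.castSucc))) m =
        -∑ s ∈ range (m i.castSucc + 1), (m i.castSucc).choose s •
          s • G (s - 1) (m i.castSucc + m i.succ - s) := by
      rw [dTerm, ← Finset.sum_neg_distrib]
      refine Finset.sum_congr rfl fun s _ => ?_
      rw [contract_update_left, AssocConformalAlgebra.D_prod]
      refine (congrArg (fun z => (m i.castSucc).choose s • z) (congrFun
        ((map_neg (φ.toLinearMap _ i) _).trans
          (congrArg Neg.neg (map_nsmul (φ.toLinearMap _ i) s _))) _)).trans ?_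
      rw [MultilinearMap.toLinearMap_apply, update_contract_prod, contract_sub_eq, Pi.neg_apply,
        Pi.smul_apply, smul_neg]
    have hR : dTerm (k := k) φ i a (Function.update m i.castSucc (m i.castSucc - 1)) =
        ∑ s ∈ range (m i.castSucc - 1 + 1), (m i.castSucc - 1).choose s •
          G s (m i.castSucc - 1 + m i.succ - s) := by
      rw [dTerm, Function.update_self]
      refine Finset.sum_congr rfl fun s _ => ?_
      rw [contract_update_left, contract_sub_eq, Function.update_idem]
    rw [hL, hR, sum_left]
  · let G : ℕ → ℕ → M := fun s r => φ (Fin.contractNth i.castSucc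
      (fun x y => AssocConformalAlgebra.prod (k := k) s x y) a)
      (Function.update (Fin.contractNth i.castSucc (fun p q => p + q) m) i r)
    have h1 : i.castSucc ≠ i.succ := by simp [Fin.ext_iff]
    have hL : dTerm (k := k) φ i
        (Function.update a i.succ (AssocConformalAlgebra.D (k := k) (a i.succ))) m =
        ∑ s ∈ range (m i.castSucc + 1), (m i.castSucc).choose s •
          (-((m i.castSucc + m i.succ - s) • G s (m i.castSucc + m i.succ - s - 1)) +
            s • G (s - 1) (m i.castSucc + m i.succ - s)) := by
      rw [dTerm]
      refine Finset.sum_congr rfl fun s _ => ?_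
      rw [contract_update_right, AssocConformalAlgebra.prod_D, MultilinearMap.map_update_add]
      have h2 := hφ (Fin.contractNth i.castSucc
        (fun x y => AssocConformalAlgebra.prod (k := k) s x y) a) i
        (Fin.contractNth i.castSucc (fun p q => p + q - s) m)
      rw [contract_self, contract_self, contract_sub_eq, Function.update_idem] at h2
      have h3 := congrFun (map_nsmul (φ.toLinearMap (Fin.contractNth i.castSucc
        (fun x y => AssocConformalAlgebra.prod (k := k) s x y) a) i) s
        (AssocConformalAlgebra.prod (k := k) (s - 1) (a i.castSucc) (a i.succ)))
        (Fin.contractNth i.castSucc (fun p q => p + q - s) m)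
      rw [MultilinearMap.toLinearMap_apply, MultilinearMap.toLinearMap_apply,
        update_contract_prod, contract_sub_eq, Pi.smul_apply] at h3
      rw [contract_sub_eq, Pi.add_apply, h2, h3]
    have hR : dTerm (k := k) φ i a (Function.update m i.succ (m i.succ - 1)) =
        ∑ s ∈ range (m i.castSucc + 1), (m i.castSucc).choose s •
          G s (m i.castSucc + (m i.succ - 1) - s) := by
      rw [dTerm, Function.update_of_ne h1]
      refine Finset.sum_congr rfl fun s _ => ?_
      rw [contract_update_right, contract_sub_eq, Function.update_idem]
    rw [hL, hR, sum_right]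
  · have h1 : i.castSucc ≠ l.succ := by
      rw [Ne, Fin.ext_iff, Fin.val_succ, Fin.val_castSucc]
      have : (i : ℕ) < l := hl
      omega
    simp only [dTerm, contract_update_of_gt _ hl, Function.update_of_ne h1, Finset.smul_sum]
    rw [← Finset.sum_neg_distrib]
    refine Finset.sum_congr rfl fun s _ => ?_
    have h2 := hφ (Fin.contractNth i.castSucc
      (fun x y => AssocConformalAlgebra.prod (k := k) s x y) a) l
      (Fin.contractNth i.castSucc (fun p q => p + q - s) m)
    rw [contract_of_gt _ hl, contract_of_gt _ hl] at h2
    rw [h2, smul_neg, smul_comm]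

lemma dFun_antilinear
    (hφ : ∀ (a : Fin n → C) (i : Fin n) (m : Fin n → ℕ),
      φ (Function.update a i (AssocConformalAlgebra.D (k := k) (a i))) m =
        -(m i • φ a (Function.update m i (m i - 1))))
    (a : Fin (n + 1) → C) (j : Fin (n + 1)) (m : Fin (n + 1) → ℕ) :
    dFun (k := k) φ (Function.update a j (AssocConformalAlgebra.D (k := k) (a j))) m =
      -(m j • dFun (k := k) φ a (Function.update m j (m j - 1))) := by
  rw [dFun_eq, dFun_eq, smul_add, neg_add]
  congr 1
  · rcases Fin.eq_zero_or_eq_succ j with rfl | ⟨j, rfl⟩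
    · rw [tail_update_zero, tail_update_zero, Function.update_self, Function.update_self,
        ConformalModule.D_act]
    · rw [tail_update_succ, tail_update_succ, Function.update_of_ne (Fin.succ_ne_zero j).symm,
        Function.update_of_ne (Fin.succ_ne_zero j).symm]
      have h := hφ (Fin.tail a) j (Fin.tail m)
      simp only [Fin.tail] at h ⊢
      rw [h, map_neg, map_nsmul]
  · rw [Finset.smul_sum, ← Finset.sum_neg_distrib]
    refine Finset.sum_congr rfl fun i _ => ?_
    rw [dTerm_antilinear hφ, smul_neg, smul_comm]

lemma dFun_finite (hφ : ∀ a, {m | φ a m ≠ 0}.Finite) (a : Fin (n + 1) → C) :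
    {m | dFun (k := k) φ a m ≠ 0}.Finite := by
  have h0 : {m : Fin (n + 1) → ℕ | ConformalModule.act (k := k) (m 0) (a 0)
      (φ (Fin.tail a) (Fin.tail m)) ≠ 0}.Finite := by
    choose N hN using fun m => ConformalModule.locality (k := k) (a 0) (φ (Fin.tail a) m)
    refine ((hφ (Fin.tail a)).biUnion fun m _ =>
      (Set.finite_Iio (N m)).image fun p => (Fin.cons p m : Fin (n + 1) → ℕ)).subset fun m hm => ?_
    simp only [Set.mem_iUnion]
    refine ⟨Fin.tail m, fun h => hm ?_, m 0, ?_, Fin.cons_self_tail m⟩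
    · rw [h, map_zero]
    · by_contra h
      exact hm (hN _ _ (not_lt.1 h))
  have h1 : ∀ i : Fin n, {m : Fin (n + 1) → ℕ | dTerm (k := k) φ i a m ≠ 0}.Finite := by
    intro i
    obtain ⟨N, hN⟩ := AssocConformalAlgebra.locality (k := k) (a i.castSucc) (a i.succ)
    refine ((Set.finite_Iio N).biUnion fun s _ => (hφ (Fin.contractNth i.castSucc
      (fun x y => AssocConformalAlgebra.prod (k := k) s x y) a)).biUnion fun t _ =>
        Set.finite_Iic (fun _ : Fin (n + 1) => s + ∑ l, t l)).subset fun m hm => ?_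
    obtain ⟨s, hs, hne⟩ := Finset.exists_ne_zero_of_sum_ne_zero hm
    have hne' : φ (Fin.contractNth i.castSucc
        (fun x y => AssocConformalAlgebra.prod (k := k) s x y) a)
        (Fin.contractNth i.castSucc (fun p q => p + q - s) m) ≠ 0 := fun h => hne (by rw [h, smul_zero])
    rw [Finset.mem_range] at hs
    simp only [Set.mem_iUnion]
    refine ⟨s, ?_, _, hne', fun j => ?_⟩
    · by_contra h
      refine hne' ?_
      rw [← update_contract_prod s, hN s (not_lt.1 h), MultilinearMap.map_update_zero]
      rfl
    · have hle : ∀ l : Fin n, Fin.contractNth i.castSucc (fun p q => p + q - s) m l ≤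
          ∑ l, Fin.contractNth i.castSucc (fun p q => p + q - s) m l :=
        fun l => Finset.single_le_sum (fun _ _ => Nat.zero_le _) (Finset.mem_univ l)
      rcases index_cases i j with ⟨l, hl, rfl⟩ | rfl | rfl | ⟨l, hl, rfl⟩
      · have := hle l
        rw [contract_of_lt _ hl] at this
        exact this.trans (Nat.le_add_left _ _)
      · have := hle i
        rw [contract_self] at this
        change m i.castSucc ≤ s + _
        omega
      · have := hle i
        rw [contract_self] at this
        change m i.succ ≤ s + _
        omega
      · have := hle l
        rw [contract_of_gt _ hl] at this
        exact this.trans (Nat.le_add_left _ _)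
  refine (h0.union (Set.finite_iUnion h1)).subset fun m hm => ?_
  by_contra h
  simp only [Set.mem_union, Set.mem_iUnion, Set.mem_ofPred_eq, not_or, not_not, not_exists] at h
  refine hm ?_
  rw [dFun_eq, h.1, zero_add]
  exact Finset.sum_eq_zero fun i _ => by rw [h.2 i, smul_zero]

end

variable (k C M)

/-- The space of basic cochains as a type. -/
def BasicCochain (n : ℕ) := basicCochain k C M n

instance (n : ℕ) : AddCommGroup (BasicCochain k C M n) :=
  inferInstanceAs (AddCommGroup (basicCochain k C M n))

instance (n : ℕ) : Module k (BasicCochain k C M n) :=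
  inferInstanceAs (Module k (basicCochain k C M n))

/-- The Hochschild differential of the basic complex. -/
def dBasic (n : ℕ) : BasicCochain k C M n →ₗ[k] BasicCochain k C M (n + 1) :=
  (dMulti (k := k) n).restrict fun _ hφ => ⟨dFun_finite hφ.1, dFun_antilinear hφ.2⟩

variable {k C M}

/-- `(∂ φ)_λ̄ = (∂ + λ₁ + ⋯ + λₙ) φ_λ̄`, in terms of coefficients. -/
def derivMulti (n : ℕ) : MultilinearMap k (fun _ : Fin n => C) ((Fin n → ℕ) → M) →ₗ[k]
    MultilinearMap k (fun _ : Fin n => C) ((Fin n → ℕ) → M) where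
  toFun φ := LinearMap.compMultilinearMap
    (LinearMap.pi fun m : Fin n → ℕ => ConformalModule.D (k := k) (C := C) (M := M) ∘ₗ LinearMap.proj m +
      ∑ i : Fin n, m i • LinearMap.proj (Function.update m i (m i - 1))) φ
  map_add' φ ψ := by ext a m; simp
  map_smul' c φ := by ext a m; simp

lemma derivMulti_apply {n : ℕ} (φ : MultilinearMap k (fun _ : Fin n => C) ((Fin n → ℕ) → M))
    (a : Fin n → C) (m : Fin n → ℕ) : derivMulti n φ a m =
      ConformalModule.D (k := k) (C := C) (φ a m) +
        ∑ i : Fin n, m i • φ a (Function.update m i (m i - 1)) := by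
  simp [derivMulti]

lemma derivMulti_mem {n : ℕ} (φ : MultilinearMap k (fun _ : Fin n => C) ((Fin n → ℕ) → M))
    (hφ : φ ∈ basicCochain k C M n) : derivMulti n φ ∈ basicCochain k C M n := by
  refine ⟨fun a => ?_, fun a i m => ?_⟩
  · refine ((hφ.1 a).union (Set.finite_iUnion fun i : Fin n =>
      (hφ.1 a).image fun m => Function.update m i (m i + 1))).subset fun m hm => ?_
    by_contra h
    simp only [Set.mem_union, Set.mem_iUnion, not_or, not_exists] at h
    refine hm ?_
    have h1 : φ a m = 0 := by
      by_contra h'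
      exact h.1 h'
    rw [derivMulti_apply, h1, map_zero, zero_add]
    refine Finset.sum_eq_zero fun i _ => ?_
    rcases Nat.eq_zero_or_pos (m i) with hi | hi
    · rw [hi, zero_smul]
    · by_contra h'
      refine h.2 i ⟨Function.update m i (m i - 1), fun h'' => h' (by rw [h'', smul_zero]), ?_⟩
      simp [Nat.sub_add_cancel hi]
  · rw [derivMulti_apply, derivMulti_apply, hφ.2, map_neg, map_nsmul, smul_add, neg_add]
    congr 1
    rw [Finset.smul_sum, ← Finset.sum_neg_distrib]
    refine Finset.sum_congr rfl fun j _ => ?_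
    rw [hφ.2, smul_neg]
    rcases eq_or_ne i j with rfl | hij
    · rfl
    · rw [Function.update_of_ne hij, Function.update_of_ne hij.symm, Function.update_comm hij,
        smul_comm]

/-- `∂ φ` in terms of the translation operators of `C` and `M`. -/
lemma derivMulti_eq {n : ℕ} (φ : MultilinearMap k (fun _ : Fin n => C) ((Fin n → ℕ) → M))
    (hφ : φ ∈ basicCochain k C M n) (a : Fin n → C) (m : Fin n → ℕ) : derivMulti n φ a m =
      ConformalModule.D (k := k) (C := C) (φ a m) -
        ∑ i : Fin n, φ (Function.update a i (AssocConformalAlgebra.D (k := k) (a i))) m := by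
  rw [derivMulti_apply, sub_eq_add_neg, ← Finset.sum_neg_distrib]
  congr 1
  exact Finset.sum_congr rfl fun i _ => by rw [hφ.2, neg_neg]

lemma sum_contract_update {n : ℕ} (φ : MultilinearMap k (fun _ : Fin n => C) ((Fin n → ℕ) → M))
    (i : Fin n) (s : ℕ) (a : Fin (n + 1) → C) (m : Fin n → ℕ) :
    ∑ j : Fin (n + 1), φ (Fin.contractNth i.castSucc
        (fun x y => AssocConformalAlgebra.prod (k := k) s x y)
        (Function.update a j (AssocConformalAlgebra.D (k := k) (a j)))) m =
      ∑ l : Fin n, φ (Function.update (Fin.contractNth i.castSucc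
        (fun x y => AssocConformalAlgebra.prod (k := k) s x y) a) l
        (AssocConformalAlgebra.D (k := k) (Fin.contractNth i.castSucc
          (fun x y => AssocConformalAlgebra.prod (k := k) s x y) a l))) m := by
  rw [Fin.sum_univ_succAbove _ i.castSucc]
  set b := Fin.contractNth i.castSucc
        (fun x y => AssocConformalAlgebra.prod (k := k) s x y) a with hb
  set z := φ (Fin.contractNth i.castSucc (fun x y => AssocConformalAlgebra.prod (k := k) s x y)
    (Function.update a i.castSucc (AssocConformalAlgebra.D (k := k) (a i.castSucc)))) m with hz
  have h : ∀ l : Fin n, φ (Function.update b l (AssocConformalAlgebra.D (k := k) (b l))) m =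
      (if l = i then z else 0) + φ (Fin.contractNth i.castSucc
        (fun x y => AssocConformalAlgebra.prod (k := k) s x y)
        (Function.update a (i.castSucc.succAbove l)
          (AssocConformalAlgebra.D (k := k) (a (i.castSucc.succAbove l))))) m := by
    intro l
    rcases lt_trichotomy l i with hl | rfl | hl
    · rw [if_neg hl.ne, zero_add, Fin.succAbove_of_castSucc_lt _ _ (by simpa using hl),
        contract_update_of_lt _ hl, hb, contract_of_lt _ hl]
    · rw [if_pos rfl, Fin.succAbove_of_le_castSucc _ _ le_rfl, hz, contract_update_left,
        contract_update_right, ← Pi.add_apply, ← MultilinearMap.map_update_add, hb, contract_self,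
        AssocConformalAlgebra.D_prod, AssocConformalAlgebra.prod_D]
      rw [neg_add_eq_sub, add_sub_cancel_right]
    · rw [if_neg hl.ne', zero_add, Fin.succAbove_of_le_castSucc _ _ (by simpa using hl.le),
        contract_update_of_gt _ hl, hb, contract_of_gt _ hl]
  rw [Finset.sum_congr rfl fun l _ => h l, Finset.sum_add_distrib, Finset.sum_ite_eq']
  simp

/-- The differential commutes with `∂`. -/
lemma dBasic_comm {n : ℕ} (φ : MultilinearMap k (fun _ : Fin n => C) ((Fin n → ℕ) → M))
    (hφ : φ ∈ basicCochain k C M n) :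
    dMulti n (derivMulti n φ) = derivMulti (n + 1) (dMulti n φ) := by
  ext a m
  have hd : dMulti n φ ∈ basicCochain k C M (n + 1) :=
    ⟨dFun_finite hφ.1, dFun_antilinear hφ.2⟩
  rw [derivMulti_eq _ hd]
  simp only [dMulti_apply, dFun_eq, Finset.sum_add_distrib, map_add]
  rw [add_sub_add_comm]
  congr 1
  · have h := ConformalModule.act_D (k := k) (m 0) (a 0) (φ (Fin.tail a) (Fin.tail m))
    have h' := ConformalModule.D_act (k := k) (m 0) (a 0) (φ (Fin.tail a) (Fin.tail m))
    rw [derivMulti_eq _ hφ, map_sub, h, Fin.sum_univ_succ, tail_update_zero, Function.update_self,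
      h', map_sum]
    have h2 : ∀ j : Fin n, ConformalModule.act (k := k) (m 0)
        (Function.update a j.succ (AssocConformalAlgebra.D (k := k) (a j.succ)) 0)
        (φ (Fin.tail (Function.update a j.succ (AssocConformalAlgebra.D (k := k) (a j.succ))))
          (Fin.tail m)) = ConformalModule.act (k := k) (m 0) (a 0)
        (φ (Function.update (Fin.tail a) j (AssocConformalAlgebra.D (k := k) (Fin.tail a j)))
          (Fin.tail m)) := by
      intro j
      rw [tail_update_succ, Function.update_of_ne (Fin.succ_ne_zero j).symm]
      rfl
    rw [Finset.sum_congr rfl fun j _ => h2 j]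
    abel
  · rw [map_sum, Finset.sum_comm, ← Finset.sum_sub_distrib]
    refine Finset.sum_congr rfl fun i _ => ?_
    rw [map_zsmul, ← Finset.smul_sum, ← smul_sub]
    congr 1
    simp only [dTerm]
    rw [map_sum, Finset.sum_comm, ← Finset.sum_sub_distrib]
    refine Finset.sum_congr rfl fun s _ => ?_
    rw [derivMulti_eq _ hφ, ← Finset.smul_sum, map_nsmul, sum_contract_update, smul_sub]

variable (k C M)

/-- The operator `∂` on the basic complex. -/
def derivBasic (n : ℕ) : BasicCochain k C M n →ₗ[k] BasicCochain k C M n :=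
  (derivMulti n).restrict derivMulti_mem

/-- The reduced cochain space `C̃ⁿ / ∂ C̃ⁿ`. -/
abbrev ReducedCochain (n : ℕ) := BasicCochain k C M n ⧸ LinearMap.range (derivBasic k C M n)

/-- The differential of the reduced complex. -/
def dReduced (n : ℕ) : ReducedCochain k C M n →ₗ[k] ReducedCochain k C M (n + 1) :=
  Submodule.mapQ _ _ (dBasic k C M n) (by
    rintro _ ⟨φ, rfl⟩
    refine ⟨dBasic k C M n φ, Subtype.ext ?_⟩
    exact (dBasic_comm φ.1 φ.2).symm)

/-- The coboundaries of the reduced complex. -/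
def coboundaries : (n : ℕ) → Submodule k (ReducedCochain k C M n)
  | 0 => ⊥
  | n + 1 => LinearMap.range (dReduced k C M n)

/-- The reduced Hochschild cohomology `Hⁿ(C, M)`: cocycles modulo coboundaries of the reduced
complex. -/
abbrev ReducedCohomology (n : ℕ) :=
  LinearMap.ker (dReduced k C M n) ⧸
    (coboundaries k C M n).submoduleOf (LinearMap.ker (dReduced k C M n))

end

end ConformalHochschild

/-!
The elements of `U(3)` are determined by their action on the modules `M_(0, Δ)`, `Δ ∈ k`. There
`a_λ` acts on `p(∂) u` by `(a_λ p)(x) = a(x, x + λ, Δ) p(x + λ)` for a polynomial `a(x, y, Δ)`, the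
symbol of `a`; the symbol of `v` is `x + Δ (y - x)`, the operator `∂` becomes multiplication by
`x - y`, and the `λ`-product becomes `(a_λ b)(x, y) = a(x, x + λ) b(x + λ, y)`. The relations of
`U(3)` show that it is spanned by the elements `v(0)ʲ ∂ˡ v` and `v(0)ʲ ∂ˡ v(1)ⁱ (v ₍₂₎ v)`, whose
symbols are linearly independent. So `U(3)` is the algebra `CQ` of the symbols with
`y a(x, y, 0) = x a(x, y, 1)` (`symEquiv`).

A reduced cochain with `n + 1` entries and values in `M_(0,0) = k[x] u` is determined by its value
at `x = -∑ λᵢ`, because the quotient by `∂` is the quotient by the multiples of `x + ∑ λᵢ`. This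
turns it into a function of words of `n` points of `CQ × k` followed by a last point of `N × k`,
where `N = CQ`; it is linear in each vector with `∂` acting by `-λ`, and polynomial in the
variables (`R N n`). The differential becomes `W - E`, where `W` lets the first entry act on the
value and `E` is the alternating sum over the products of neighbours (`cmpR`, `cmpR_dReduced`). In
this form the complex makes sense for every space `N` of symbols that is stable under `∂` and under
the left action of `CQ`, and right multiplication by symbols independent of `x` gives maps between
these spaces.

The space `P` of the symbols with `a(x, y, 0) = x a(x, y, 1)` has a contracting homotopy, which comes
from an identity `1 = z(x, x) p₀(x) + z'(x, x + 1) p₀(x + 1)` with `p₀ ∈ P` and `z`, `z'` in the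
dual space. So the complex of `P` is exact in positive degrees, and its cocycles of degree zero are
the multiples of the functional `aug` (`exists_of_cocycle_Pm`, `eq_smul_aug_of_cocycle`).

Let `K` be the space of the symbols with `a(x, y, 0) = x y a(x, y, 1)`. There is an exact sequence
`0 → K → P² → CQ → 0` that splits over `k[∂]`. Hence the cocycles of degree zero of `CQ` form a
space of dimension two, and the cohomology of `CQ` in degree `n + 1` is that of `K` in degree `n`
(`rank_CQ_zero`, `rank_CQ_succ`); in degree one of the original complex the multiples of `aug` are
coboundaries. There is also a map `P² → K` whose kernel is `CQ` and whose cokernel is spanned by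
`c = Δ² - Δ`, with `∂ c` in the image. A pair of cochains on `P` comes from `K` exactly when it
vanishes on the kernel and when a further functional `η`, the obstruction at `c`, vanishes. These
two conditions are tied by the differential like `CQ` and its extension by a unit, and they leave
only one class, the value of `η` in degree zero. So `K` has cohomology of dimension `2`, `1`
and `0` in degree `0`, in degree `1` and in higher degrees (`rank_Km_zero`, `rank_Km_one`,
`Zc_Km_le`), and `H¹`, `H²`, `H³` have dimension `1`, `2` and `1`.
-/

set_option linter.unusedSectionVars false

namespace VirHoch

/-! ### Symbols -/

section Symbols

open MvPolynomial

variable (k : Type*) [Field k]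

/-- The ring of symbols `k[x, y, Δ]`, with `x = X 0`, `y = X 1`, `Δ = X 2`. -/
abbrev Sym := MvPolynomial (Fin 3) k

variable {k}

/-- The value of a symbol at a point. -/
noncomputable def ev (x y d : k) : Sym k →ₐ[k] k := aeval ![x, y, d]

@[simp] lemma ev_X0 (x y d : k) : ev x y d (X 0) = x := by simp [ev]
@[simp] lemma ev_X1 (x y d : k) : ev x y d (X 1) = y := by simp [ev]
@[simp] lemma ev_X2 (x y d : k) : ev x y d (X 2) = d := by simp [ev]
@[simp] lemma ev_C (x y d c : k) : ev x y d (C c) = c := by simp [ev]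

lemma sym_ext [Infinite k] {p q : Sym k} (h : ∀ x y d, ev x y d p = ev x y d q) : p = q := by
  refine MvPolynomial.funext fun s => ?_
  have h1 : s = ![s 0, s 1, s 2] := by
    ext i; fin_cases i <;> rfl
  rw [h1]
  simpa [ev, aeval_eq_eval] using h (s 0) (s 1) (s 2)

/-- Substitutions of symbols, given by the three new variables. -/
noncomputable def sub (a b c : Sym k) : Sym k →ₐ[k] Sym k := aeval ![a, b, c]

lemma ev_sub (a b c : Sym k) (x y d : k) (p : Sym k) :
    ev x y d (sub a b c p) = ev (ev x y d a) (ev x y d b) (ev x y d c) p := by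
  have : (ev x y d).comp (sub a b c) = ev (ev x y d a) (ev x y d b) (ev x y d c) := by
    refine MvPolynomial.algHom_ext fun i => ?_
    fin_cases i <;> simp [sub, ev]
  exact DFunLike.congr_fun this p

/-- Two substitutions that agree on the variables modulo `h` agree modulo `h`. -/
lemma dvd_sub_of_dvd {σ A : Type*} [CommRing A] [Algebra k A] (f g : MvPolynomial σ k →ₐ[k] A)
    (h : A) (hX : ∀ i, h ∣ f (X i) - g (X i)) (p : MvPolynomial σ k) : h ∣ f p - g p := by
  induction p using MvPolynomial.induction_on with
  | C c => simp [← MvPolynomial.algebraMap_eq]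
  | add p q hp hq =>
    rw [map_add, map_add, add_sub_add_comm]
    exact dvd_add hp hq
  | mul_X p i hp =>
    have : f (p * X i) - g (p * X i) = (f p - g p) * f (X i) + g p * (f (X i) - g (X i)) := by
      rw [map_mul, map_mul]; ring
    rw [this]
    exact dvd_add (hp.mul_right _) ((hX i).mul_left _)

lemma dvd_sub_sub (h a b c : Sym k) (ha : h ∣ X 0 - a) (hb : h ∣ X 1 - b) (hc : h ∣ X 2 - c)
    (p : Sym k) : h ∣ p - sub a b c p := by
  have := dvd_sub_of_dvd (AlgHom.id k (Sym k)) (sub a b c) h (fun i => by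
    fin_cases i <;> simpa [sub]) p
  simpa using this

/-- The symbol `x - y`; multiplication by it is the operator `∂`. -/
noncomputable def del : Sym k := X 0 - X 1

@[simp] lemma ev_del (x y d : k) : ev x y d del = x - y := by simp [del]

/-- `a(x, x + l, Δ)`. -/
noncomputable def sL (l : k) : Sym k →ₐ[k] Sym k := sub (X 0) (X 0 + C l) (X 2)
/-- `a(x + l, y, Δ)`. -/
noncomputable def sR (l : k) : Sym k →ₐ[k] Sym k := sub (X 0 + C l) (X 1) (X 2)

@[simp] lemma ev_sL (l x y d : k) (p : Sym k) : ev x y d (sL l p) = ev x (x + l) d p := by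
  simp [sL, ev_sub]
@[simp] lemma ev_sR (l x y d : k) (p : Sym k) : ev x y d (sR l p) = ev (x + l) y d p := by
  simp [sR, ev_sub]

/-- The `λ`-product of symbols, `(a_λ b)(x, y) = a(x, x + λ) b(x + λ, y)`. -/
noncomputable def lam (l : k) : Sym k →ₗ[k] Sym k →ₗ[k] Sym k :=
  (LinearMap.mul k (Sym k)).compl₁₂ (sL l).toLinearMap (sR l).toLinearMap

@[simp] lemma ev_lam (l x y d : k) (a b : Sym k) :
    ev x y d (lam l a b) = ev x (x + l) d a * ev (x + l) y d b := by
  simp [lam]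

/-- `a(x, x + l, Δ)` with a formal `l`. -/
noncomputable def fL : Sym k →ₐ[k] Polynomial (Sym k) :=
  aeval ![Polynomial.C (X 0), Polynomial.C (X 0) + Polynomial.X, Polynomial.C (X 2)]
/-- `a(x + l, y, Δ)` with a formal `l`. -/
noncomputable def fR : Sym k →ₐ[k] Polynomial (Sym k) :=
  aeval ![Polynomial.C (X 0) + Polynomial.X, Polynomial.C (X 1), Polynomial.C (X 2)]

lemma eval_fL (l : k) (a : Sym k) : (fL a).eval (C l) = sL l a := by
  have : ((Polynomial.aeval (C l : Sym k)).restrictScalars k).comp fL = sL l := by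
    refine MvPolynomial.algHom_ext fun i => ?_
    fin_cases i <;> simp [sL, sub, fL]
  simpa [Polynomial.coe_aeval_eq_eval] using DFunLike.congr_fun this a

lemma eval_fR (l : k) (a : Sym k) : (fR a).eval (C l) = sR l a := by
  have : ((Polynomial.aeval (C l : Sym k)).restrictScalars k).comp fR = sR l := by
    refine MvPolynomial.algHom_ext fun i => ?_
    fin_cases i <;> simp [sR, sub, fR]
  simpa [Polynomial.coe_aeval_eq_eval] using DFunLike.congr_fun this a

/-- The `λ`-product is a polynomial in `λ`; its coefficients are those of `fL a * fR b`. -/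
lemma lam_eq_sum (l : k) (a b : Sym k) :
    lam l a b = ∑ i ∈ range ((fL a * fR b).natDegree + 1), l ^ i • (fL a * fR b).coeff i := by
  have h : lam l a b = (fL a * fR b).eval (C l) := by
    simp [lam, eval_fL, eval_fR]
  rw [h, Polynomial.eval_eq_sum_range]
  refine Finset.sum_congr rfl fun i _ => ?_
  rw [← map_pow, mul_comm, MvPolynomial.C_mul']

/-- The value at `Δ = 0`. -/
noncomputable def e0 : Sym k →ₐ[k] Sym k := sub (X 0) (X 1) 0
/-- The value at `Δ = 1`. -/
noncomputable def e1 : Sym k →ₐ[k] Sym k := sub (X 0) (X 1) 1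

@[simp] lemma ev_e0 (x y d : k) (p : Sym k) : ev x y d (e0 p) = ev x y 0 p := by
  simp [e0, ev_sub]
@[simp] lemma ev_e1 (x y d : k) (p : Sym k) : ev x y d (e1 p) = ev x y 1 p := by
  simp [e1, ev_sub]

/-- The symbol `c = Δ² - Δ`, which vanishes at `Δ = 0` and `Δ = 1`. -/
noncomputable def cc : Sym k := X 2 ^ 2 - X 2

@[simp] lemma ev_cc (x y d : k) : ev x y d cc = d ^ 2 - d := by simp [cc]

end Symbols

/-! #### Divisibility -/

section Divisibility

open MvPolynomial

variable {k : Type*} [Field k] [CharZero k]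

lemma X_dvd_of_ev {i : Fin 3} {p : Sym k}
    (h : ∀ s : Fin 3 → k, s i = 0 → ev (s 0) (s 1) (s 2) p = 0) : X i ∣ p := by
  set g : Sym k →ₐ[k] Sym k := aeval fun j => if j = i then 0 else X j with hg
  have h1 : X i ∣ p - g p := by
    have := dvd_sub_of_dvd (AlgHom.id k (Sym k)) g (X i) (fun j => by
      by_cases hj : j = i
      · subst hj; simp [hg]
      · simp [hg, hj]) p
    simpa using this
  have h2 : g p = 0 := by
    refine sym_ext fun x y d => ?_
    set t : Fin 3 → k := fun j => if j = i then 0 else ![x, y, d] j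
    have h3 : (ev x y d).comp g = ev (t 0) (t 1) (t 2) := by
      refine MvPolynomial.algHom_ext fun j => ?_
      fin_cases j <;> fin_cases i <;> simp [hg, t]
    have h4 := DFunLike.congr_fun h3 p
    rw [AlgHom.comp_apply] at h4
    rw [h4, map_zero]
    exact h t (by simp [t])
  rwa [h2, sub_zero] at h1

lemma X1_dvd {p : Sym k} (h : ∀ x d, ev x 0 d p = 0) : X 1 ∣ p :=
  X_dvd_of_ev fun s hs => by rw [hs]; exact h _ _

lemma X0_dvd {p : Sym k} (h : ∀ y d, ev 0 y d p = 0) : X 0 ∣ p :=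
  X_dvd_of_ev fun s hs => by rw [hs]; exact h _ _

lemma cc_dvd {p : Sym k} (h0 : ∀ x y, ev x y 0 p = 0) (h1 : ∀ x y, ev x y 1 p = 0) :
    cc ∣ p := by
  obtain ⟨q, rfl⟩ : X 2 ∣ p := X_dvd_of_ev fun s hs => by rw [hs]; exact h0 _ _
  have h2 : (X 2 - 1 : Sym k) ∣ q - e1 q := dvd_sub_sub _ _ _ _ (by simp) (by simp) (by simp) q
  have h3 : e1 q = 0 := sym_ext fun x y d => by simpa using h1 x y
  rw [h3, sub_zero] at h2
  obtain ⟨r, rfl⟩ := h2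
  exact ⟨r, by rw [cc]; ring⟩

lemma cc_ne_zero : (cc : Sym k) ≠ 0 := by
  intro h
  have := congrArg (ev 0 0 2) h
  simp at this
  norm_num at this

/-- A symbol that vanishes off the zero set of a nonzero symbol vanishes. -/
lemma ev_eq_zero_of_mul {p u : Sym k} (hu : u ≠ 0)
    (h : ∀ x y d, ev x y d u * ev x y d p = 0) (x y d : k) : ev x y d p = 0 := by
  have : u * p = 0 := sym_ext fun x y d => by simpa using h x y d
  rcases mul_eq_zero.1 this with h | h
  · exact absurd h hu
  · simp [h]

/-- The quotients by `h` of a linear family of multiples of `h` form a linear family. -/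
lemma exists_quot {N : Type*} [AddCommGroup N] [Module k N] (g : N →ₗ[k] Sym k) (h : Sym k)
    (h0 : h ≠ 0) (hg : ∀ a, h ∣ g a) : ∃ f : N →ₗ[k] Sym k, ∀ a, h * f a = g a := by
  choose f hf using hg
  refine ⟨⟨⟨f, fun a b => ?_⟩, fun c a => ?_⟩, fun a => (hf a).symm⟩
  · refine mul_left_cancel₀ h0 ?_
    rw [mul_add, ← hf, ← hf, ← hf, map_add]
  · refine mul_left_cancel₀ h0 ?_
    change h * f (c • a) = h * (c • f a)
    rw [mul_smul_comm, ← hf, ← hf, map_smul]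

end Divisibility

/-! ### Exponential generating functions -/

section Egf

variable {k : Type*} [Field k] {V W : Type*} [AddCommGroup V] [Module k V] [AddCommGroup W]
  [Module k W]

/-- The exponential generating function `∑ₙ (lⁿ / n!) f(n)` of a sequence that vanishes
eventually. -/
noncomputable def egf (l : k) (f : ℕ → V) : V := ∑ᶠ n, (l ^ n / (n.factorial : k)) • f n

lemma egf_eq_sum {l : k} {f : ℕ → V} {N : ℕ} (h : ∀ n, N ≤ n → f n = 0) :
    egf l f = ∑ n ∈ range N, (l ^ n / (n.factorial : k)) • f n := by
  refine finsum_eq_sum_of_support_subset _ fun n hn => ?_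
  by_contra h'
  simp only [coe_range, Set.mem_Iio, not_lt] at h'
  exact hn (by simp [h n h'])

/-- Sequences that vanish eventually. -/
def EvZero (f : ℕ → V) : Prop := ∃ N, ∀ n, N ≤ n → f n = 0

lemma EvZero.map {f : ℕ → V} (hf : EvZero f) (T : V →ₗ[k] W) : EvZero (fun n => T (f n)) := by
  obtain ⟨N, hN⟩ := hf
  exact ⟨N, fun n hn => by simp [hN n hn]⟩

lemma EvZero.deriv {f : ℕ → V} (hf : EvZero f) : EvZero (fun n => n • f (n - 1)) := by
  obtain ⟨N, hN⟩ := hf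
  exact ⟨N + 1, fun n hn => by simp [hN (n - 1) (by omega)]⟩

lemma egf_add (l : k) {f g : ℕ → V} (hf : EvZero f) (hg : EvZero g) :
    egf l (fun n => f n + g n) = egf l f + egf l g := by
  obtain ⟨N, hN⟩ := hf
  obtain ⟨M, hM⟩ := hg
  rw [egf_eq_sum (N := N + M) (fun n hn => by rw [hN n (by omega), hM n (by omega), add_zero]),
    egf_eq_sum (N := N + M) (fun n hn => hN n (by omega)),
    egf_eq_sum (N := N + M) (fun n hn => hM n (by omega)), ← Finset.sum_add_distrib]
  simp only [smul_add]

lemma egf_map (l : k) {f : ℕ → V} (hf : EvZero f) (T : V →ₗ[k] W) :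
    egf l (fun n => T (f n)) = T (egf l f) := by
  obtain ⟨N, hN⟩ := hf
  rw [egf_eq_sum (N := N) (fun n hn => by rw [hN n hn, map_zero]), egf_eq_sum hN, map_sum]
  simp

lemma egf_zero (l : k) : egf l (fun _ => (0 : V)) = 0 := by simp [egf]

/-- The shift `f(n) ↦ n f(n - 1)` multiplies the generating function by the variable. -/
lemma egf_deriv [CharZero k] (l : k) {f : ℕ → V} (hf : EvZero f) :
    egf l (fun n => n • f (n - 1)) = l • egf l f := by
  obtain ⟨N, hN⟩ := hf
  rw [egf_eq_sum (N := N + 1) (fun n hn => by rw [hN (n - 1) (by omega), smul_zero]),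
    egf_eq_sum hN, Finset.sum_range_succ', zero_smul, smul_zero, add_zero, Finset.smul_sum]
  refine Finset.sum_congr rfl fun n _ => ?_
  rw [Nat.add_sub_cancel, ← Nat.cast_smul_eq_nsmul k, smul_smul, smul_smul]
  congr 1
  have h1 : (n.factorial : k) ≠ 0 := by exact_mod_cast n.factorial_ne_zero
  have h2 : ((n : k) + 1) ≠ 0 := by exact_mod_cast n.succ_ne_zero
  rw [Nat.factorial_succ]
  push_cast
  field_simp
  ring

/-- The generating function is the value of the polynomial with coefficients `f(n) / n!`. -/
lemma egf_eq_eval (l : k) {f : ℕ → k} {N : ℕ} (h : ∀ n, N ≤ n → f n = 0) :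
    egf l f = (∑ n ∈ range N, Polynomial.monomial n (f n / n.factorial)).eval l := by
  rw [egf_eq_sum h, Polynomial.eval_finsetSum]
  refine Finset.sum_congr rfl fun n _ => ?_
  rw [Polynomial.eval_monomial, smul_eq_mul]
  ring

/-- A sequence is determined by its generating function. -/
lemma coeff_eq_of_egf_eq [CharZero k] {f : ℕ → k} (hf : EvZero f) {p : Polynomial k}
    (h : ∀ l, egf l f = p.eval l) (n : ℕ) : f n = n.factorial * p.coeff n := by
  obtain ⟨N, hN⟩ := hf
  have h1 : (∑ n ∈ range N, Polynomial.monomial n (f n / n.factorial)) = p :=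
    Polynomial.funext fun l => by rw [← egf_eq_eval l hN, h]
  have h2 : (n.factorial : k) ≠ 0 := by exact_mod_cast n.factorial_ne_zero
  rw [← h1, Polynomial.finsetSum_coeff]
  simp only [Polynomial.coeff_monomial]
  rw [Finset.sum_ite_eq']
  split_ifs with h3
  · field_simp
  · rw [hN n (by simpa using h3), mul_zero]

/-- The generating function of a binomial convolution: the substitution `λ, μ ↦ λ, λ + μ`. -/
lemma egf_binomial [CharZero k] (l m : k) {G : ℕ → ℕ → V} {A B : ℕ}
    (hA : ∀ r M, A ≤ r → G r M = 0) (hB : ∀ r M, B ≤ M → G r M = 0) :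
    egf l (fun p => egf m fun q => ∑ s ∈ range (p + 1), p.choose s • G s (p + q - s)) =
      egf l (fun r => egf (l + m) (G r)) := by
  have h1 : ∀ p q, B ≤ q → ∑ s ∈ range (p + 1), p.choose s • G s (p + q - s) = 0 := by
    intro p q hq
    refine Finset.sum_eq_zero fun s hs => ?_
    rw [Finset.mem_range] at hs
    rw [hB _ _ (by omega), smul_zero]
  have h2 : ∀ p, A + B ≤ p →
      egf m (fun q => ∑ s ∈ range (p + 1), p.choose s • G s (p + q - s)) = 0 := by
    intro p hp
    rw [egf_eq_sum (h1 p)]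
    refine Finset.sum_eq_zero fun q _ => ?_
    rw [Finset.sum_eq_zero, smul_zero]
    intro s hs
    rcases le_or_gt A s with h | h
    · rw [hA _ _ h, smul_zero]
    · rw [hB _ _ (by omega), smul_zero]
  have h3 : ∀ r, A ≤ r → egf (l + m) (G r) = 0 := by
    intro r hr
    have : G r = fun _ => 0 := funext fun M => hA r M hr
    rw [this, egf_zero]
  rw [egf_eq_sum h2, egf_eq_sum h3]
  have h4 : ∀ p, egf m (fun q => ∑ s ∈ range (p + 1), p.choose s • G s (p + q - s)) =
      ∑ q ∈ range B, (m ^ q / (q.factorial : k)) •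
        ∑ s ∈ range (p + 1), p.choose s • G s (p + q - s) := fun p => egf_eq_sum (h1 p)
  have h5 : ∀ r, egf (l + m) (G r) = ∑ M ∈ range B,
      ((l + m) ^ M / (M.factorial : k)) • G r M := fun r => egf_eq_sum fun M hM => hB r M hM
  simp only [h4, h5, Finset.smul_sum, add_pow, Finset.sum_div, Finset.sum_smul]
  rw [Finset.sum_congr rfl fun p _ => Finset.sum_sigma' (range B) (fun _ => range (p + 1)) _,
    Finset.sum_sigma', Finset.sum_congr rfl fun r _ => Finset.sum_sigma' (range B) _ _,
    Finset.sum_sigma']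
  -- The terms are matched by `r = s`, `M = p + q - s` and the exponent `j = p - s` of `l` in
  -- `(l + m) ^ M`; both sides range over boxes, so only the nonzero terms correspond.
  refine Finset.sum_bij_ne_zero
    (fun x _ _ => ⟨x.2.2, ⟨x.1 + x.2.1 - x.2.2, x.1 - x.2.2⟩⟩) ?_ ?_ ?_ ?_
  · rintro ⟨p, q, s⟩ h hne
    simp only [Finset.mem_sigma, Finset.mem_range] at h ⊢
    have hG : G s (p + q - s) ≠ 0 := fun h0 => hne (by simp [h0])
    refine ⟨?_, ?_, ?_⟩
    · by_contra hs
      exact hG (hA _ _ (by omega))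
    · by_contra hs
      exact hG (hB _ _ (by omega))
    · omega
  · rintro ⟨p, q, s⟩ h _ ⟨p', q', s'⟩ h' _ heq
    simp only [Finset.mem_sigma, Finset.mem_range] at h h'
    simp only [Sigma.mk.injEq, heq_eq_eq] at heq ⊢
    omega
  · rintro ⟨r, M, j⟩ h hne
    simp only [Finset.mem_sigma, Finset.mem_range] at h
    have hG : G r M ≠ 0 := fun h0 => hne (by simp [h0])
    refine ⟨⟨r + j, M - j, r⟩, ?_, ?_, ?_⟩
    · simp only [Finset.mem_sigma, Finset.mem_range]
      omega
    · intro h0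
      apply hne
      rw [show r + j + (M - j) - r = M by omega] at h0
      by_cases hl : l ^ (r + j) = 0
      · have : l ^ r * l ^ j = 0 := by rw [← pow_add]; exact hl
        rcases mul_eq_zero.1 this with h' | h' <;> simp [h']
      · by_cases hm : m ^ (M - j) = 0
        · simp [hm]
        · exfalso
          rw [← Nat.cast_smul_eq_nsmul k, smul_smul, smul_smul] at h0
          rcases smul_eq_zero.1 h0 with h' | h'
          · have h6 : ((r + j).factorial : k) ≠ 0 := by exact_mod_cast Nat.factorial_ne_zero _
            have h7 : ((M - j).factorial : k) ≠ 0 := by exact_mod_cast Nat.factorial_ne_zero _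
            have h8 : ((r + j).choose r : k) ≠ 0 := by
              exact_mod_cast (Nat.choose_pos (by omega)).ne'
            have := mul_ne_zero (mul_ne_zero (div_ne_zero hl h6) (div_ne_zero hm h7)) h8
            exact this h'
          · exact hG h'
    · have h9 : r + j + (M - j) - r = M := by omega
      have h10 : r + j - r = j := by omega
      simp only [h9, h10]
  · rintro ⟨p, q, s⟩ h _
    simp only [Finset.mem_sigma, Finset.mem_range] at h
    obtain ⟨j, rfl⟩ : ∃ j, p = s + j := ⟨p - s, by omega⟩
    simp only
    rw [show s + j + q - s = j + q by omega, show s + j - s = j by omega,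
      ← Nat.cast_smul_eq_nsmul k, smul_smul, smul_smul, smul_smul]
    congr 1
    rw [show j + q - j = q by omega]
    have h6 : ((s + j).factorial : k) ≠ 0 := by exact_mod_cast Nat.factorial_ne_zero _
    have h7 : (q.factorial : k) ≠ 0 := by exact_mod_cast Nat.factorial_ne_zero _
    have h8 : ((j + q).factorial : k) ≠ 0 := by exact_mod_cast Nat.factorial_ne_zero _
    have h9 : (s.factorial : k) ≠ 0 := by exact_mod_cast Nat.factorial_ne_zero _
    have h10 : (j.factorial : k) ≠ 0 := by exact_mod_cast Nat.factorial_ne_zero _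
    have e1 : ((s + j).choose s : k) * s.factorial * j.factorial = (s + j).factorial := by
      exact_mod_cast Nat.choose_symm_add (a := s) (b := j) ▸
        Nat.add_choose_mul_factorial_mul_factorial s j
    have e2 : ((j + q).choose j : k) * j.factorial * q.factorial = (j + q).factorial := by
      exact_mod_cast Nat.choose_symm_add (a := j) (b := q) ▸
        Nat.add_choose_mul_factorial_mul_factorial j q
    have e3 : ((s + j).choose s : k) / (s + j).factorial = 1 / (s.factorial * j.factorial) := by
      rw [div_eq_div_iff h6 (mul_ne_zero h9 h10), ← e1]; ring
    have e4 : ((j + q).choose j : k) / (j + q).factorial = 1 / (j.factorial * q.factorial) := by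
      rw [div_eq_div_iff h8 (mul_ne_zero h10 h7), ← e2]; ring
    calc l ^ (s + j) / ((s + j).factorial : k) * (m ^ q / q.factorial) * ((s + j).choose s : k)
        = l ^ (s + j) * m ^ q / q.factorial * (((s + j).choose s : k) / (s + j).factorial) := by
          ring
      _ = l ^ s / s.factorial * (l ^ j * m ^ q * (((j + q).choose j : k) / (j + q).factorial)) := by
          rw [e3, e4, pow_add]; field_simp
      _ = _ := by ring

end Egf

/-! ### The symbol of an element of `U(3)` -/

section SymbolMap

open Polynomial

variable {k : Type*} [Field k]

/-- The value of a polynomial `p(∂) u` at a point. -/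
noncomputable def evalM {α Δ : k} (x : k) : VirModule k α Δ →ₗ[k] k :=
  (Polynomial.leval x : k[X] →ₗ[k] k)

lemma evalM_eq {α Δ : k} (x : k) (p : VirModule k α Δ) :
    evalM x p = Polynomial.eval x (show k[X] from p) := rfl

lemma evZero_act (α Δ : k) (a : U3 k) (p : VirModule k α Δ) :
    EvZero fun n => VirModule.act α Δ n a p :=
  VirModule.act_locality α Δ a p

/-- Taylor's formula. -/
lemma egf_derivative [CharZero k] (x l : k) (p : k[X]) :
    egf l (fun n => (derivative^[n] p).eval x) = p.eval (x + l) := by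
  have h1 : ∀ n, p.natDegree + 1 ≤ n → (derivative^[n] p).eval x = 0 := fun n hn => by
    rw [iterate_derivative_eq_zero hn, eval_zero]
  rw [egf_eq_sum h1]
  have h2 : p.eval (x + l) = (taylor x p).eval l := by rw [taylor_eval, add_comm]
  rw [h2, eval_eq_sum_range, natDegree_taylor]
  refine Finset.sum_congr rfl fun n _ => ?_
  have h3 : (n.factorial : k) ≠ 0 := by exact_mod_cast n.factorial_ne_zero
  have h4 := congrFun (factorial_smul_hasseDeriv (R := k) (k := n)) p
  rw [LinearMap.smul_apply] at h4
  rw [taylor_coeff, ← h4, nsmul_eq_mul, eval_mul, eval_natCast, smul_eq_mul]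
  field_simp

/-- The `n`-products of symbols: the coefficients of the `λ`-product, multiplied by `n!`. -/
noncomputable def cprod (n : ℕ) (a b : Sym k) : Sym k := (n.factorial : k) • (fL a * fR b).coeff n

lemma ev_lam_eq_eval (x y d l : k) (a b : Sym k) :
    ev x y d (lam l a b) = ((fL a * fR b).map (ev x y d).toRingHom).eval l := by
  rw [lam_eq_sum, map_sum, eval_map, eval₂_eq_sum_range]
  refine Finset.sum_congr rfl fun i _ => ?_
  rw [map_smul, smul_eq_mul, mul_comm]
  rfl

/-- The generator `v` has the symbol `x + Δ (y - x)`. -/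
lemma evalM_act_v [CharZero k] (d : k) (p : VirModule k 0 d) (x l : k) :
    egf l (fun n => evalM x (VirModule.act 0 d n (U3.v k) p)) =
      (x + d * l) * evalM (x + l) p := by
  have h0 : ∀ (q : k[X]) (n : ℕ), eval x ((X + C 0) * ((derivative : Module.End k k[X]) ^ n) q +
      (n : k) • d • ((derivative : Module.End k k[X]) ^ (n - 1)) q) =
      x * (derivative^[n] q).eval x + n • (d * (derivative^[n - 1] q).eval x) := by
    intro q n
    rw [Module.End.pow_apply, Module.End.pow_apply]
    simp
  have h1 : ∀ n, evalM x (VirModule.act 0 d n (U3.v k) p) =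
      x * (derivative^[n] (show k[X] from p)).eval x +
        n • (d * (derivative^[n - 1] (show k[X] from p)).eval x) := by
    intro n
    rw [VirModule.act_v]
    exact h0 p n
  have h2 : EvZero fun n => (derivative^[n] (show k[X] from p)).eval x :=
    ⟨natDegree (show k[X] from p) + 1, fun n hn => by
      simp only [iterate_derivative_eq_zero (Nat.lt_of_succ_le hn), eval_zero]⟩
  have h3 : ∀ c : k, EvZero fun n => c * (derivative^[n] (show k[X] from p)).eval x :=
    fun c => h2.map (LinearMap.mulLeft k c)
  simp only [h1]
  have h4 := egf_deriv l (h3 d)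
  have h5 : ∀ c : k, egf l (fun n => c * (derivative^[n] (show k[X] from p)).eval x) = _ :=
    fun c => egf_map l h2 (LinearMap.mulLeft k c)
  rw [egf_add l (h3 x) (h3 d).deriv, h4, h5, h5, egf_derivative]
  simp only [LinearMap.mulLeft_apply, smul_eq_mul, evalM_eq]
  ring

/-- The action of `a` on a vector is multiplication by a symbol combined with a translation. -/
def HasSymbol (a : U3 k) (q : Sym k) : Prop :=
  ∀ (d : k) (p : VirModule k 0 d) (x l : k),
    egf l (fun n => evalM x (VirModule.act 0 d n a p)) = ev x (x + l) d q * evalM (x + l) p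

lemma evZero_evalM {α Δ : k} (a : U3 k) (p : VirModule k α Δ) (x : k) :
    EvZero fun n => evalM x (VirModule.act α Δ n a p) :=
  (evZero_act α Δ a p).map (evalM x)

lemma HasSymbol.D [CharZero k] {a : U3 k} {q : Sym k} (h : HasSymbol a q) :
    HasSymbol (U3.D k a) (del * q) := by
  intro d p x l
  have h1 : ∀ n, evalM x (VirModule.act 0 d n (U3.D k a) p) =
      (-LinearMap.id : k →ₗ[k] k) (n • evalM x (VirModule.act 0 d (n - 1) a p)) := by
    intro n
    rw [VirModule.act_Dl, LinearMap.neg_apply, LinearMap.smul_apply, map_neg, map_nsmul]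
    rfl
  simp only [h1]
  rw [egf_map l (evZero_evalM a p x).deriv, egf_deriv l (evZero_evalM a p x), h d p x l]
  simp
  ring

lemma HasSymbol.add {a b : U3 k} {q r : Sym k} (h : HasSymbol a q) (h' : HasSymbol b r) :
    HasSymbol (a + b) (q + r) := by
  intro d p x l
  simp only [map_add, LinearMap.add_apply]
  rw [egf_add l (evZero_evalM a p x) (evZero_evalM b p x), h d p x l, h' d p x l]
  ring

lemma HasSymbol.smul {a : U3 k} {q : Sym k} (h : HasSymbol a q) (c : k) :
    HasSymbol (c • a) (c • q) := by
  intro d p x l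
  simp only [map_smul, LinearMap.smul_apply]
  have h1 := egf_map l (evZero_evalM a p x) (c • (LinearMap.id : k →ₗ[k] k))
  simp only [LinearMap.smul_apply, LinearMap.id_apply] at h1
  rw [h1, h d p x l]
  simp
  ring

/-- By associativity the generating function of the operators of `a ₍ₛ₎ b`, `s ≥ 0`, is a
composition of the operators of `a` and `b`, and the symbols of the products are its coefficients.
-/
lemma HasSymbol.prod [CharZero k] {a b : U3 k} {q r : Sym k} (h : HasSymbol a q)
    (h' : HasSymbol b r) (n : ℕ) : HasSymbol (U3.prod k n a b) (cprod n q r) := by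
  intro d p x ν
  obtain ⟨A, hA⟩ := U3.local_all k a b
  have hB : ∃ B, ∀ s M, B ≤ M → evalM x (VirModule.act 0 d M (U3.prod k s a b) p) = 0 := by
    choose N hN using fun s => evZero_evalM (α := 0) (Δ := d) (U3.prod k s a b) p x
    refine ⟨∑ s ∈ range A, N s, fun s M hM => ?_⟩
    rcases le_or_gt A s with hs | hs
    · rw [hA s hs, map_zero, LinearMap.zero_apply, map_zero]
    · exact hN s M ((Finset.single_le_sum (fun _ _ => Nat.zero_le _)
        (Finset.mem_range.2 hs)).trans hM)
  obtain ⟨B, hB⟩ := hB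
  have hA' : ∀ s M, A ≤ s → evalM x (VirModule.act 0 d M (U3.prod k s a b) p) = 0 := by
    intro s M hs
    rw [hA s hs, map_zero, LinearMap.zero_apply, map_zero]
  -- This is `(a_λ b)_ν p = a_λ (b_{ν - λ} p)` at the point `x`, as a polynomial in `λ = l`.
  have key : ∀ l, egf l (fun s => egf ν fun M =>
      evalM x (VirModule.act 0 d M (U3.prod k s a b) p)) =
      ((Polynomial.C (evalM (x + ν) p)) *
        (fL q * fR r).map (ev x (x + ν) d).toRingHom).eval l := by
    intro l
    have h1 := egf_binomial l (ν - l) hA' hB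
    rw [add_sub_cancel] at h1
    rw [← h1, eval_mul, eval_C, ← ev_lam_eq_eval, ev_lam]
    have h2 : ∀ i j, ∑ s ∈ range (i + 1), i.choose s • evalM x
        (VirModule.act 0 d (i + j - s) (U3.prod k s a b) p) =
        evalM x (VirModule.act 0 d i a (VirModule.act 0 d j b p)) := by
      intro i j
      have h3 := LinearMap.congr_fun (VirModule.act_mul_act 0 d i j a b) p
      rw [Module.End.mul_apply] at h3
      rw [h3, LinearMap.sum_apply, map_sum, ← Finset.sum_range_reflect]
      refine Finset.sum_congr rfl fun s hs => ?_
      rw [Finset.mem_range] at hs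
      rw [LinearMap.smul_apply, map_nsmul, show i + 1 - 1 - s = i - s by omega,
        Nat.choose_symm (by omega), show i + j - (i - s) = j + s by omega]
    simp only [h2]
    have h4 : ∀ i, egf (ν - l) (fun j => evalM x (VirModule.act 0 d i a
        (VirModule.act 0 d j b p))) =
        evalM x (VirModule.act 0 d i a (egf (ν - l) fun j => VirModule.act 0 d j b p)) := by
      intro i
      exact egf_map (ν - l) (evZero_act 0 d b p) (evalM x ∘ₗ VirModule.act 0 d i a)
    simp only [h4]
    rw [h d _ x l, ← egf_map (ν - l) (evZero_act 0 d b p) (evalM (x + l)), h' d p (x + l) (ν - l),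
      add_add_sub_cancel]
    ring
  have h5 : EvZero fun s => egf ν fun M => evalM x (VirModule.act 0 d M (U3.prod k s a b) p) :=
    ⟨A, fun s hs => by simp only [fun M => hA' s M hs, egf_zero]⟩
  have h6 := coeff_eq_of_egf_eq h5 key n
  rw [h6, coeff_C_mul, coeff_map, cprod, map_smul, smul_eq_mul]
  change _ * (_ * (ev x (x + ν) d) _) = _
  ring

lemma exists_hasSymbol [CharZero k] (a : U3 k) : ∃ q : Sym k, HasSymbol a q := by
  induction a using U3.induction with
  | hv =>
    refine ⟨MvPolynomial.X 0 + MvPolynomial.X 2 * (MvPolynomial.X 1 - MvPolynomial.X 0),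
      fun d p x l => ?_⟩
    rw [evalM_act_v]
    simp
  | hD a h =>
    obtain ⟨q, hq⟩ := h
    exact ⟨_, hq.D⟩
  | hprod n a b h h' =>
    obtain ⟨q, hq⟩ := h
    obtain ⟨r, hr⟩ := h'
    exact ⟨_, hq.prod hr n⟩
  | h0 => exact ⟨0, fun d p x l => by simp [egf_zero]⟩
  | hadd a b h h' =>
    obtain ⟨q, hq⟩ := h
    obtain ⟨r, hr⟩ := h'
    exact ⟨_, hq.add hr⟩
  | hsmul c a h =>
    obtain ⟨q, hq⟩ := h
    exact ⟨_, hq.smul c⟩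

/-- The action on the generators of the modules `M_(0, Δ)` determines the symbol. -/
lemma HasSymbol.unique [CharZero k] {a : U3 k} {q r : Sym k} (h : HasSymbol a q)
    (h' : HasSymbol a r) : q = r := by
  refine sym_ext fun x y d => ?_
  have h1 := h d (show VirModule k 0 d from (1 : k[X])) x (y - x)
  rw [h' d (show VirModule k 0 d from (1 : k[X])) x (y - x)] at h1
  have h2 : ∀ z, evalM z (show VirModule k 0 d from (1 : k[X])) = 1 := fun z => by
    rw [evalM_eq]; exact eval_one
  rw [h2, add_sub_cancel, mul_one, mul_one] at h1
  exact h1.symm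

variable [CharZero k]

/-- The symbol of an element of `U(3)`: the polynomial `a(x, y, Δ)` such that
`(a_λ p)(x) = a(x, x + λ, Δ) p(x + λ)` in all the modules `M_(0, Δ)`. -/
noncomputable def sym : U3 k →ₗ[k] Sym k where
  toFun a := (exists_hasSymbol a).choose
  map_add' a b := (exists_hasSymbol (a + b)).choose_spec.unique
    ((exists_hasSymbol a).choose_spec.add (exists_hasSymbol b).choose_spec)
  map_smul' c a := (exists_hasSymbol (c • a)).choose_spec.unique
    ((exists_hasSymbol a).choose_spec.smul c)

lemma hasSymbol_sym (a : U3 k) : HasSymbol a (sym a) := (exists_hasSymbol a).choose_spec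

lemma sym_v : sym (U3.v k) =
    MvPolynomial.X 0 + MvPolynomial.X 2 * (MvPolynomial.X 1 - MvPolynomial.X 0) :=
  (hasSymbol_sym _).unique fun d p x l => by
    rw [evalM_act_v]
    simp

lemma sym_D (a : U3 k) : sym (U3.D k a) = del * sym a :=
  (hasSymbol_sym _).unique (hasSymbol_sym a).D

lemma sym_prod (n : ℕ) (a b : U3 k) : sym (U3.prod k n a b) = cprod n (sym a) (sym b) :=
  (hasSymbol_sym _).unique ((hasSymbol_sym a).prod (hasSymbol_sym b) n)

lemma evZero_prod (a b : U3 k) : EvZero fun n => U3.prod k n a b := U3.local_all k a b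

/-- The `λ`-product of symbols is the generating function of the `n`-products. -/
lemma lam_sym (l : k) (a b : U3 k) :
    lam l (sym a) (sym b) = sym (egf l fun n => U3.prod k n a b) := by
  rw [← egf_map l (evZero_prod a b)]
  have h1 : ∀ n, (fL (sym a) * fR (sym b)).natDegree + 1 ≤ n →
      sym (U3.prod k n a b) = 0 := by
    intro n hn
    rw [sym_prod, cprod, coeff_eq_zero_of_natDegree_lt (Nat.lt_of_succ_le hn), smul_zero]
  rw [egf_eq_sum h1, lam_eq_sum]
  refine Finset.sum_congr rfl fun n _ => ?_
  have h3 : (n.factorial : k) ≠ 0 := by exact_mod_cast n.factorial_ne_zero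
  rw [sym_prod, cprod, smul_smul]
  congr 1
  field_simp

end SymbolMap

/-! ### The structure of `U(3)` -/

section Structure

variable {k : Type*} [Field k]

/-- The symbols `a` with `y a(x, y, 0) = x a(x, y, 1)`, that is, with `a(x, y, 0) = x q(x, y)` and
`a(x, y, 1) = y q(x, y)` for a polynomial `q`: the image of `U(3)`. -/
def CQ (k : Type*) [Field k] : Submodule k (Sym k) where
  carrier := {a | ∀ x y, y * ev x y 0 a = x * ev x y 1 a}
  add_mem' {a b} ha hb x y := by
    simp only [map_add, mul_add]
    rw [ha x y, hb x y]
  zero_mem' x y := by simp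
  smul_mem' c a ha x y := by
    simp only [map_smul, smul_eq_mul]
    linear_combination c * ha x y

lemma mem_CQ {a : Sym k} : a ∈ CQ k ↔ ∀ x y, y * ev x y 0 a = x * ev x y 1 a := Iff.rfl

/-- The symbol of the generator. -/
noncomputable def vS : Sym k :=
  MvPolynomial.X 0 + MvPolynomial.X 2 * (MvPolynomial.X 1 - MvPolynomial.X 0)

@[simp] lemma ev_vS (x y d : k) : ev x y d vS = x + d * (y - x) := by simp [vS]

variable [CharZero k]

/-- A linear functional that vanishes on all `λ`-products vanishes on the coefficients. -/
lemma coeff_functional (f : Sym k →ₗ[k] k) {a b : Sym k} (h : ∀ l, f (lam l a b) = 0) (i : ℕ) :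
    f ((fL a * fR b).coeff i) = 0 := by
  set F := fL a * fR b
  have h1 : (∑ i ∈ range (F.natDegree + 1), Polynomial.monomial i (f (F.coeff i))) = 0 := by
    refine Polynomial.funext fun l => ?_
    have h2 := h l
    rw [lam_eq_sum, map_sum] at h2
    rw [Polynomial.eval_finsetSum, Polynomial.eval_zero, ← h2]
    refine Finset.sum_congr rfl fun i _ => ?_
    rw [Polynomial.eval_monomial, map_smul, smul_eq_mul, mul_comm]
  have h3 := congrArg (fun p => Polynomial.coeff p i) h1
  simp only [Polynomial.finsetSum_coeff, Polynomial.coeff_monomial, Polynomial.coeff_zero] at h3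
  rw [Finset.sum_ite_eq'] at h3
  split_ifs at h3 with h4
  · exact h3
  · rw [Polynomial.coeff_eq_zero_of_natDegree_lt (by simpa using h4), map_zero]

lemma exists_qC : ∃ f : CQ k →ₗ[k] Sym k, ∀ b : CQ k, MvPolynomial.X 1 * f b = e1 (b : Sym k) := by
  refine exists_quot (e1.toLinearMap ∘ₗ (CQ k).subtype) _ (MvPolynomial.X_ne_zero _) fun b => ?_
  refine X1_dvd fun x d => ?_
  have h := b.2
  have h2 : ∀ x y d : k, ev x y d (MvPolynomial.X 0) *
      ev x y d (MvPolynomial.aeval ![MvPolynomial.X 0, 0, 1] (b : Sym k)) = 0 := by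
    intro x y d
    have h3 := h x 0
    have h4 := ev_sub (MvPolynomial.X 0) 0 1 x y d (b : Sym k)
    simp only [sub, ev_X0, map_zero, map_one] at h4
    rw [h4, ev_X0, ← h3, zero_mul]
  have h5 := ev_eq_zero_of_mul (MvPolynomial.X_ne_zero (R := k) 0) h2 x 0 0
  have h4 := ev_sub (MvPolynomial.X 0) 0 1 x 0 0 (b : Sym k)
  simp only [sub, ev_X0, map_zero, map_one] at h4
  rw [h4] at h5
  simpa using h5

/-- The polynomial `q` with `a(x, y, 0) = x q(x, y)` and `a(x, y, 1) = y q(x, y)`, for `a ∈ CQ`. -/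
noncomputable def qC : CQ k →ₗ[k] Sym k := exists_qC.choose

lemma X1_mul_qC (b : CQ k) : MvPolynomial.X 1 * qC b = e1 (b : Sym k) := exists_qC.choose_spec b

lemma ev_qC_mul (b : CQ k) (x y d : k) : y * ev x y d (qC b) = ev x y 1 (b : Sym k) := by
  simpa using congrArg (ev x y d) (X1_mul_qC b)

lemma e0_qC (b : CQ k) : e0 (qC b) = qC b := by
  refine mul_left_cancel₀ (MvPolynomial.X_ne_zero (R := k) (1 : Fin 3)) (sym_ext fun x y d => ?_)
  simp [ev_qC_mul]

lemma ev_qC (b : CQ k) (x y d : k) : ev x y d (qC b) = ev x y 0 (qC b) := by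
  rw [← ev_e0 x y d, e0_qC]

lemma ev_mul_qC (b : CQ k) (x y d : k) : x * ev x y d (qC b) = ev x y 0 (b : Sym k) := by
  have h : (MvPolynomial.X 0 * qC b - e0 (b : Sym k) : Sym k) = 0 := by
    refine mul_left_cancel₀ (MvPolynomial.X_ne_zero (R := k) (1 : Fin 3)) (sym_ext fun x y d => ?_)
    have := b.2 x y
    simp only [map_mul, map_sub, ev_X0, ev_X1, ev_e0, map_zero]
    linear_combination x * ev_qC_mul b x y d - this
  have := congrArg (ev x y d) h
  simp only [map_mul, map_sub, ev_X0, ev_e0, map_zero] at this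
  linear_combination this

lemma exists_rC : ∃ f : CQ k →ₗ[k] Sym k, ∀ b : CQ k, cc * f b = (b : Sym k) - vS * qC b := by
  refine exists_quot ((CQ k).subtype - LinearMap.mulLeft k vS ∘ₗ qC) _ cc_ne_zero fun b => ?_
  refine cc_dvd (fun x y => ?_) (fun x y => ?_)
  · simpa using sub_eq_zero.2 (ev_mul_qC b x y 0).symm
  · simpa using sub_eq_zero.2 (ev_qC_mul b x y 1).symm

/-- The polynomial `r` of `a = q v + c r ∈ CQ`. -/
noncomputable def rC : CQ k →ₗ[k] Sym k := exists_rC.choose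

lemma CQ_eq (b : CQ k) : (b : Sym k) = vS * qC b + cc * rC b := by
  rw [rC, exists_rC.choose_spec b]; ring

/-! #### Spanning -/

/-- The operators `v ₍ₙ₎ ·`. -/
noncomputable def vn (n : ℕ) : U3 k →ₗ[k] U3 k := U3.prod k n (U3.v k)

lemma vn_eq_zero (n : ℕ) (hn : 3 ≤ n) : vn n (U3.v k) = 0 := U3.prod_v_v k n hn

lemma vn_one_v : vn 1 (U3.v k) = U3.v k + (2⁻¹ : k) • U3.D k (vn 2 (U3.v k)) := by
  have h := U3.vir k
  rw [← Nat.cast_smul_eq_nsmul k, ← Nat.cast_smul_eq_nsmul k] at h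
  have h2 : (2 : k) ≠ 0 := two_ne_zero
  have h3 := congrArg (fun z => (2⁻¹ : k) • z) h
  simp only [smul_sub, smul_smul, Nat.cast_ofNat, inv_mul_cancel₀ h2, one_smul] at h3
  exact sub_eq_iff_eq_add.1 h3

/-- The product of two operators `v ₍ₙ₎`, by associativity and the relations of `U(3)`. The
truncated differences `n + m - 1` and `n + m - 2` occur with coefficient zero where the truncation
matters. -/
lemma vn_vn (n m : ℕ) (a : U3 k) : vn n (vn m a) = U3.prod k (n + m) (vn 0 (U3.v k)) a +
    (n : k) • vn (n + m - 1) a - ((n * m : k) / 2) • U3.prod k (n + m - 2) (vn 2 (U3.v k)) a := by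
  have h1 : vn n (vn m a) = ∑ i ∈ range 3, (n.choose i : k) •
      U3.prod k (n + m - i) (vn i (U3.v k)) a := by
    have h := U3.prod_assoc k n m (U3.v k) (U3.v k) a
    rw [← Finset.sum_range_reflect] at h
    refine h.trans ?_
    have h2 : ∀ i ∈ range (n + 1), n.choose (n + 1 - 1 - i) •
        U3.prod k (m + (n + 1 - 1 - i)) (U3.prod k (n - (n + 1 - 1 - i)) (U3.v k) (U3.v k)) a =
        (n.choose i : k) • U3.prod k (n + m - i) (vn i (U3.v k)) a := by
      intro i hi
      rw [Finset.mem_range] at hi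
      rw [Nat.cast_smul_eq_nsmul, Nat.add_sub_cancel, Nat.choose_symm (by omega),
        show m + (n - i) = n + m - i by omega, show n - (n - i) = i by omega]
      rfl
    rw [Finset.sum_congr rfl h2]
    rcases le_total (n + 1) 3 with h3 | h3
    · refine Finset.sum_subset (by simpa using h3) fun i _ hi => ?_
      rw [Nat.choose_eq_zero_of_lt (by simpa using hi), Nat.cast_zero, zero_smul]
    · refine (Finset.sum_subset (by simpa using h3) fun i _ hi => ?_).symm
      rw [vn_eq_zero i (by simpa using hi), map_zero, LinearMap.zero_apply, smul_zero]
  rw [h1, Finset.sum_range_succ, Finset.sum_range_succ, Finset.sum_range_one, vn_one_v, map_add,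
    LinearMap.add_apply, map_smul, LinearMap.smul_apply, U3.D_prod, ← Nat.cast_smul_eq_nsmul k]
  rw [Nat.choose_zero_right, Nat.choose_one_right, Nat.cast_one, one_smul, Nat.sub_zero,
    Nat.sub_sub]
  rw [show U3.prod k (n + m - 1) (U3.v k) a = vn (n + m - 1) a from rfl, Nat.cast_choose_two]
  rcases Nat.eq_zero_or_pos n with rfl | hn
  · simp
  · rw [Nat.cast_sub (show 1 ≤ n + m by omega), smul_add, smul_neg, smul_neg, smul_smul, smul_smul]
    push_cast
    module

lemma vn_vn_zero (n : ℕ) (a : U3 k) :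
    vn n (vn 0 a) = vn 0 (vn n a) + (n : k) • vn (n - 1) a := by
  rw [vn_vn, vn_vn]
  simp

lemma vn_vn_one (n : ℕ) (a : U3 k) :
    vn n (vn 1 a) = vn 1 (vn n a) + ((n : k) - 1) • vn n a := by
  rw [vn_vn, vn_vn, add_comm 1 n, Nat.add_sub_cancel]
  push_cast
  module

/-- The relations for `v ₍ₙ₎ v ₍₂₎ v` and `v ₍₂₎ v ₍ₙ₎ v`, and for small `n` those of the same total
degree, force these products to vanish. -/
lemma vn_e (n : ℕ) (hn : 2 ≤ n) : vn n (vn 2 (U3.v k)) = 0 := by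
  have h := vn_vn n 2 (U3.v k)
  have h' := vn_vn 2 n (U3.v k)
  rw [add_comm 2 n, vn_eq_zero (n + 2 - 1) (by omega), smul_zero] at h'
  rw [vn_eq_zero (n + 2 - 1) (by omega), smul_zero] at h
  rcases hn.eq_or_lt with rfl | hn
  · have h2 := vn_vn 1 3 (U3.v k)
    have h3 := vn_vn 0 4 (U3.v k)
    have h4 := vn_eq_zero (k := k) 3 le_rfl
    have h5 := vn_eq_zero (k := k) 4 (by norm_num)
    norm_num [h4, h5] at h h2 h3
    rw [← h3] at h h2
    norm_num at h h2
    rw [h, h2, smul_zero, neg_zero]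
  · rw [vn_eq_zero n hn, map_zero] at h'
    rw [h, mul_comm (n : k)]
    exact h'.symm

lemma vn_D (n : ℕ) (a : U3 k) : vn n (U3.D k a) = U3.D k (vn n a) + (n : k) • vn (n - 1) a := by
  rw [vn, U3.prod_D, Nat.cast_smul_eq_nsmul]; rfl

/-- The elements `v` and `v(1)ⁱ e`, where `e = v ₍₂₎ v`. -/
noncomputable def gen0 : Option ℕ → U3 k
  | none => U3.v k
  | some i => (vn 1)^[i] (vn 2 (U3.v k))

/-- The elements `v(0)ʲ ∂ˡ v` and `v(0)ʲ ∂ˡ v(1)ⁱ e`. -/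
noncomputable def gen (j l : ℕ) (o : Option ℕ) : U3 k := (vn 0)^[j] ((U3.D k)^[l] (gen0 o))

variable (k) in
/-- The span of the elements `gen`. -/
noncomputable def genSpan : Submodule k (U3 k) :=
  Submodule.span k (Set.range fun x : ℕ × ℕ × Option ℕ => gen x.1 x.2.1 x.2.2)

lemma gen_mem (j l : ℕ) (o : Option ℕ) : (gen j l o : U3 k) ∈ genSpan k :=
  Submodule.subset_span ⟨(j, l, o), rfl⟩

lemma genSpan_le {V : Submodule k (U3 k)} (h : ∀ j l o, gen j l o ∈ V) : genSpan k ≤ V := by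
  refine Submodule.span_le.2 ?_
  rintro _ ⟨x, rfl⟩
  exact h _ _ _

lemma vn_zero_mem {a : U3 k} (ha : a ∈ genSpan k) : vn 0 a ∈ genSpan k := by
  have : genSpan k ≤ (genSpan k).comap (vn 0) := genSpan_le fun j l o => by
    rw [Submodule.mem_comap, gen, ← Function.iterate_succ_apply' (vn 0)]
    exact gen_mem (j + 1) l o
  exact this ha

lemma D_mem {a : U3 k} (ha : a ∈ genSpan k) : U3.D k a ∈ genSpan k := by
  have : genSpan k ≤ (genSpan k).comap (U3.D k) := genSpan_le fun j l o => by
    have h : U3.D k (gen j l o) = gen j (l + 1) o := by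
      induction j with
      | zero => simp [gen, Function.iterate_succ_apply']
      | succ j ih =>
        have h1 : ∀ l, (gen (j + 1) l o : U3 k) = vn 0 (gen j l o) :=
          fun l => Function.iterate_succ_apply' _ _ _
        have h2 := vn_D 0 (gen j l o : U3 k)
        rw [Nat.cast_zero, zero_smul, add_zero] at h2
        rw [h1, h1, ← h2, ih]
    rw [Submodule.mem_comap, h]
    exact gen_mem _ _ _
  exact this ha

lemma vn_gen0_mem (n : ℕ) (o : Option ℕ) : vn n (gen0 o : U3 k) ∈ genSpan k := by
  have hg : ∀ o, (gen0 o : U3 k) ∈ genSpan k := fun o => gen_mem 0 0 o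
  cases o with
  | none =>
    rcases n with _ | _ | _ | n
    · exact vn_zero_mem (hg none)
    · change vn 1 (U3.v k) ∈ _
      rw [vn_one_v]
      exact add_mem (hg none) ((genSpan k).smul_mem _ (D_mem (hg (some 0))))
    · exact hg (some 0)
    · change vn (n + 3) (U3.v k) ∈ _
      rw [vn_eq_zero (n + 3) (by omega)]
      exact zero_mem _
  | some i =>
    rcases n with _ | _ | n
    · exact vn_zero_mem (hg _)
    · have : vn 1 (gen0 (some i) : U3 k) = gen0 (some (i + 1)) :=
        (Function.iterate_succ_apply' _ _ _).symm
      rw [this]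
      exact hg _
    · have : vn (n + 2) (gen0 (some i) : U3 k) = 0 := by
        induction i with
        | zero => exact vn_e (n + 2) (by omega)
        | succ i ih =>
          have h1 : (gen0 (some (i + 1)) : U3 k) = vn 1 (gen0 (some i)) :=
            Function.iterate_succ_apply' _ _ _
          rw [h1, vn_vn_one, ih, map_zero, smul_zero, add_zero]
      rw [this]
      exact zero_mem _

lemma vn_mem (n : ℕ) {a : U3 k} (ha : a ∈ genSpan k) : vn n a ∈ genSpan k := by
  have : genSpan k ≤ (genSpan k).comap (vn n) := genSpan_le fun j l o => by
    rw [Submodule.mem_comap]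
    induction j generalizing n with
    | zero =>
      induction l generalizing n with
      | zero => exact vn_gen0_mem n o
      | succ l ih =>
        have h1 : (gen 0 (l + 1) o : U3 k) = U3.D k (gen 0 l o) :=
          Function.iterate_succ_apply' _ _ _
        rw [h1, vn_D]
        exact add_mem (D_mem (ih n)) ((genSpan k).smul_mem _ (ih _))
    | succ j ih =>
      have h1 : (gen (j + 1) l o : U3 k) = vn 0 (gen j l o) := Function.iterate_succ_apply' _ _ _
      rw [h1, vn_vn_zero]
      exact add_mem (vn_zero_mem (ih n)) ((genSpan k).smul_mem _ (ih _))
  exact this ha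

/-- The span is a left ideal: the product of `a ₍ₘ₎ a'` and `b` is expressed through iterated
products by associativity, with induction on `m`. -/
lemma prod_mem (a : U3 k) (n : ℕ) {b : U3 k} (hb : b ∈ genSpan k) :
    U3.prod k n a b ∈ genSpan k := by
  induction a using U3.induction generalizing n b with
  | hv => exact vn_mem n hb
  | hD a h =>
    rw [U3.D_prod]
    exact neg_mem (nsmul_mem (h _ hb) _)
  | hprod m a a' h h' =>
    induction m using Nat.strong_induction_on generalizing n with
    | _ m ih =>
      have h1 := U3.prod_assoc k m n a a' b
      rw [Finset.sum_range_succ', Nat.choose_zero_right, one_smul, add_zero, Nat.sub_zero] at h1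
      rw [← sub_eq_iff_eq_add'.2 h1]
      refine sub_mem (h _ (h' _ hb)) (sum_mem fun s hs => nsmul_mem ?_ _)
      rw [Finset.mem_range] at hs
      exact ih _ (by omega) _
  | h0 => simp
  | hadd a a' h h' =>
    rw [map_add]
    exact add_mem (h n hb) (h' n hb)
  | hsmul c a h =>
    rw [map_smul]
    exact (genSpan k).smul_mem _ (h n hb)

lemma mem_genSpan (a : U3 k) : a ∈ genSpan k := by
  induction a using U3.induction with
  | hv => exact gen_mem 0 0 none
  | hD a h => exact D_mem h
  | hprod n a b _ h => exact prod_mem a n h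
  | h0 => exact zero_mem _
  | hadd a b h h' => exact add_mem h h'
  | hsmul c a h => exact (genSpan k).smul_mem _ h

end Structure

/-! #### The symbol map is an isomorphism -/

section SymEquiv

open MvPolynomial

variable {k : Type*} [Field k] [CharZero k]

/-- Uniqueness of the decomposition `b = q v + c r` with `q` independent of `Δ`. -/
lemma eq_qC_rC {b : CQ k} {q r : Sym k} (hq : e0 q = q) (h : (b : Sym k) = vS * q + cc * r) :
    qC b = q ∧ rC b = r := by
  have h1 : qC b = q := by
    refine mul_left_cancel₀ (X_ne_zero (R := k) (1 : Fin 3)) (sym_ext fun x y d => ?_)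
    have h2 : ev x y 1 q = ev x y d q := by
      rw [← hq]; simp
    rw [map_mul, map_mul, ev_X1, ev_qC_mul, h]
    simp [h2]
  refine ⟨h1, mul_left_cancel₀ cc_ne_zero ?_⟩
  have h3 := CQ_eq b
  rw [h, h1] at h3
  exact (add_left_cancel h3).symm

lemma fL_vS : fL (vS : Sym k) = Polynomial.C (X 0) + Polynomial.C (X 2) * Polynomial.X := by
  simp only [vS, fL, map_add, map_mul, map_sub, aeval_X]
  simp

lemma sym_vn_zero (a : U3 k) : sym (vn 0 a) = X 0 * sym a := by
  have h : egf (0 : k) (fun n => U3.prod k n (U3.v k) a) = vn 0 a := by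
    obtain ⟨N, hN⟩ := evZero_prod (U3.v k) a
    have h1 : ∀ n, N + 1 ≤ n → U3.prod k n (U3.v k) a = 0 := fun n hn => hN n (by omega)
    rw [egf_eq_sum h1, Finset.sum_range_succ']
    simp [vn]
  rw [← h, ← lam_sym]
  refine sym_ext fun x y d => ?_
  rw [ev_lam, sym_v]
  simp

lemma sym_vn_iterate (j : ℕ) (a : U3 k) : sym ((vn 0)^[j] a) = X 0 ^ j * sym a := by
  induction j with
  | zero => simp
  | succ j ih => rw [Function.iterate_succ_apply', sym_vn_zero, ih]; ring

lemma sym_D_iterate (l : ℕ) (a : U3 k) : sym ((U3.D k)^[l] a) = del ^ l * sym a := by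
  induction l with
  | zero => simp
  | succ j ih => rw [Function.iterate_succ_apply', sym_D, ih]; ring

lemma sym_v' : sym (U3.v k) = vS := sym_v

lemma sym_e : sym (vn 2 (U3.v k)) = C (-2) * cc := by
  have h : fL (vS : Sym k) * fR (vS : Sym k) = Polynomial.C (X 0 * (X 0 + X 2 * (X 1 - X 0))) +
      Polynomial.C (X 0 * (1 - X 2) + X 2 * (X 0 + X 2 * (X 1 - X 0))) * Polynomial.X +
        Polynomial.C (X 2 * (1 - X 2)) * Polynomial.X ^ 2 := by
    rw [fL_vS]
    simp only [vS, fR, map_add, map_mul, map_sub, aeval_X, map_one]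
    simp
    ring
  have h2 : ∀ p q r : Sym k, (Polynomial.C p + Polynomial.C q * Polynomial.X +
      Polynomial.C r * Polynomial.X ^ 2).coeff 2 = r := fun p q r => by
    simp
  rw [vn, sym_prod, sym_v', cprod, h, h2]
  refine sym_ext fun x y d => ?_
  simp
  ring

lemma sym_vn_one (i : ℕ) : sym ((vn 1)^[i] (vn 2 (U3.v k))) = C (-2) * cc * X 2 ^ i := by
  induction i with
  | zero => simp [sym_e]
  | succ i ih =>
    have h : fR (C (-2) * cc * X 2 ^ i : Sym k) = Polynomial.C (C (-2) * cc * X 2 ^ i) := by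
      simp only [cc, fR, map_mul, map_sub, map_pow, aeval_X, aeval_C]
      rfl
    have h1 : sym (vn 1 ((vn 1)^[i] (vn 2 (U3.v k)))) = _ := sym_prod 1 _ _
    rw [Function.iterate_succ_apply', h1, sym_v', ih, cprod, h, fL_vS, Polynomial.coeff_mul_C]
    simp
    ring

lemma sym_gen_none (j l : ℕ) : sym (gen j l none : U3 k) = vS * (X 0 ^ j * del ^ l) := by
  rw [gen, sym_vn_iterate, sym_D_iterate, gen0, sym_v']
  ring

lemma sym_gen_some (j l i : ℕ) :
    sym (gen j l (some i) : U3 k) = cc * (C (-2) * (X 0 ^ j * del ^ l * X 2 ^ i)) := by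
  rw [gen, sym_vn_iterate, sym_D_iterate, gen0, sym_vn_one]
  ring

lemma sym_mem (a : U3 k) : sym a ∈ CQ k := by
  have h : genSpan k ≤ (CQ k).comap sym := genSpan_le fun j l o => by
    rw [Submodule.mem_comap, mem_CQ]
    intro x y
    cases o with
    | none =>
      rw [sym_gen_none]
      simp
      ring
    | some i =>
      rw [sym_gen_some]
      simp
  exact h (mem_genSpan a)

/-- The map `xʲ yˡ Δⁱ ↦ v(0)ʲ ∂ˡ v`, which inverts the symbol map on `k[x, y] v` up to the
substitution of `∂` for `y`. -/
noncomputable def theta0 : Sym k →ₗ[k] U3 k :=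
  (basisMonomials (Fin 3) k).constr k fun m => gen (m 0) (m 1) none
/-- The map `xʲ yˡ Δⁱ ↦ v(0)ʲ ∂ˡ v(1)ⁱ e`, which inverts the symbol map on `c k[x, y, Δ]` up to
the substitution of `∂` for `y` and a factor. -/
noncomputable def theta1 : Sym k →ₗ[k] U3 k :=
  (basisMonomials (Fin 3) k).constr k fun m => gen (m 0) (m 1) (some (m 2))

lemma theta0_monomial (m : Fin 3 →₀ ℕ) :
    theta0 (monomial m 1 : Sym k) = gen (m 0) (m 1) none := by
  have := (basisMonomials (Fin 3) k).constr_basis k (fun m => (gen (m 0) (m 1) none : U3 k)) m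
  rwa [coe_basisMonomials] at this

lemma theta1_monomial (m : Fin 3 →₀ ℕ) :
    theta1 (monomial m 1 : Sym k) = gen (m 0) (m 1) (some (m 2)) := by
  have := (basisMonomials (Fin 3) k).constr_basis k
    (fun m => (gen (m 0) (m 1) (some (m 2)) : U3 k)) m
  rwa [coe_basisMonomials] at this

lemma monomial_eq' (m : Fin 3 →₀ ℕ) :
    (monomial m 1 : Sym k) = X 0 ^ m 0 * X 1 ^ m 1 * X 2 ^ m 2 := by
  rw [monomial_eq, C_1, one_mul, Finsupp.prod_fintype _ _ (by simp), Fin.prod_univ_three]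

lemma sym_theta0 (q : Sym k) : sym (theta0 q) = vS * sub (X 0) del 1 q := by
  have : sym ∘ₗ theta0 = LinearMap.mulLeft k vS ∘ₗ (sub (X 0) del (1 : Sym k)).toLinearMap := by
    refine (basisMonomials (Fin 3) k).ext fun m => ?_
    rw [coe_basisMonomials]
    change sym (theta0 (monomial m (1 : k))) = vS * sub (X 0) del 1 (monomial m (1 : k))
    rw [theta0_monomial, sym_gen_none, monomial_eq']
    simp [sub]
  exact LinearMap.congr_fun this q

lemma sym_theta1 (r : Sym k) : sym (theta1 r) = cc * (C (-2) * sub (X 0) del (X 2) r) := by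
  have : sym ∘ₗ theta1 = LinearMap.mulLeft k cc ∘ₗ LinearMap.mulLeft k (C (-2)) ∘ₗ
      (sub (X 0) del (X 2 : Sym k)).toLinearMap := by
    refine (basisMonomials (Fin 3) k).ext fun m => ?_
    rw [coe_basisMonomials]
    change sym (theta1 (monomial m (1 : k))) =
      cc * (C (-2) * sub (X 0) del (X 2) (monomial m (1 : k)))
    rw [theta1_monomial, sym_gen_some, monomial_eq']
    simp [sub]
  exact LinearMap.congr_fun this r

/-- The inverse of the symbol map. -/
noncomputable def symInv : CQ k →ₗ[k] U3 k :=
  theta0 ∘ₗ (sub (X 0) del (0 : Sym k)).toLinearMap ∘ₗ qC +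
    (-2⁻¹ : k) • (theta1 ∘ₗ (sub (X 0) del (X 2 : Sym k)).toLinearMap ∘ₗ rC)

lemma symInv_apply (b : CQ k) : symInv b = theta0 (sub (X 0) del 0 (qC b)) +
    (-2⁻¹ : k) • theta1 (sub (X 0) del (X 2) (rC b)) := rfl

lemma sym_symInv (b : CQ k) : sym (symInv b) = b := by
  rw [symInv_apply, map_add, map_smul, sym_theta0, sym_theta1, CQ_eq b]
  refine sym_ext fun x y d => ?_
  simp [ev_sub, ev_qC b x y d]
  ring

lemma symInv_sym (a : U3 k) : symInv ⟨sym a, sym_mem a⟩ = a := by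
  have h : genSpan k ≤ LinearMap.eqLocus (symInv ∘ₗ sym.codRestrict (CQ k) sym_mem)
      LinearMap.id := genSpan_le fun j l o => by
    rw [LinearMap.mem_eqLocus, LinearMap.comp_apply, LinearMap.id_apply, symInv_apply]
    cases o with
    | none =>
      obtain ⟨h1, h2⟩ := eq_qC_rC (b := sym.codRestrict (CQ k) sym_mem (gen j l none))
        (q := X 0 ^ j * del ^ l) (r := 0) (sym_ext fun x y d => by simp)
        (by simpa using sym_gen_none j l)
      have h3 : sub (X 0) del 0 (X 0 ^ j * del ^ l : Sym k) = monomial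
          (Finsupp.single 0 j + Finsupp.single 1 l) 1 := by
        rw [monomial_eq']
        simp [sub, del]
      rw [h1, h2, h3, theta0_monomial]
      simp
    | some i =>
      obtain ⟨h1, h2⟩ := eq_qC_rC (b := sym.codRestrict (CQ k) sym_mem (gen j l (some i)))
        (q := 0) (r := C (-2) * (X 0 ^ j * del ^ l * X 2 ^ i)) (by simp)
        (by simpa using sym_gen_some j l i)
      have h3 : sub (X 0) del (X 2) (C (-2) * (X 0 ^ j * del ^ l * X 2 ^ i) : Sym k) =
          (-2 : k) • monomial
          (Finsupp.single 0 j + Finsupp.single 1 l + Finsupp.single 2 i) 1 := by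
        rw [monomial_eq']
        refine sym_ext fun x y d => ?_
        simp [ev_sub]
      rw [h1, h2, h3, map_smul, theta1_monomial, smul_smul]
      simp
  exact h (mem_genSpan a)

/-- `U(3)` is the algebra of symbols `CQ`. -/
noncomputable def symEquiv : U3 k ≃ₗ[k] CQ k :=
  LinearEquiv.ofLinearMap (sym.codRestrict (CQ k) sym_mem) symInv
    (LinearMap.ext fun b => Subtype.ext (sym_symInv b)) (LinearMap.ext symInv_sym)

@[simp] lemma coe_symEquiv (a : U3 k) : (symEquiv a : Sym k) = sym a := rfl

end SymEquiv

/-! ### Polynomial families -/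

section Families

variable (k : Type*) [Field k]

/-- The polynomial functions of parameters `t 0, t 1, …`. There are infinitely many, so that new
parameters are always available. -/
noncomputable def PF : Subalgebra k ((ℕ → k) → k) :=
  (MvPolynomial.aeval (R := k) fun i (t : ℕ → k) => t i).range

variable (V : Type*) [AddCommGroup V] [Module k V]

/-- The polynomial families of vectors: the finite sums of polynomial functions times constant
vectors. -/
def Fam : Submodule k ((ℕ → k) → V) :=
  Submodule.span k {g | ∃ f ∈ PF k, ∃ v : V, g = fun t => f t • v}

variable {k V} {V' V'' : Type*} [AddCommGroup V'] [Module k V'] [AddCommGroup V''] [Module k V'']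

lemma smul_mem_fam {f : (ℕ → k) → k} (hf : f ∈ PF k) (v : V) : (fun t => f t • v) ∈ Fam k V :=
  Submodule.subset_span ⟨f, hf, v, rfl⟩

lemma const_mem_PF (c : k) : (fun _ => c) ∈ PF k := (PF k).algebraMap_mem c

lemma coord_mem_PF (i : ℕ) : (fun t => t i) ∈ PF k := ⟨MvPolynomial.X i, by simp⟩

lemma const_mem_fam (v : V) : (fun _ => v) ∈ Fam k V := by
  have := smul_mem_fam (const_mem_PF (1 : k)) v
  simpa using this

lemma fam_le {P : Submodule k ((ℕ → k) → V)}
    (h : ∀ f ∈ PF k, ∀ v : V, (fun t => f t • v) ∈ P) : Fam k V ≤ P :=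
  Submodule.span_le.2 (by rintro _ ⟨f, hf, v, rfl⟩; exact h f hf v)

/-- A linear map with polynomial dependence on parameters preserves polynomial families. -/
lemma fam_linear (L : (ℕ → k) → V →ₗ[k] V') (hL : ∀ v, (fun t => L t v) ∈ Fam k V')
    {a : (ℕ → k) → V} (ha : a ∈ Fam k V) : (fun t => L t (a t)) ∈ Fam k V' := by
  have hmul : ∀ f ∈ PF k, Fam k V' ≤ (Fam k V').comap
      (LinearMap.pi fun t => f t • LinearMap.proj t) := fun f hf =>
    fam_le fun g hg v => by
      have : (fun t => f t • g t • v) = fun t => (f * g) t • v := by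
        funext t; rw [smul_smul]; rfl
      change (fun t => f t • g t • v) ∈ Fam k V'
      rw [this]
      exact smul_mem_fam ((PF k).mul_mem hf hg) v
  have : Fam k V ≤ (Fam k V').comap (LinearMap.pi fun t => L t ∘ₗ LinearMap.proj t) :=
    fam_le fun f hf v => by
      have h := hmul f hf (hL v)
      rw [Submodule.mem_comap] at h ⊢
      convert h using 1
      funext t
      simp
  exact this ha

lemma fam_map (f : V →ₗ[k] V') {a : (ℕ → k) → V} (ha : a ∈ Fam k V) :
    (fun t => f (a t)) ∈ Fam k V' :=
  fam_linear (fun _ => f) (fun v => const_mem_fam (f v)) ha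

lemma fam_bilinear (L : (ℕ → k) → V →ₗ[k] V' →ₗ[k] V'')
    (hL : ∀ v v', (fun t => L t v v') ∈ Fam k V'') {a : (ℕ → k) → V} {b : (ℕ → k) → V'}
    (ha : a ∈ Fam k V) (hb : b ∈ Fam k V') : (fun t => L t (a t) (b t)) ∈ Fam k V'' :=
  fam_linear (fun t => (L t).flip (b t)) (fun v => fam_linear (fun t => L t v) (hL v) hb) ha

/-- A polynomial family of scalars is a polynomial function. -/
lemma fam_self : Fam k k ≤ (PF k).toSubmodule :=
  fam_le fun f hf v => by
    have := (PF k).mul_mem hf (const_mem_PF v)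
    exact this

lemma mem_fam_self {f : (ℕ → k) → k} (hf : f ∈ PF k) : f ∈ Fam k k := by
  simpa using smul_mem_fam hf (1 : k)

/-- Finite sums with polynomial coefficients. -/
lemma sum_mem_fam {ι : Type*} (s : Finset ι) (f : ι → (ℕ → k) → k) (hf : ∀ i, f i ∈ PF k)
    (v : ι → V) : (fun t => ∑ i ∈ s, f i t • v i) ∈ Fam k V := by
  have : (fun t => ∑ i ∈ s, f i t • v i) = ∑ i ∈ s, fun t => f i t • v i := by
    funext t; simp
  rw [this]
  exact sum_mem fun i _ => smul_mem_fam (hf i) _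

lemma ev_mem_PF {f g h : (ℕ → k) → k} (hf : f ∈ PF k) (hg : g ∈ PF k) (hh : h ∈ PF k)
    (p : Sym k) : (fun t => ev (f t) (g t) (h t) p) ∈ PF k := by
  induction p using MvPolynomial.induction_on with
  | C c => simpa using const_mem_PF c
  | add p q hp hq =>
    simp only [map_add]
    exact (PF k).add_mem hp hq
  | mul_X p i hp =>
    simp only [map_mul]
    refine (PF k).mul_mem hp ?_
    fin_cases i
    · simpa using hf
    · simpa using hg
    · simpa using hh

end Families

/-! ### Modules of symbols and cochains on words -/

section Words

variable {k : Type*} [Field k]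

/-- A space of symbols stable under `∂` and under the left action of `CQ`. -/
class IsMod (N : Submodule k (Sym k)) : Prop where
  del_mem : ∀ a ∈ N, del * a ∈ N
  lam_mem : ∀ (l : k), ∀ a ∈ CQ k, ∀ b ∈ N, lam l a b ∈ N

/-- The defining equation for a product is only obtained after multiplication by `x + λ`; where
this factor vanishes, both sides vanish. -/
instance : IsMod (CQ k) where
  del_mem a ha x y := by
    simp only [map_mul, ev_del]
    linear_combination (x - y) * ha x y
  lam_mem l a ha b hb x y := by
    simp only [ev_lam]
    by_cases h : x + l = 0
    · have h1 := ha x (x + l)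
      have h2 := hb (x + l) y
      rw [h, zero_mul] at h1 h2
      rw [h]
      linear_combination ev x 0 0 a * h2 + ev 0 y 1 b * h1
    · refine mul_left_cancel₀ h ?_
      linear_combination ev (x + l) y 0 b * y * ha x (x + l) + x * ev x (x + l) 1 a * hb (x + l) y

/-- A vector together with a value of the variable `λ` that belongs to it. -/
abbrev Pt (N : Submodule k (Sym k)) := N × k

variable (N : Submodule k (Sym k)) [IsMod N]

/-- The operator `∂` on a module of symbols. -/
noncomputable def dN : N →ₗ[k] N :=
  (LinearMap.mulLeft k del).restrict fun a ha => IsMod.del_mem a ha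

@[simp] lemma coe_dN (a : N) : ((dN N a : N) : Sym k) = del * (a : Sym k) := rfl

/-- The action `a_λ` on a module of symbols. -/
noncomputable def actN (l : k) : CQ k →ₗ[k] N →ₗ[k] N :=
  LinearMap.mk₂ k (fun a b => ⟨lam l a b, IsMod.lam_mem l a a.2 b b.2⟩)
    (fun a b c => Subtype.ext (by simp)) (fun c a b => Subtype.ext (by simp))
    (fun a b c => Subtype.ext (by simp)) (fun c a b => Subtype.ext (by simp))

@[simp] lemma coe_actN (l : k) (a : CQ k) (b : N) : (actN N l a b : Sym k) = lam l a b := rfl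

variable {N}

/-- The product of a point of `CQ` and a point of `N`: the action, with the variables added. -/
noncomputable def sm (s : Pt (CQ k)) (y : Pt N) : Pt N := (actN N s.2 s.1 y.1, s.2 + y.2)

@[simp] lemma sm_snd (s : Pt (CQ k)) (y : Pt N) : (sm s y).2 = s.2 + y.2 := rfl
@[simp] lemma coe_sm_fst (s : Pt (CQ k)) (y : Pt N) :
    ((sm s y).1 : Sym k) = lam s.2 (s.1 : Sym k) (y.1 : Sym k) := rfl

variable (N) in
/-- Functions on words of points of `CQ` followed by a point of `N`. All lengths are allowed, so
that the differential has no index; a cochain of degree `n` is supported on words of length `n`. -/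
abbrev Wd := List (Pt (CQ k)) → Pt N → k

/-- The function obtained by multiplying the first entry of the word by `s`. -/
noncomputable def hd (s : Pt (CQ k)) (φ : Wd N) : Wd N
  | [], y => φ [] (sm s y)
  | s' :: l, y => φ (sm s s' :: l) y

/-- The alternating sum over the products of adjacent entries, by recursion on the word: the product
of the first two entries, minus the sum for the rest of the word. -/
noncomputable def Eaux : List (Pt (CQ k)) → Wd N → Pt N → k
  | [], _, _ => 0
  | s :: l, φ, y => hd s φ l y - Eaux l (fun l' => φ (s :: l')) y

lemma hd_add (s : Pt (CQ k)) (φ ψ : Wd N) : hd s (φ + ψ) = hd s φ + hd s ψ := by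
  funext l y; cases l <;> rfl

lemma hd_smul (s : Pt (CQ k)) (c : k) (φ : Wd N) : hd s (c • φ) = c • hd s φ := by
  funext l y; cases l <;> rfl

variable (N) in
/-- The alternating sum over the products of adjacent entries, as a linear map. -/
noncomputable def E : Wd N →ₗ[k] Wd N where
  toFun φ l y := Eaux l φ y
  map_add' φ ψ := by
    funext l y
    induction l generalizing φ ψ with
    | nil => simp [Eaux]
    | cons s l ih =>
      have := ih (fun l' => φ (s :: l')) (fun l' => ψ (s :: l'))
      simp only [Eaux, hd_add] at this ⊢
      rw [show (fun l' => (φ + ψ) (s :: l')) =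
        (fun l' => φ (s :: l')) + fun l' => ψ (s :: l') from rfl, this]
      simp only [Pi.add_apply, Eaux]
      ring
  map_smul' c φ := by
    funext l y
    induction l generalizing φ with
    | nil => simp [Eaux]
    | cons s l ih =>
      have := ih (fun l' => φ (s :: l'))
      simp only [Eaux, hd_smul] at this ⊢
      rw [show (fun l' => (c • φ) (s :: l')) = c • fun l' => φ (s :: l') from rfl, this]
      simp only [Pi.smul_apply, RingHom.id_apply, smul_sub, Eaux]

@[simp] lemma E_nil (φ : Wd N) (y : Pt N) : E N φ [] y = 0 := rfl

lemma E_cons (φ : Wd N) (s : Pt (CQ k)) (l : List (Pt (CQ k))) (y : Pt N) :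
    E N φ (s :: l) y = hd s φ l y - E N (fun l' => φ (s :: l')) l y := rfl

/-- The sum of all variables. -/
def deg (l : List (Pt (CQ k))) (y : Pt N) : k := (l.map Prod.snd).sum + y.2

@[simp] lemma deg_nil (y : Pt N) : deg [] y = y.2 := by simp [deg]
@[simp] lemma deg_cons (s : Pt (CQ k)) (l : List (Pt (CQ k))) (y : Pt N) :
    deg (s :: l) y = s.2 + deg l y := by simp [deg, add_assoc]

/-- The factor by which a point acts on the value of a cochain whose variables have the sum `m`: the
symbol at `Δ = 0` between the points `-(λ + m)` and `-m` of `M_(0,0)`. -/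
noncomputable def wt (s : Pt (CQ k)) (m : k) : k := ev (-(s.2 + m)) (-m) 0 (s.1 : Sym k)

lemma wt_sm (s s' : Pt (CQ k)) (m : k) : wt (sm s s') m = wt s (s'.2 + m) * wt s' m := by
  simp only [wt, coe_sm_fst, sm_snd, ev_lam]
  rw [show -(s.2 + s'.2 + m) + s.2 = -(s'.2 + m) by ring, add_assoc]

variable (N) in
/-- The first term of the differential: the first entry acts on the value at the rest of the
word. -/
noncomputable def W : Wd N →ₗ[k] Wd N where
  toFun φ
    | [], _ => 0
    | s :: l, y => wt s (deg l y) * φ l y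
  map_add' φ ψ := by
    funext l y
    cases l with
    | nil => simp
    | cons s l => exact mul_add _ _ _
  map_smul' c φ := by
    funext l y
    cases l with
    | nil => simp
    | cons s l => exact mul_left_comm _ _ _

@[simp] lemma W_nil (φ : Wd N) (y : Pt N) : W N φ [] y = 0 := rfl

lemma W_cons (φ : Wd N) (s : Pt (CQ k)) (l : List (Pt (CQ k))) (y : Pt N) :
    W N φ (s :: l) y = wt s (deg l y) * φ l y := rfl

variable (N) in
/-- The differential. -/
noncomputable def dW : Wd N →ₗ[k] Wd N := W N - E N

lemma dW_apply (φ : Wd N) (l : List (Pt (CQ k))) (y : Pt N) :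
    dW N φ l y = W N φ l y - E N φ l y := rfl

section

variable [CharZero k]

lemma sm_assoc (s s' : Pt (CQ k)) (y : Pt N) : sm (sm s s') y = sm s (sm s' y) := by
  refine Prod.ext (Subtype.ext (sym_ext fun x z d => ?_)) (by simp [add_assoc])
  simp [add_assoc, mul_assoc]

lemma hd_hd (s s' : Pt (CQ k)) (φ : Wd N) : hd s' (hd s φ) = hd (sm s s') φ := by
  funext l y
  cases l with
  | nil => simp [hd, sm_assoc]
  | cons s'' l => simp [hd, sm_assoc]

/-- Multiplication of the first entry commutes with `E`, by associativity. -/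
lemma hd_E (s : Pt (CQ k)) (φ : Wd N) : hd s (E N φ) = E N (hd s φ) := by
  funext l y
  cases l with
  | nil => rfl
  | cons s' l =>
    change E N φ (sm s s' :: l) y = _
    rw [E_cons, E_cons, hd_hd]
    rfl

lemma E_E (φ : Wd N) : E N (E N φ) = 0 := by
  funext l y
  induction l generalizing φ with
  | nil => rfl
  | cons s l ih =>
    have h : (fun l' => E N φ (s :: l')) = hd s φ - E N (fun l' => φ (s :: l')) := rfl
    have h2 := ih (fun l' => φ (s :: l'))
    rw [E_cons, h, map_sub, hd_E, Pi.sub_apply, Pi.sub_apply, h2]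
    simp

/-- Products of adjacent entries preserve the sum of the variables. -/
lemma E_deg_mul (f : k → k) (φ : Wd N) (l : List (Pt (CQ k))) (y : Pt N) :
    E N (fun l y => f (deg l y) * φ l y) l y = f (deg l y) * E N φ l y := by
  induction l generalizing φ f with
  | nil => simp
  | cons s l ih =>
    have h := ih (fun z => f (s.2 + z)) (fun l' => φ (s :: l'))
    rw [E_cons, E_cons, mul_sub]
    simp only [deg_cons]
    rw [h]
    congr 1
    cases l <;> simp [hd, add_assoc]

lemma dW_dW (φ : Wd N) : dW N (dW N φ) = 0 := by
  have h : W N (W N φ) = W N (E N φ) + E N (W N φ) := by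
    funext l y
    cases l with
    | nil => simp
    | cons s l =>
      have h1 : (fun l' => W N φ (s :: l')) = fun l y => wt s (deg l y) * φ l y := rfl
      rw [Pi.add_apply, Pi.add_apply, E_cons, h1, E_deg_mul, W_cons, W_cons, add_sub_cancel]
      cases l with
      | nil => simp [hd]
      | cons s' l => simp [hd, W_cons, wt_sm, mul_assoc]
  rw [dW, LinearMap.sub_apply, LinearMap.sub_apply, map_sub, map_sub, E_E, h]
  abel

end

/-! ### Cochains -/

/-- Antilinear functions: linear functions `f` with `f (∂ a) = - m f(a)`. -/
structure IsLin (N : Submodule k (Sym k)) [IsMod N] (m : k) (f : N → k) : Prop where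
  add : ∀ a b, f (a + b) = f a + f b
  smul : ∀ (c : k) a, f (c • a) = c * f a
  del : ∀ a, f (dN N a) = -m * f a

lemma IsLin.sub {m : k} {f g : N → k} (hf : IsLin N m f) (hg : IsLin N m g) :
    IsLin N m (fun a => f a - g a) where
  add a b := by rw [hf.add, hg.add]; ring
  smul c a := by rw [hf.smul, hg.smul]; ring
  del a := by rw [hf.del, hg.del]; ring

lemma IsLin.const_mul {m : k} {f : N → k} (hf : IsLin N m f) (c : k) :
    IsLin N m (fun a => c * f a) where
  add a b := by rw [hf.add]; ring
  smul c a := by rw [hf.smul]; ring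
  del a := by rw [hf.del]; ring

lemma IsLin.add' {m : k} {f g : N → k} (hf : IsLin N m f) (hg : IsLin N m g) :
    IsLin N m (fun a => f a + g a) where
  add a b := by rw [hf.add, hg.add]; ring
  smul c a := by rw [hf.smul, hg.smul]; ring
  del a := by rw [hf.del, hg.del]; ring

lemma isLin_zero (m : k) : IsLin N m (fun _ => 0) where
  add a b := by simp
  smul c a := by simp
  del a := by simp

lemma IsLin.mul_const {m : k} {f : N → k} (hf : IsLin N m f) (c : k) :
    IsLin N m (fun a => f a * c) := by
  simpa only [mul_comm] using hf.const_mul c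

lemma IsLin.comp {N' : Submodule k (Sym k)} [IsMod N'] {m : k} {f : N → k} (hf : IsLin N m f)
    (g : N' →ₗ[k] N) (hg : ∀ a, g (dN N' a) = dN N (g a)) : IsLin N' m (fun a => f (g a)) where
  add a b := by rw [map_add, hf.add]
  smul c a := by rw [map_smul, hf.smul]
  del a := by rw [hg, hf.del]

section

variable [CharZero k]

lemma actN_del_left (l : k) (a : CQ k) (b : N) :
    actN N l (dN (CQ k) a) b = (-l) • actN N l a b := by
  refine Subtype.ext (sym_ext fun x y d => ?_)
  simp
  ring

lemma actN_del_right (l : k) (a : CQ k) (b : N) :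
    actN N l a (dN N b) = dN N (actN N l a b) + l • actN N l a b := by
  refine Subtype.ext (sym_ext fun x y d => ?_)
  simp
  ring

/-- `f(a_λ b)` is antilinear in `a`. -/
lemma IsLin.act_left {l m : k} {f : N → k} (hf : IsLin N (l + m) f) (b : N) :
    IsLin (CQ k) l (fun a => f (actN N l a b)) where
  add a b := by rw [map_add, LinearMap.add_apply, hf.add]
  smul c a := by rw [map_smul, LinearMap.smul_apply, hf.smul]
  del a := by rw [actN_del_left, hf.smul]

/-- `f(a_λ b)` is antilinear in `b`. -/
lemma IsLin.act_right {l m : k} {f : N → k} (hf : IsLin N (l + m) f) (a : CQ k) :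
    IsLin N m (fun b => f (actN N l a b)) where
  add a b := by rw [map_add, hf.add]
  smul c a := by rw [map_smul, hf.smul]
  del b := by rw [actN_del_right, hf.add, hf.del, hf.smul]; ring

end

lemma isLin_wt (l m : k) : IsLin (CQ k) l (fun a => wt (a, l) m) where
  add a b := by simp [wt]
  smul c a := by simp [wt]
  del a := by simp [wt]

/-- Antilinearity in all entries. -/
structure IsMulti (φ : Wd N) : Prop where
  slot : ∀ (l₁ l₂ : List (Pt (CQ k))) (l : k) (y : Pt N),
    IsLin (CQ k) l fun a => φ (l₁ ++ (a, l) :: l₂) y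
  last : ∀ (l : List (Pt (CQ k))) (m : k), IsLin N m fun b => φ l (b, m)

lemma IsMulti.cons {φ : Wd N} (h : IsMulti φ) (s : Pt (CQ k)) : IsMulti fun l => φ (s :: l) where
  slot l₁ l₂ l y := h.slot (s :: l₁) l₂ l y
  last l m := h.last (s :: l) m

section

variable [CharZero k]

lemma IsMulti.hd {φ : Wd N} (h : IsMulti φ) (s : Pt (CQ k)) : IsMulti (hd s φ) where
  slot l₁ l₂ l y := by
    cases l₁ with
    | nil => exact (h.slot [] l₂ (s.2 + l) y).act_right s.1
    | cons s' l₁ => exact h.slot (sm s s' :: l₁) l₂ l y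
  last l m := by
    cases l with
    | nil => exact (h.last [] (s.2 + m)).act_right s.1
    | cons s' l => exact h.last (sm s s' :: l) m

lemma IsMulti.hd_left {φ : Wd N} (h : IsMulti φ) (l : k) (l₂ : List (Pt (CQ k))) (y : Pt N) :
    IsLin (CQ k) l fun a => VirHoch.hd (a, l) φ l₂ y := by
  cases l₂ with
  | nil => exact (h.last [] (l + y.2)).act_left y.1
  | cons s' l₂ => exact (h.slot [] l₂ (l + s'.2) y).act_left s'.1

omit [CharZero k] in
lemma isLin_E {N' : Submodule k (Sym k)} [IsMod N'] {m : k} {G : N' → Wd N}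
    (hG : ∀ l y, IsLin N' m fun a => G a l y) (l : List (Pt (CQ k))) (y : Pt N) :
    IsLin N' m fun a => E N (G a) l y where
  add a b := by
    rw [show G (a + b) = G a + G b from funext₂ fun l y => (hG l y).add a b, map_add]; rfl
  smul c a := by
    rw [show G (c • a) = c • G a from funext₂ fun l y => (hG l y).smul c a, map_smul]; rfl
  del a := by
    rw [show G (dN N' a) = (-m) • G a from funext₂ fun l y => (hG l y).del a, map_smul]; rfl

lemma IsMulti.E {φ : Wd N} (h : IsMulti φ) : IsMulti (E N φ) where
  slot l₁ l₂ l y := by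
    induction l₁ generalizing φ with
    | nil => exact (h.hd_left l l₂ y).sub (isLin_E (fun l' y => h.slot [] l' l y) l₂ y)
    | cons s l₁ ih => exact ((h.hd s).slot l₁ l₂ l y).sub (ih (h.cons s))
  last l m := by
    induction l generalizing φ with
    | nil => exact isLin_zero m
    | cons s l ih => exact ((h.hd s).last l m).sub (ih (h.cons s))

omit [CharZero k] in
lemma IsMulti.W {φ : Wd N} (h : IsMulti φ) : IsMulti (W N φ) where
  slot l₁ l₂ l y := by
    cases l₁ with
    | nil => exact (isLin_wt l (deg l₂ y)).mul_const _
    | cons s l₁ =>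
      have : ∀ a : CQ k, deg (l₁ ++ (a, l) :: l₂) y = deg (l₁ ++ (0, l) :: l₂) y :=
        fun a => by simp [deg]
      simp only [List.cons_append, W_cons, this]
      exact (h.slot l₁ l₂ l y).const_mul _
  last l m := by
    cases l with
    | nil => exact isLin_zero m
    | cons s l => exact (h.last l m).const_mul (wt s (deg l ((0 : N), m)))

end

/-! #### Polynomial dependence on the variables -/

/-- Polynomial families of points. -/
def FamPt (N : Submodule k (Sym k)) (y : (ℕ → k) → Pt N) : Prop :=
  (fun t => (y t).1) ∈ Fam k N ∧ (fun t => (y t).2) ∈ PF k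

section

variable [CharZero k]

/-- If all `a_λ b` lie in a subspace then so do the coefficients of `a_λ b`. -/
lemma lam_mem_fam_sub {l : (ℕ → k) → k} (hl : l ∈ PF k) (a b : Sym k) (V : Submodule k (Sym k))
    (h : ∀ l, lam l a b ∈ V) : (fun t => (⟨lam (l t) a b, h _⟩ : V)) ∈ Fam k V := by
  have h1 : ∀ i, (fL a * fR b).coeff i ∈ V := by
    intro i
    by_contra hi
    obtain ⟨f, hf, hV⟩ := Submodule.exists_le_ker_of_notMem hi
    exact hf (coeff_functional f (fun l => hV (h l)) i)
  have h2 : (fun t => (⟨lam (l t) a b, h _⟩ : V)) = fun t =>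
      ∑ i ∈ range ((fL a * fR b).natDegree + 1),
        l t ^ i • (⟨(fL a * fR b).coeff i, h1 i⟩ : V) := by
    funext t
    refine Subtype.ext ?_
    simp [lam_eq_sum]
  rw [h2]
  exact sum_mem_fam _ (fun i t => l t ^ i) (fun i => (PF k).pow_mem hl i) _

lemma FamPt.sm {s : (ℕ → k) → Pt (CQ k)} {y : (ℕ → k) → Pt N} (hs : FamPt (CQ k) s)
    (hy : FamPt N y) : FamPt N fun t => sm (s t) (y t) :=
  ⟨fam_bilinear (fun t => actN N (s t).2) (fun a b => lam_mem_fam_sub hs.2 a b N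
    fun l => IsMod.lam_mem l a a.2 b b.2) hs.1 hy.1, (PF k).add_mem hs.2 hy.2⟩

end

lemma wt_mem_PF {s : (ℕ → k) → Pt (CQ k)} {m : (ℕ → k) → k} (hs : FamPt (CQ k) s)
    (hm : m ∈ PF k) : (fun t => wt (s t) (m t)) ∈ PF k := by
  refine fam_self (fam_linear (fun t => (ev (-((s t).2 + m t)) (-m t) 0).toLinearMap ∘ₗ
    (CQ k).subtype) (fun a => mem_fam_self ?_) hs.1)
  exact ev_mem_PF ((PF k).neg_mem ((PF k).add_mem hs.2 hm)) ((PF k).neg_mem hm)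
    (const_mem_PF 0) _

/-- Families of functions on words with polynomial values on polynomial families. -/
def IsPoly (Φ : (ℕ → k) → Wd N) : Prop :=
  ∀ (l : List ((ℕ → k) → Pt (CQ k))) (y : (ℕ → k) → Pt N), (∀ s ∈ l, FamPt (CQ k) s) →
    FamPt N y → (fun t => Φ t (l.map (· t)) (y t)) ∈ PF k

lemma IsPoly.cons {Φ : (ℕ → k) → Wd N} (h : IsPoly Φ) {s : (ℕ → k) → Pt (CQ k)}
    (hs : FamPt (CQ k) s) : IsPoly fun t l => Φ t (s t :: l) :=
  fun l y hl hy => h (s :: l) y (by simpa using ⟨hs, hl⟩) hy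

lemma deg_mem_PF {l : List ((ℕ → k) → Pt (CQ k))} {y : (ℕ → k) → Pt N}
    (hl : ∀ s ∈ l, FamPt (CQ k) s) (hy : FamPt N y) :
    (fun t => deg (l.map (· t)) (y t)) ∈ PF k := by
  induction l with
  | nil => simpa using hy.2
  | cons s l ih =>
    simp only [List.map_cons, deg_cons]
    exact (PF k).add_mem (hl s (by simp)).2 (ih fun s' hs' => hl s' (by simp [hs']))

lemma IsPoly.W {Φ : (ℕ → k) → Wd N} (h : IsPoly Φ) : IsPoly fun t => W N (Φ t) := by
  intro l y hl hy
  cases l with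
  | nil => exact const_mem_PF 0
  | cons s l =>
    have hl' : ∀ s ∈ l, FamPt (CQ k) s := fun s' hs' => hl s' (by simp [hs'])
    exact (PF k).mul_mem (wt_mem_PF (hl s (by simp)) (deg_mem_PF hl' hy)) (h l y hl' hy)

section

variable [CharZero k]

lemma IsPoly.hd {Φ : (ℕ → k) → Wd N} (h : IsPoly Φ) {s : (ℕ → k) → Pt (CQ k)}
    (hs : FamPt (CQ k) s) : IsPoly fun t => hd (s t) (Φ t) := by
  intro l y hl hy
  cases l with
  | nil => exact h [] _ hl (hs.sm hy)
  | cons s' l => exact h ((fun t => sm (s t) (s' t)) :: l) y (by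
      rintro s'' hs''
      rcases List.mem_cons.1 hs'' with rfl | hs''
      · exact hs.sm (hl s' (by simp))
      · exact hl s'' (by simp [hs''])) hy

lemma IsPoly.E {Φ : (ℕ → k) → Wd N} (h : IsPoly Φ) : IsPoly fun t => E N (Φ t) := by
  intro l y hl hy
  induction l generalizing Φ with
  | nil => exact const_mem_PF 0
  | cons s l ih =>
    have hl' : ∀ s ∈ l, FamPt (CQ k) s := fun s' hs' => hl s' (by simp [hs'])
    exact (PF k).sub_mem (h.hd (hl s (by simp)) l y hl' hy) (ih (h.cons (hl s (by simp))) hl')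

end

variable (N) in
/-- The cochains of degree `n`: functions on words of length `n` followed by a point of `N`
that are antilinear in all entries and polynomial in the variables. -/
def R (n : ℕ) : Submodule k (Wd N) where
  carrier := {φ | (∀ l y, l.length ≠ n → φ l y = 0) ∧ IsMulti φ ∧ IsPoly fun _ => φ}
  add_mem' {φ ψ} h h' := ⟨fun l y hl => by simp [h.1 l y hl, h'.1 l y hl],
    ⟨fun l₁ l₂ l y => (h.2.1.slot l₁ l₂ l y).add' (h'.2.1.slot l₁ l₂ l y),
      fun l m => (h.2.1.last l m).add' (h'.2.1.last l m)⟩,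
    fun l y hl hy => (PF k).add_mem (h.2.2 l y hl hy) (h'.2.2 l y hl hy)⟩
  zero_mem' := ⟨fun l y hl => rfl, ⟨fun l₁ l₂ l y => isLin_zero l, fun l m => isLin_zero m⟩,
    fun l y hl hy => const_mem_PF 0⟩
  smul_mem' c φ h := ⟨fun l y hl => by simp [h.1 l y hl],
    ⟨fun l₁ l₂ l y => (h.2.1.slot l₁ l₂ l y).const_mul c,
      fun l m => (h.2.1.last l m).const_mul c⟩,
    fun l y hl hy => (PF k).mul_mem (const_mem_PF c) (h.2.2 l y hl hy)⟩

/-- The map `E` raises the degree by one. -/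
lemma E_supp {n : ℕ} {φ : Wd N} (h : ∀ l y, l.length ≠ n → φ l y = 0)
    (l : List (Pt (CQ k))) (y : Pt N) (hl : l.length ≠ n + 1) : E N φ l y = 0 := by
  induction l generalizing φ n with
  | nil => rfl
  | cons s l ih =>
    have h0 : l.length ≠ n := by simpa using hl
    have h1 : hd s φ l y = 0 := by
      cases l with
      | nil => exact h _ _ h0
      | cons s' l => exact h _ _ (by simpa using h0)
    rw [E_cons, h1, zero_sub, neg_eq_zero]
    cases n with
    | zero =>
      have : (fun l' => φ (s :: l')) = 0 := funext₂ fun l' y => h _ _ (by simp)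
      rw [this, map_zero]; rfl
    | succ n => exact ih (fun l y hl => h _ _ (by simpa using hl)) h0

variable [CharZero k]

lemma dW_mem {n : ℕ} {φ : Wd N} (h : φ ∈ R N n) : dW N φ ∈ R N (n + 1) := by
  refine ⟨fun l y hl => ?_, ⟨fun l₁ l₂ l y => ?_, fun l m => ?_⟩, fun l y hl hy => ?_⟩
  · rw [dW_apply, E_supp h.1 l y hl, sub_zero]
    cases l with
    | nil => rfl
    | cons s l => rw [W_cons, h.1 l y (by simpa using hl), mul_zero]
  · exact (h.2.1.W.slot l₁ l₂ l y).sub (h.2.1.E.slot l₁ l₂ l y)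
  · exact (h.2.1.W.last l m).sub (h.2.1.E.last l m)
  · exact (PF k).sub_mem (h.2.2.W l y hl hy) (h.2.2.E l y hl hy)

end Words

/-! ### Operations on cochains -/

section Operations

open MvPolynomial

variable {k : Type*} [Field k] [CharZero k]
variable {N N' : Submodule k (Sym k)} [IsMod N] [IsMod N']

/-- The space `N` contains the quotients of its elements by the polynomials `∂ + m`. -/
class IsSat (N : Submodule k (Sym k)) : Prop where
  sat : ∀ (m : k) (q : Sym k), (del + C m) * q ∈ N → q ∈ N

lemma del_add_ne_zero (m : k) : (del + C m : Sym k) ≠ 0 := by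
  intro h
  have := congrArg (ev (1 - m) 0 0) h
  simp at this

lemma del_add_dvd {m : k} {p : Sym k} (h : ∀ x d, ev x (x + m) d p = 0) : del + C m ∣ p := by
  have h1 : del + C m ∣ p - sub (X 0) (X 0 + C m) (X 2) p :=
    dvd_sub_sub _ _ _ _ (by simp) ⟨-1, by rw [del]; ring⟩ (by simp) p
  rwa [show sub (X 0) (X 0 + C m) (X 2) p = 0 from sym_ext fun x y d => by simp [ev_sub, h],
    sub_zero] at h1

/-- An antilinear function depends only on the values on the line `y = x + m`. -/
lemma IsLin.congr [IsSat N] {m : k} {f : N → k} (hf : IsLin N m f) {p p' : N}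
    (h : ∀ x d, ev x (x + m) d (p : Sym k) = ev x (x + m) d (p' : Sym k)) : f p = f p' := by
  obtain ⟨q, hq⟩ := del_add_dvd (m := m) (p := (p : Sym k) - p') fun x d => by
    rw [map_sub, h, sub_self]
  have hqN : q ∈ N := IsSat.sat m q (by rw [← hq]; exact N.sub_mem p.2 p'.2)
  have h1 : p = p' + (dN N ⟨q, hqN⟩ + m • (⟨q, hqN⟩ : N)) := Subtype.ext <| by
    rw [Submodule.coe_add, Submodule.coe_add, coe_dN, Submodule.coe_smul, smul_eq_C_mul]
    linear_combination hq
  rw [h1, hf.add, hf.add, hf.del, hf.smul]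
  ring

/-- The pullback along a map of the last entry. -/
noncomputable def pb (f : N →ₗ[k] N') : Wd N' →ₗ[k] Wd N where
  toFun φ l y := φ l (f y.1, y.2)
  map_add' _ _ := rfl
  map_smul' _ _ := rfl

@[simp] lemma pb_apply (f : N →ₗ[k] N') (φ : Wd N') (l : List (Pt (CQ k))) (y : Pt N) :
    pb f φ l y = φ l (f y.1, y.2) := rfl

lemma pb_mem {f : N →ₗ[k] N'} (hf : ∀ a, f (dN N a) = dN N' (f a)) {n : ℕ} {φ : Wd N'}
    (h : φ ∈ R N' n) : pb f φ ∈ R N n :=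
  ⟨fun l _ hl => h.1 l _ hl, ⟨fun l₁ l₂ l _ => h.2.1.slot l₁ l₂ l _,
    fun l m => (h.2.1.last l m).comp f hf⟩,
    fun l y hl hy => h.2.2 l (fun t => (f (y t).1, (y t).2)) hl ⟨fam_map f hy.1, hy.2⟩⟩

lemma pb_dW {f : N →ₗ[k] N'} (hf : ∀ l a b, f (actN N l a b) = actN N' l a (f b)) (φ : Wd N') :
    pb f (dW N' φ) = dW N (pb f φ) := by
  have hE : ∀ (φ : Wd N') l y, E N' φ l (f y.1, y.2) = E N (pb f φ) l y := by
    intro φ l y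
    induction l generalizing φ with
    | nil => rfl
    | cons s l ih =>
      rw [E_cons, E_cons, ih]
      congr 1
      cases l with
      | nil => simp [hd, sm, hf]
      | cons s' l => rfl
  funext l y
  rw [pb_apply, dW_apply, dW_apply, hE]
  congr 1
  cases l <;> rfl

/-- The function of a shorter word obtained by moving the last entry through `g` into the word
and appending the fixed entry `y₀`. -/
noncomputable def ap (g : Pt N → Pt (CQ k)) (y₀ : Pt N') : Wd N' →ₗ[k] Wd N where
  toFun φ l y := φ (l ++ [g y]) y₀
  map_add' _ _ := rfl
  map_smul' _ _ := rfl

omit [CharZero k] [IsMod N] [IsMod N'] in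
@[simp] lemma ap_apply (g : Pt N → Pt (CQ k)) (y₀ : Pt N') (φ : Wd N') (l : List (Pt (CQ k)))
    (y : Pt N) : ap g y₀ φ l y = φ (l ++ [g y]) y₀ := rfl

lemma ap_mem {g : Pt N → Pt (CQ k)} {y₀ : Pt N'} {n : ℕ} {φ : Wd N'}
    (hg : ∀ (m : k) (f : k → CQ k → k), (∀ l, IsLin (CQ k) l (f l)) →
      IsLin N m fun b => f (g (b, m)).2 (g (b, m)).1)
    (hg' : ∀ y, FamPt N y → FamPt (CQ k) fun t => g (y t)) (h : φ ∈ R N' (n + 1)) :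
    ap g y₀ φ ∈ R N n := by
  refine ⟨fun l y hl => h.1 _ _ (by simpa using hl), ⟨fun l₁ l₂ l y => ?_, fun l m => ?_⟩,
    fun l y hl hy => ?_⟩
  · simpa using h.2.1.slot l₁ (l₂ ++ [g y]) l y₀
  · exact hg m (fun l' b => φ (l ++ [(b, l')]) y₀) fun l' => h.2.1.slot l [] l' y₀
  · have := h.2.2 (l ++ [fun t => g (y t)]) (fun _ => y₀) (by
      intro s hs
      rcases List.mem_append.1 hs with hs | hs
      · exact hl s hs
      · rw [List.mem_singleton.1 hs]
        exact hg' y hy) ⟨const_mem_fam _, const_mem_PF _⟩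
    simpa using this

/-- The map `ap` commutes with the differential up to the value at the product of `g y` with the
appended entry, and a term in degree zero. -/
lemma ap_dW {g : Pt N → Pt (CQ k)} {y₀ : Pt N'} (hg : ∀ s y, g (sm s y) = sm s (g y))
    (hdeg : ∀ y, (g y).2 + y₀.2 = y.2) (φ : Wd N') (l : List (Pt (CQ k))) (y : Pt N) :
    ap g y₀ (dW N' φ) l y = dW N (ap g y₀ φ) l y - (-1) ^ l.length * φ l (sm (g y) y₀) +
      if l = [] then wt (g y) y₀.2 * φ [] y₀ else 0 := by
  have hE : E N' φ (l ++ [g y]) y₀ =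
      E N (ap g y₀ φ) l y + (-1) ^ l.length * φ l (sm (g y) y₀) := by
    induction l generalizing φ with
    | nil => simp [E_cons, hd]
    | cons s l ih =>
      have h1 : hd s φ (l ++ [g y]) y₀ = hd s (ap g y₀ φ) l y := by
        cases l with
        | nil => simp [hd, hg]
        | cons s' l => rfl
      rw [List.cons_append, E_cons, E_cons, ih, h1, List.length_cons, pow_succ]
      have h2 : (ap g y₀ fun l' => φ (s :: l')) = fun l' => ap g y₀ φ (s :: l') := rfl
      rw [h2]
      ring
  rw [ap_apply, dW_apply, dW_apply, hE]
  cases l with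
  | nil =>
    rw [List.nil_append, W_cons, if_pos rfl]
    simp
    ring
  | cons s l =>
    have h1 : deg (l ++ [g y]) y₀ = deg l y := by
      simp [deg, ← hdeg y, add_assoc]
    rw [List.cons_append, W_cons, W_cons, if_neg (by simp), h1, ap_apply]
    ring

omit [CharZero k] in
variable (N) in
/-- The invariant functional `p ↦ p(-m, 0, 0)` in degree zero. -/
noncomputable def aug : Wd N
  | [], y => ev (-y.2) 0 0 (y.1 : Sym k)
  | _ :: _, _ => 0

lemma aug_mem : aug N ∈ R N 0 := by
  refine ⟨fun l y hl => ?_, ⟨fun l₁ l₂ l y => ?_, fun l m => ?_⟩, fun l y hl hy => ?_⟩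
  · cases l with
    | nil => simp at hl
    | cons s l => rfl
  · cases l₁ <;> exact isLin_zero l
  · cases l with
    | nil => exact ⟨fun a b => by simp [aug], fun c a => by simp [aug], fun a => by simp [aug]⟩
    | cons s l => exact isLin_zero m
  · cases l with
    | nil =>
      exact fam_self (fam_linear (fun t => (ev (-(y t).2) 0 0).toLinearMap ∘ₗ N.subtype)
        (fun a => mem_fam_self (ev_mem_PF ((PF k).neg_mem hy.2) (const_mem_PF 0)
          (const_mem_PF 0) _)) hy.1)
    | cons s l => exact const_mem_PF 0

lemma dW_aug : dW N (aug N) = 0 := by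
  funext l y
  cases l with
  | nil => simp [dW_apply]
  | cons s l =>
    have h : (fun l' => aug N (s :: l')) = 0 := rfl
    rw [dW_apply, W_cons, E_cons, h, map_zero]
    cases l with
    | nil => simp [hd, aug, wt]
    | cons s' l => simp [hd, aug]

/-- A cochain is a polynomial in the last variable. -/
lemma exists_poly {n : ℕ} {Φ : Wd N} (hΦ : Φ ∈ R N n) (l : List (Pt (CQ k))) (b : N) :
    ∃ p : Polynomial k, ∀ m, Φ l (b, m) = p.eval m := by
  obtain ⟨p, hp⟩ := hΦ.2.2 (l.map fun s _ => s) (fun t => (b, t 0)) (by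
    intro s hs
    obtain ⟨s', -, rfl⟩ := List.mem_map.1 hs
    exact ⟨const_mem_fam _, const_mem_PF _⟩) ⟨const_mem_fam _, coord_mem_PF 0⟩
  refine ⟨aeval (fun _ => Polynomial.X) p, fun m => ?_⟩
  have h3 := congrFun hp fun _ => m
  simp only [List.map_map] at h3
  have h4 : ((fun x : (ℕ → k) → Pt (CQ k) => x fun _ => m) ∘ fun s _ => s) = id := rfl
  rw [h4, List.map_id] at h3
  rw [← h3]
  have h5 : (Pi.evalAlgHom k (fun _ : ℕ → k => k) (fun _ => m)).comp
      (aeval (fun i (t : ℕ → k) => t i)) =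
      ((Polynomial.aeval m : Polynomial k →ₐ[k] k)).comp (aeval (fun _ => Polynomial.X)) := by
    refine MvPolynomial.algHom_ext fun i => ?_
    simp
  exact DFunLike.congr_fun h5 p

/-- A cochain is determined by its values off the zero of the last variable. -/
lemma eq_zero_of_mul_eq_zero {n : ℕ} {Φ : Wd N} (hΦ : Φ ∈ R N n)
    (h : ∀ l b m, m * Φ l (b, m) = 0) : Φ = 0 := by
  funext l y
  obtain ⟨p, hp⟩ := exists_poly hΦ l y.1
  have h1 : Polynomial.X * p = 0 := Polynomial.funext fun m => by simpa [hp] using h l y.1 m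
  rcases mul_eq_zero.1 h1 with h1 | h1
  · exact absurd h1 Polynomial.X_ne_zero
  · change Φ l (y.1, y.2) = 0
    rw [hp, h1, Polynomial.eval_zero]

/-- Division of a cochain that vanishes where the last variable vanishes. -/
lemma exists_div {n : ℕ} {Φ : Wd N} (hΦ : Φ ∈ R N n) (h0 : ∀ l b, Φ l (b, 0) = 0) :
    ∃ φ ∈ R N n, ∀ l b m, m * φ l (b, m) = Φ l (b, m) := by
  have h1 : ∀ l b, ∃ q : Polynomial k, ∀ m, m * q.eval m = Φ l (b, m) := by
    intro l b
    obtain ⟨P, h2⟩ := exists_poly hΦ l b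
    have h3 : Polynomial.X ∣ P := by
      rw [Polynomial.X_dvd_iff, Polynomial.coeff_zero_eq_eval_zero, ← h2, h0]
    obtain ⟨q, hq⟩ := h3
    refine ⟨q, fun m => ?_⟩
    rw [h2, hq]
    simp
  choose q hq using h1
  have huniq : ∀ p p' : Polynomial k, (∀ m, m * p.eval m = m * p'.eval m) → p = p' := by
    intro p p' h
    refine mul_left_cancel₀ Polynomial.X_ne_zero (Polynomial.funext fun m => ?_)
    simpa using h m
  -- The quotients are unique, so antilinearity may be checked after multiplication by `m`.
  refine ⟨fun l y => (q l y.1).eval y.2, ⟨fun l y hl => ?_, ⟨fun l₁ l₂ l y => ?_, fun l m => ?_⟩,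
    fun l y hl hy => ?_⟩, fun l b m => hq l b m⟩
  · have : q l y.1 = 0 := huniq _ _ fun m => by rw [hq, hΦ.1 l _ hl]; simp
    change (q l y.1).eval y.2 = 0
    rw [this, Polynomial.eval_zero]
  · refine ⟨fun a b => ?_, fun c a => ?_, fun a => ?_⟩
    · rw [← Polynomial.eval_add]
      congr 1
      refine huniq _ _ fun m => ?_
      rw [Polynomial.eval_add, mul_add, hq, hq, hq]
      exact (hΦ.2.1.slot l₁ l₂ l _).add a b
    · rw [← smul_eq_mul, ← Polynomial.eval_smul]
      congr 1
      refine huniq _ _ fun m => ?_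
      rw [Polynomial.eval_smul, smul_eq_mul, mul_left_comm, hq, hq]
      exact (hΦ.2.1.slot l₁ l₂ l _).smul c a
    · rw [← smul_eq_mul, ← Polynomial.eval_smul]
      congr 1
      refine huniq _ _ fun m => ?_
      rw [Polynomial.eval_smul, smul_eq_mul, mul_left_comm, hq, hq]
      exact (hΦ.2.1.slot l₁ l₂ l _).del a
  · refine ⟨fun a b => ?_, fun c a => ?_, fun a => ?_⟩
    · rw [← Polynomial.eval_add]
      congr 1
      refine huniq _ _ fun m => ?_
      rw [Polynomial.eval_add, mul_add, hq, hq, hq]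
      exact (hΦ.2.1.last l _).add a b
    · rw [← smul_eq_mul, ← Polynomial.eval_smul]
      congr 1
      refine huniq _ _ fun m => ?_
      rw [Polynomial.eval_smul, smul_eq_mul, mul_left_comm, hq, hq]
      exact (hΦ.2.1.last l _).smul c a
    · have : q l (dN N a) = -Polynomial.X * q l a := huniq _ _ fun m => by
        rw [hq, Polynomial.eval_mul, mul_left_comm, hq]
        simpa using (hΦ.2.1.last l m).del a
      rw [this]
      simp
  · -- The parameters are shifted, and the variable of the last entry is replaced by the new
    -- parameter `t 0`. The resulting polynomial is divisible by `t 0`, and its quotient, with the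
    -- variable of the last entry substituted back, is the value of the quotient cochain.
    have hsh : ∀ f ∈ PF k, (fun t : ℕ → k => f fun i => t (i + 1)) ∈ PF k := by
      rintro _ ⟨p, rfl⟩
      refine ⟨rename Nat.succ p, funext fun t => ?_⟩
      have h5 : ((Pi.evalAlgHom k (fun _ : ℕ → k => k) t).comp
          (aeval (fun i (t : ℕ → k) => t i))).comp (rename Nat.succ) =
          (Pi.evalAlgHom k (fun _ : ℕ → k => k) (fun i => t (i + 1))).comp
          (aeval (fun i (t : ℕ → k) => t i)) := by
        refine MvPolynomial.algHom_ext fun i => ?_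
        simp
      exact DFunLike.congr_fun h5 p
    have hshN : ∀ {V : Type _} [AddCommGroup V] [Module k V] (f : (ℕ → k) → V), f ∈ Fam k V →
        (fun t : ℕ → k => f fun i => t (i + 1)) ∈ Fam k V := by
      intro V _ _ f hf
      have : Fam k V ≤ (Fam k V).comap (LinearMap.funLeft k V fun (t : ℕ → k) i => t (i + 1)) :=
        fam_le fun f hf v => smul_mem_fam (hsh f hf) v
      exact this hf
    obtain ⟨p, hp⟩ := hΦ.2.2 (l.map fun s t => s fun i => t (i + 1))
      (fun t => ((y fun i => t (i + 1)).1, t 0)) (by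
        intro s hs
        obtain ⟨s', hs', rfl⟩ := List.mem_map.1 hs
        exact ⟨hshN _ (hl s' hs').1, hsh _ (hl s' hs').2⟩) ⟨hshN _ hy.1, coord_mem_PF 0⟩
    have hev : ∀ (p : MvPolynomial ℕ k) t, aeval (fun i (t : ℕ → k) => t i) p t = eval t p := by
      intro p t
      have h5 : (Pi.evalAlgHom k (fun _ : ℕ → k => k) t).comp
          (aeval (fun i (t : ℕ → k) => t i)) = aeval t := by
        refine MvPolynomial.algHom_ext fun i => ?_
        simp
      exact DFunLike.congr_fun h5 p
    have hp' : ∀ t, eval t p =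
        Φ (l.map fun s => s fun i => t (i + 1)) ((y fun i => t (i + 1)).1, t 0) := by
      intro t
      rw [← hev]
      have := congrFun hp t
      simp only [List.map_map] at this
      exact this
    obtain ⟨r, rfl⟩ : X 0 ∣ p := by
      set g : MvPolynomial ℕ k →ₐ[k] MvPolynomial ℕ k := aeval fun i => if i = 0 then 0 else X i
        with hg
      have h2 : X 0 ∣ p - g p := by
        have := dvd_sub_of_dvd (AlgHom.id k _) g (X 0) (fun i => by
          by_cases hi : i = 0
          · subst hi; simp [hg]
          · simp [hg, hi]) p
        simpa using this
      have h3 : g p = 0 := by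
        refine MvPolynomial.funext fun t => ?_
        have h4 : (aeval t : MvPolynomial ℕ k →ₐ[k] k).comp g =
            aeval (fun i => if i = 0 then 0 else t i) := by
          refine MvPolynomial.algHom_ext fun i => ?_
          by_cases hi : i = 0 <;> simp [hg, hi]
        have h5 := DFunLike.congr_fun h4 p
        rw [AlgHom.comp_apply, aeval_eq_eval, aeval_eq_eval] at h5
        change eval t (g p) = eval _ p at h5
        rw [h5, hp', map_zero]
        exact h0 _ _
      rwa [h3, sub_zero] at h2
    have hr : ∀ (u : ℕ → k) (m : k), (q (l.map fun s => s u) (y u).1).eval m =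
        aeval (fun i => Nat.casesOn i m u : ℕ → k) r := by
      intro u m
      set A : MvPolynomial ℕ k →ₐ[k] Polynomial k :=
        aeval fun i => Nat.casesOn i Polynomial.X (fun j => Polynomial.C (u j)) with hA
      have h2 : ∀ m, (Polynomial.aeval m : Polynomial k →ₐ[k] k).comp A =
          aeval (fun i => Nat.casesOn i m u : ℕ → k) := fun m => by
        refine MvPolynomial.algHom_ext fun i => ?_
        cases i <;> simp [hA]
      have h3 : ∀ m, (A r).eval m = aeval (fun i => Nat.casesOn i m u : ℕ → k) r :=
        fun m => DFunLike.congr_fun (h2 m) r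
      rw [← h3]
      congr 1
      refine huniq _ _ fun m => ?_
      have h4 := hp' (fun i => Nat.casesOn i m u)
      rw [map_mul, eval_X] at h4
      rw [hq, h3, aeval_eq_eval]
      exact h4.symm
    obtain ⟨g, hg⟩ := hy.2
    refine ⟨aeval (fun i => Nat.casesOn i g X) r, funext fun t => ?_⟩
    change aeval (fun i (t : ℕ → k) => t i) (aeval (fun i => Nat.casesOn i g X) r) t =
      (q (l.map fun s => s t) (y t).1).eval (y t).2
    rw [hr, hev]
    have h4 : (aeval t : MvPolynomial ℕ k →ₐ[k] k).comp (aeval (fun i => Nat.casesOn i g X)) =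
        aeval (fun i => Nat.casesOn i (y t).2 t : ℕ → k) := by
      refine MvPolynomial.algHom_ext fun i => ?_
      cases i with
      | zero =>
        have h5 := congrFun hg t
        change aeval (fun i (t : ℕ → k) => t i) g t = _ at h5
        rw [hev] at h5
        simpa [aeval_eq_eval] using h5
      | succ i => simp
    exact DFunLike.congr_fun h4 r

end Operations

/-! ### The modules `P` and `K` -/

section Modules

open MvPolynomial

variable (k : Type*) [Field k]

/-- The space `P` of the symbols with `a(x, y, 0) = x a(x, y, 1)`. -/
def Pm : Submodule k (Sym k) where
  carrier := {a | ∀ x y, ev x y 0 a = x * ev x y 1 a}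
  add_mem' {a b} ha hb x y := by rw [map_add, map_add, ha x y, hb x y]; ring
  zero_mem' x y := by simp
  smul_mem' c a ha x y := by rw [map_smul, map_smul, ha x y]; simp; ring

/-- The space `K` of the symbols with `a(x, y, 0) = x y a(x, y, 1)`. -/
def Km : Submodule k (Sym k) where
  carrier := {a | ∀ x y, ev x y 0 a = x * y * ev x y 1 a}
  add_mem' {a b} ha hb x y := by rw [map_add, map_add, ha x y, hb x y]; ring
  zero_mem' x y := by simp
  smul_mem' c a ha x y := by rw [map_smul, map_smul, ha x y]; simp; ring

variable {k}

instance : IsMod (Pm k) where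
  del_mem a ha x y := by
    simp only [map_mul, ev_del]
    linear_combination (x - y) * ha x y
  lam_mem l a ha b hb x y := by
    simp only [ev_lam]
    linear_combination ev x (x + l) 0 a * hb (x + l) y + ev (x + l) y 1 b * ha x (x + l)

instance : IsMod (Km k) where
  del_mem a ha x y := by
    simp only [map_mul, ev_del]
    linear_combination (x - y) * ha x y
  lam_mem l a ha b hb x y := by
    simp only [ev_lam]
    linear_combination ev x (x + l) 0 a * hb (x + l) y + y * ev (x + l) y 1 b * ha x (x + l)

instance : IsMod (⊤ : Submodule k (Sym k)) where
  del_mem _ _ := trivial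
  lam_mem _ _ _ _ _ := trivial

variable [CharZero k]

/-- Symbols of two variables `x`, `y` may be compared after multiplication by `∂ + m`. -/
lemma eq_of_del_add_mul {m : k} {p q : Sym k}
    (h : ∀ x y, (x - y + m) * ev x y 0 p = (x - y + m) * ev x y 0 q) (x y : k) :
    ev x y 0 p = ev x y 0 q := by
  have h1 : ev x y 0 (e0 p - e0 q) = 0 := ev_eq_zero_of_mul (del_add_ne_zero m) (fun x y d => by
    have := h x y
    simp only [map_add, ev_del, ev_C, map_sub, ev_e0]
    linear_combination this) x y 0
  simpa [sub_eq_zero] using h1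

instance : IsSat (Pm k) where
  sat m q hq x y := by
    have h := eq_of_del_add_mul (m := m) (p := q) (q := X 0 * e1 q) fun x y => by
      have := hq x y
      simp only [map_mul, map_add, ev_del, ev_C] at this
      simp only [map_mul, ev_X0, ev_e1]
      linear_combination this
    simpa using h x y

/-! #### Acyclicity of `P` -/

/-- The symbol `(1 - Δ) x + Δ` of `P`. -/
noncomputable def p0 : Sym k := (1 - X 2) * X 0 + X 2
/-- The symbol `1 - Δ + Δ y`. -/
noncomputable def g1 : Sym k := 1 - X 2 + X 2 * X 1

omit [CharZero k] in
@[simp] lemma ev_p0 (x y d : k) : ev x y d p0 = (1 - d) * x + d := by simp [p0]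
omit [CharZero k] in
@[simp] lemma ev_g1 (x y d : k) : ev x y d g1 = 1 - d + d * y := by simp [g1]

/-- The symbols with `z(x, y, 1) = y z(x, y, 0)`. This space is dual to `P`: the products of
elements of `P` with them belong to `CQ`. -/
def IsDual (z : Sym k) : Prop := ∀ x y, ev x y 1 z = y * ev x y 0 z

variable (k) in
/-- The element `p₀` of `P`. -/
noncomputable def p0' : Pm k := ⟨p0, fun x y => by simp⟩

omit [CharZero k] in
lemma IsDual.mem {z : Sym k} (hz : IsDual z) (m : k) (p : Pm k) : lam m (p : Sym k) z ∈ CQ k := by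
  intro x y
  have := p.2 x (x + m)
  rw [ev_lam, ev_lam, hz, this]
  ring

/-- The map `(p, m) ↦ (p_m z, m + e)` from `P` to `CQ`. -/
noncomputable def gz {z : Sym k} (hz : IsDual z) (e : k) (y : Pt (Pm k)) : Pt (CQ k) :=
  (⟨lam y.2 y.1 z, hz.mem y.2 y.1⟩, y.2 + e)

lemma sm_gz {z : Sym k} (hz : IsDual z) (e : k) (s : Pt (CQ k)) (y : Pt (Pm k)) :
    gz hz e (sm s y) = sm s (gz hz e y) := by
  refine Prod.ext (Subtype.ext (sym_ext fun x y d => ?_)) (by simp [gz, add_assoc])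
  simp [gz, sm, add_assoc, mul_assoc]

lemma ap_gz_mem {z : Sym k} (hz : IsDual z) (e : k) (y₀ : Pt (Pm k)) {n : ℕ} {φ : Wd (Pm k)}
    (h : φ ∈ R (Pm k) (n + 1)) : ap (gz hz e) y₀ φ ∈ R (Pm k) n := by
  refine ap_mem (fun m f hf => ?_) (fun y hy => ?_) h
  · have hf' := hf (m + e)
    refine ⟨fun a b => ?_, fun c a => ?_, fun a => ?_⟩
    · refine Eq.trans ?_ (hf'.add _ _)
      exact congrArg (f (m + e)) (Subtype.ext (by simp [gz]))
    · refine Eq.trans ?_ (hf'.smul _ _)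
      exact congrArg (f (m + e)) (Subtype.ext (by simp [gz]))
    · refine Eq.trans ?_ (hf'.smul _ _)
      refine congrArg (f (m + e)) (Subtype.ext (sym_ext fun x y d => ?_))
      simp [gz]
      ring
  · refine ⟨fam_linear (fun t => (LinearMap.codRestrict (CQ k)
      ((lam (y t).2).flip z ∘ₗ (Pm k).subtype) fun p => hz.mem _ p)) (fun p => ?_) hy.1,
      (PF k).add_mem hy.2 (const_mem_PF e)⟩
    exact lam_mem_fam_sub hy.2 p z (CQ k) fun l => hz.mem l p

/-- The symbol `z` in `z(x, x) p₀(x) + z'(x, x + 1) p₀(x + 1) = 1`. -/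
noncomputable def zA : Sym k := -g1 + cc * ((X 0 + X 0 - 1) * X 0)
/-- The symbol `z'` in `z(x, x) p₀(x) + z'(x, x + 1) p₀(x + 1) = 1`. -/
noncomputable def zB : Sym k := g1 - cc * ((X 0 + X 0 - 1) * (X 0 - 1))

omit [CharZero k] in
lemma isDual_zA : IsDual (zA : Sym k) := fun x y => by simp [zA]
omit [CharZero k] in
lemma isDual_zB : IsDual (zB : Sym k) := fun x y => by simp [zB]

/-- The contracting homotopy of the complex of `P`: the last entry `p` is replaced by the two
entries `p_m z` and `p₀`, and by `p_m z'` and `p₀`. -/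
noncomputable def contr : Wd (Pm k) →ₗ[k] Wd (Pm k) :=
  ap (gz isDual_zA 0) (p0' k, 0) + ap (gz isDual_zB 1) (p0' k, -1)

lemma contr_mem {n : ℕ} {φ : Wd (Pm k)} (h : φ ∈ R (Pm k) (n + 1)) : contr φ ∈ R (Pm k) n :=
  (R (Pm k) n).add_mem (ap_gz_mem _ _ _ h) (ap_gz_mem _ _ _ h)

/-- The homotopy formula. The values at the products of the two new last entries add up to the value
at `p`, by the identity that `z`, `z'` and `p₀` satisfy. -/
lemma contr_dW {n : ℕ} {φ : Wd (Pm k)} (h : φ ∈ R (Pm k) n) (l : List (Pt (CQ k)))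
    (y : Pt (Pm k)) : contr (dW _ φ) l y = dW _ (contr φ) l y - (-1) ^ n * φ l y +
      if l = [] then ev (-y.2) 0 0 (y.1 : Sym k) * (φ [] (p0' k, -1) - φ [] (p0' k, 0)) else 0 := by
  have hsum : φ l (sm (gz isDual_zA 0 y) (p0' k, 0)) + φ l (sm (gz isDual_zB 1 y) (p0' k, -1)) =
      φ l y := by
    have hl := h.2.1.last l y.2
    have h1 : (sm (gz isDual_zA 0 y) (p0' k, 0)).2 = y.2 := by simp [gz]
    have h2 : (sm (gz isDual_zB 1 y) (p0' k, -1)).2 = y.2 := by simp [gz]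
    change φ l ((sm (gz isDual_zA 0 y) (p0' k, 0)).1, (sm (gz isDual_zA 0 y) (p0' k, 0)).2) +
      φ l ((sm (gz isDual_zB 1 y) (p0' k, -1)).1, (sm (gz isDual_zB 1 y) (p0' k, -1)).2) = _
    rw [h1, h2, ← hl.add]
    refine hl.congr fun x d => ?_
    simp [gz, p0', zA, zB]
    ring
  have hA := ap_dW (y₀ := ((p0' k, 0) : Pt (Pm k))) (sm_gz isDual_zA 0) (fun y => by simp [gz])
    φ l y
  have hB := ap_dW (y₀ := ((p0' k, -1) : Pt (Pm k))) (sm_gz isDual_zB 1) (fun y => by simp [gz])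
    φ l y
  have hlen : (-1 : k) ^ l.length * φ l y = (-1) ^ n * φ l y := by
    by_cases hl : l.length = n
    · rw [hl]
    · rw [h.1 l y hl, mul_zero, mul_zero]
  have hwA : wt (gz isDual_zA 0 y) 0 = -ev (-y.2) 0 0 (y.1 : Sym k) := by
    simp [wt, gz, zA]
  have hwB : wt (gz isDual_zB 1 y) (-1) = ev (-y.2) 0 0 (y.1 : Sym k) := by
    simp [wt, gz, zB]
  rw [contr, LinearMap.add_apply, LinearMap.add_apply, Pi.add_apply, Pi.add_apply, hA, hB,
    map_add, Pi.add_apply, Pi.add_apply, hwA, hwB, ← hlen, ← hsum]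
  split_ifs <;> ring

/-- The complex of `P` is exact in positive degrees. -/
lemma exists_of_cocycle_Pm {n : ℕ} {φ : Wd (Pm k)} (h : φ ∈ R (Pm k) (n + 1))
    (hd : dW _ φ = 0) : ∃ ψ ∈ R (Pm k) n, dW _ ψ = φ := by
  refine ⟨(-1 : k) ^ (n + 1) • contr φ, (R (Pm k) n).smul_mem _ (contr_mem h), ?_⟩
  funext l y
  have h1 := contr_dW h l y
  have h2 : ∀ y, φ [] y = 0 := fun y => h.1 [] y (by simp)
  rw [hd, map_zero, h2, h2, sub_zero, mul_zero, ite_self, add_zero] at h1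
  have h3 : (-1 : k) ^ (n + 1) * (-1) ^ (n + 1) = 1 := by rw [← mul_pow]; simp
  rw [map_smul, Pi.smul_apply, Pi.smul_apply, smul_eq_mul, sub_eq_zero.1 h1.symm, ← mul_assoc,
    h3, one_mul]

/-- The cocycles of degree zero of `P` are the multiples of `aug`. -/
lemma eq_smul_aug_of_cocycle {φ : Wd (Pm k)} (h : φ ∈ R (Pm k) 0) (hd : dW _ φ = 0) :
    ∃ α : k, φ = α • aug _ := by
  refine ⟨φ [] (p0' k, -1) - φ [] (p0' k, 0), funext₂ fun l y => ?_⟩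
  cases l with
  | nil =>
    have h1 := contr_dW h [] y
    rw [hd, map_zero, if_pos rfl] at h1
    have h2 : dW (Pm k) (contr φ) [] y = 0 := by simp [dW_apply]
    rw [h2] at h1
    simp only [Pi.zero_apply, pow_zero, one_mul, zero_sub] at h1
    rw [Pi.smul_apply, Pi.smul_apply, smul_eq_mul, aug]
    linear_combination h1
  | cons s l => rw [h.1 _ _ (by simp)]; simp [aug]

lemma aug_Pm_ne_zero : aug (Pm k) ≠ 0 := by
  intro h
  have := congrFun (congrFun h []) (p0' k, -1)
  simp [aug, p0'] at this

lemma smul_aug_inj {α β : k} (h : α • aug (Pm k) = β • aug (Pm k)) : α = β :=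
  smul_left_injective k aug_Pm_ne_zero h

/-! #### Multiplication by symbols independent of `x` -/

/-- Symbols that do not depend on `x`. -/
def IsRight (z : Sym k) : Prop := ∀ x x' y d, ev x y d z = ev x' y d z

variable {N N' : Submodule k (Sym k)}

/-- Right multiplication by a symbol as a map between spaces of symbols. -/
noncomputable def mulR (z : Sym k) (h : ∀ a ∈ N, a * z ∈ N') : N →ₗ[k] N' :=
  (LinearMap.mulRight k z).restrict h

omit [CharZero k] in
@[simp] lemma coe_mulR (z : Sym k) (h : ∀ a ∈ N, a * z ∈ N') (a : N) :
    (mulR z h a : Sym k) = (a : Sym k) * z := rfl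

variable [IsMod N] [IsMod N']

omit [CharZero k] in
lemma mulR_dN (z : Sym k) (h : ∀ a ∈ N, a * z ∈ N') (a : N) :
    mulR z h (dN N a) = dN N' (mulR z h a) :=
  Subtype.ext (by simp [mul_assoc])

lemma mulR_actN {z : Sym k} (hz : IsRight z) (h : ∀ a ∈ N, a * z ∈ N') (l : k) (a : CQ k)
    (b : N) : mulR z h (actN N l a b) = actN N' l a (mulR z h b) :=
  Subtype.ext (sym_ext fun x y d => by simp [mul_assoc, hz x (x + l) y d])

/-- The symbol `y (1 - Δ) + Δ`. -/
noncomputable def g2 : Sym k := X 1 * (1 - X 2) + X 2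

omit [CharZero k] in
@[simp] lemma ev_g2 (x y d : k) : ev x y d g2 = y * (1 - d) + d := by simp [g2]

omit [CharZero k] in
lemma isRight_cc : IsRight (cc : Sym k) := fun x x' y d => by simp
omit [CharZero k] in
lemma isRight_g1 : IsRight (g1 : Sym k) := fun x x' y d => by simp
omit [CharZero k] in
lemma isRight_g2 : IsRight (g2 : Sym k) := fun x x' y d => by simp

end Modules

/-! ### Maps between `CQ`, `K` and copies of `P` -/

section Resolutions

open MvPolynomial

variable {k : Type*} [Field k] [CharZero k]

lemma e0_del : e0 (del : Sym k) = del := sym_ext fun x y d => by simp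
lemma e1_del : e1 (del : Sym k) = del := sym_ext fun x y d => by simp

lemma qC_dN (b : CQ k) : qC (dN _ b) = del * qC b ∧ rC (dN _ b) = del * rC b :=
  eq_qC_rC (by rw [map_mul, e0_del, e0_qC]) (by rw [coe_dN, CQ_eq b]; ring)

/-- Multiples of `c` belong to all the modules. -/
lemma mul_cc_mem_CQ (a : Sym k) : a * cc ∈ CQ k := fun x y => by simp
lemma mul_cc_mem_Pm (a : Sym k) : a * cc ∈ Pm k := fun x y => by simp
lemma mul_cc_mem_Km (a : Sym k) : a * cc ∈ Km k := fun x y => by simp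
lemma mul_g1_mem_CQ {a : Sym k} (ha : a ∈ Pm k) : a * g1 ∈ CQ k := fun x y => by
  simp [ha x y]; ring
lemma mul_g1_mem_Pm {a : Sym k} (ha : a ∈ Km k) : a * g1 ∈ Pm k := fun x y => by
  simp [ha x y]; ring
lemma mul_g2_mem_Km {a : Sym k} (ha : a ∈ Pm k) : a * g2 ∈ Km k := fun x y => by
  simp [ha x y]; ring
lemma mul_g2_mem_Pm {a : Sym k} (ha : a ∈ CQ k) : a * g2 ∈ Pm k := fun x y => by
  have := ha x y
  simp
  linear_combination this

/-! #### The quotient of an element of `P` -/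

lemma exists_tP : ∃ f : Pm k →ₗ[k] Sym k, ∀ p : Pm k,
    cc * f p = (p : Sym k) - e1 (p : Sym k) * p0 := by
  refine exists_quot ((Pm k).subtype -
    LinearMap.mulRight k p0 ∘ₗ e1.toLinearMap ∘ₗ (Pm k).subtype) _ cc_ne_zero fun p => ?_
  refine cc_dvd (fun x y => ?_) (fun x y => ?_)
  · simp [p.2 x y, mul_comm]
  · simp

/-- The polynomial `t` of `p = p(x, y, 1) p₀ + c t ∈ P`. -/
noncomputable def tP : Pm k →ₗ[k] Sym k := exists_tP.choose

lemma Pm_eq (p : Pm k) : (p : Sym k) = e1 (p : Sym k) * p0 + cc * tP p := by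
  rw [tP, exists_tP.choose_spec p]; ring

lemma tP_dN (p : Pm k) : tP (dN _ p) = del * tP p := by
  refine mul_left_cancel₀ cc_ne_zero ?_
  have h := Pm_eq (dN _ p)
  rw [coe_dN, map_mul, e1_del] at h
  linear_combination -h + del * Pm_eq p

lemma tP_cc (a : Sym k) (h : a * cc ∈ Pm k) : tP ⟨a * cc, h⟩ = a := by
  refine mul_left_cancel₀ cc_ne_zero ?_
  have h1 := Pm_eq ⟨a * cc, h⟩
  have h2 : e1 (cc : Sym k) = 0 := sym_ext fun x y d => by simp
  rw [map_mul, h2] at h1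
  linear_combination -h1

/-! #### The resolution `K → P² → CQ` -/

/-- The map `p ↦ p g₁` from `P` to `CQ`. -/
noncomputable def i1 : Pm k →ₗ[k] CQ k := mulR g1 fun _ ha => mul_g1_mem_CQ ha
/-- The map `p ↦ p c` from `P` to `CQ`. -/
noncomputable def i2 : Pm k →ₗ[k] CQ k := mulR cc fun a _ => mul_cc_mem_CQ a
/-- The map `a ↦ a c` from `K` to `P`. -/
noncomputable def j1 : Km k →ₗ[k] Pm k := mulR cc fun a _ => mul_cc_mem_Pm a
/-- The map `a ↦ a g₁` from `K` to `P`. -/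
noncomputable def j2 : Km k →ₗ[k] Pm k := mulR g1 fun _ ha => mul_g1_mem_Pm ha

/-- For `b = q v + c r`, the symbol `d` with `b = q p₀ g₁ + c d`: the defect of `(q p₀, 0)` as a
lift of `b` along `P² → CQ`. -/
noncomputable def rD : CQ k →ₗ[k] Sym k :=
  rC - LinearMap.mulRight k (X 0 + X 1 - 1 - X 0 * X 1) ∘ₗ qC

/-- The obstruction for `rD` to lie in `P`. -/
noncomputable def sD : CQ k →ₗ[k] Sym k :=
  e0.toLinearMap ∘ₗ rD - LinearMap.mulLeft k (X 0) ∘ₗ e1.toLinearMap ∘ₗ rD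

lemma rD_apply (b : CQ k) : rD b = rC b - qC b * (X 0 + X 1 - 1 - X 0 * X 1) := rfl
lemma sD_apply (b : CQ k) : sD b = e0 (rD b) - X 0 * e1 (rD b) := rfl

lemma rD_dN (b : CQ k) : rD (dN _ b) = del * rD b := by
  rw [rD_apply, rD_apply, (qC_dN b).1, (qC_dN b).2]; ring

lemma sD_dN (b : CQ k) : sD (dN _ b) = del * sD b := by
  rw [sD_apply, sD_apply, rD_dN, map_mul, map_mul, e0_del, e1_del]; ring

/-- The first component of a section of `P² → CQ`. -/
noncomputable def s1 : CQ k →ₗ[k] Pm k :=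
  LinearMap.codRestrict (Pm k) (LinearMap.mulRight k p0 ∘ₗ qC +
    LinearMap.mulRight k cc ∘ₗ LinearMap.mulLeft k (1 - X 2) ∘ₗ sD) fun b => by
      refine (Pm k).add_mem (fun x y => ?_) (mul_cc_mem_Pm _)
      simp [ev_qC b x y 1]
      ring

/-- The second component of a section of `P² → CQ`. -/
noncomputable def s2 : CQ k →ₗ[k] Pm k :=
  LinearMap.codRestrict (Pm k) (rD - LinearMap.mulRight k g1 ∘ₗ LinearMap.mulLeft k (1 - X 2) ∘ₗ sD)
    fun b x y => by simp [sD_apply]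

lemma coe_s1 (b : CQ k) : (s1 b : Sym k) = qC b * p0 + (1 - X 2) * sD b * cc := rfl
lemma coe_s2 (b : CQ k) : (s2 b : Sym k) = rD b - (1 - X 2) * sD b * g1 := rfl

/-- The pair `(s1, s2)` is a section of `P² → CQ`. -/
lemma section_eq (b : CQ k) : i1 (s1 b) + i2 (s2 b) = b := by
  refine Subtype.ext ?_
  rw [Submodule.coe_add, i1, i2, coe_mulR, coe_mulR, coe_s1, coe_s2, rD_apply]
  conv_rhs => rw [CQ_eq b]
  simp only [p0, g1, cc, vS]
  ring

lemma s1_dN (b : CQ k) : s1 (dN _ b) = dN _ (s1 b) := Subtype.ext <| by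
  rw [coe_s1, coe_dN, coe_s1, (qC_dN b).1, sD_dN]; ring

lemma s2_dN (b : CQ k) : s2 (dN _ b) = dN _ (s2 b) := Subtype.ext <| by
  rw [coe_s2, coe_dN, coe_s2, rD_dN, sD_dN]; ring

lemma s1_i2 (p : Pm k) : s1 (i2 p) = 0 ∧ s2 (i2 p) = p := by
  obtain ⟨h1, h2⟩ := eq_qC_rC (b := i2 p) (q := 0) (r := p) (by simp)
    (by rw [i2, coe_mulR]; ring)
  have h3 : rD (i2 p) = p := by rw [rD_apply, h1, h2]; ring
  have h4 : sD (i2 p) = 0 := by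
    rw [sD_apply, h3]
    exact sym_ext fun x y d => by simp [p.2 x y]
  exact ⟨Subtype.ext (by rw [coe_s1, h1, h4]; simp), Subtype.ext (by rw [coe_s2, h3, h4]; simp)⟩

/-- The symbol of the retraction of `P` onto `K`, embedded by `a ↦ a c`. -/
noncomputable def kR : Pm k →ₗ[k] Sym k := tP - LinearMap.mulLeft k (1 - X 2) ∘ₗ sD ∘ₗ i1

lemma kR_apply (p : Pm k) : kR p = tP p - (1 - X 2) * sD (i1 p) := rfl

lemma cc_mul_kR (p : Pm k) : kR p * cc = (p : Sym k) - (s1 (i1 p) : Sym k) := by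
  obtain ⟨h1, -⟩ := eq_qC_rC (b := i1 p) (q := e1 (p : Sym k))
    (r := e1 (p : Sym k) * (X 0 + X 1 - 1 - X 0 * X 1) + tP p * g1)
    (sym_ext fun x y d => by simp) (by
      rw [i1, coe_mulR]
      conv_lhs => rw [Pm_eq p]
      simp only [p0, g1, cc, vS]
      ring)
  rw [kR_apply, coe_s1, h1]
  linear_combination -Pm_eq p

lemma kR_mul_g1 (p : Pm k) : kR p * g1 = (s2 (i1 p) : Sym k) := by
  refine mul_left_cancel₀ cc_ne_zero ?_
  have h := congrArg (Subtype.val) (section_eq (i1 p))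
  rw [Submodule.coe_add, i1, i2, coe_mulR, coe_mulR, coe_mulR] at h
  rw [i1]
  have h2 := cc_mul_kR p
  rw [i1] at h2
  linear_combination g1 * h2 - h

lemma kR_mem (p : Pm k) : kR p ∈ Km k := by
  intro x y
  have h := (s2 (i1 p)).2 x y
  rw [← kR_mul_g1] at h
  simp at h
  linear_combination h

/-- The retraction of `P` onto `K`, embedded by `a ↦ a c`. -/
noncomputable def kk : Pm k →ₗ[k] Km k := kR.codRestrict (Km k) kR_mem

lemma kk_dN (p : Pm k) : kk (dN _ p) = dN _ (kk p) := Subtype.ext <| by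
  change kR _ = del * kR p
  rw [kR_apply, kR_apply, tP_dN, i1, mulR_dN, sD_dN]
  ring

lemma s1_i1 (p : Pm k) : s1 (i1 p) = p - j1 (kk p) := Subtype.ext <| by
  have := cc_mul_kR p
  change _ = (p : Sym k) - kR p * cc
  linear_combination this

lemma s2_i1 (p : Pm k) : s2 (i1 p) = j2 (kk p) := Subtype.ext (kR_mul_g1 p).symm

lemma kk_j1 (a : Km k) : kk (j1 a) = a := Subtype.ext <| by
  have h : i1 (j1 a) = i2 (j2 a) := Subtype.ext (by simp only [i1, i2, j1, j2, coe_mulR]; ring)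
  change kR (j1 a) = a
  refine mul_right_cancel₀ cc_ne_zero ?_
  rw [cc_mul_kR, h, (s1_i2 _).1]
  simp [j1]

/-- A cochain on `CQ` is determined by its pullbacks to `P`. -/
lemma CQ_ext {φ : Wd (CQ k)} (h : IsMulti φ) (h1 : pb i1 φ = 0) (h2 : pb i2 φ = 0) : φ = 0 := by
  funext l y
  have h3 := congrFun (congrFun h1 l) (s1 y.1, y.2)
  have h4 := congrFun (congrFun h2 l) (s2 y.1, y.2)
  rw [pb_apply] at h3 h4
  have h5 := (h.last l y.2).add (i1 (s1 y.1)) (i2 (s2 y.1))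
  rw [section_eq] at h5
  rw [Pi.zero_apply, Pi.zero_apply]
  refine h5.trans ?_
  rw [h3, h4]
  simp

/-- A pair of cochains on `P` that vanishes on `K` comes from a cochain on `CQ`. -/
lemma exists_CQ {n : ℕ} {ψ₁ ψ₂ : Wd (Pm k)} (h1 : ψ₁ ∈ R _ n) (h2 : ψ₂ ∈ R _ n)
    (h : pb j1 ψ₁ = pb j2 ψ₂) : ∃ φ ∈ R (CQ k) n, pb i1 φ = ψ₁ ∧ pb i2 φ = ψ₂ := by
  refine ⟨pb s1 ψ₁ + pb s2 ψ₂, (R _ n).add_mem (pb_mem s1_dN h1) (pb_mem s2_dN h2), ?_, ?_⟩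
  · funext l y
    have h3 := congrFun (congrFun h l) (kk y.1, y.2)
    rw [pb_apply, pb_apply] at h3
    have h4 := (h1.2.1.last l y.2).add (y.1 - j1 (kk y.1)) (j1 (kk y.1))
    rw [sub_add_cancel] at h4
    rw [pb_apply, Pi.add_apply, Pi.add_apply, pb_apply, pb_apply]
    simp only [s1_i1, s2_i1]
    change _ = ψ₁ l (y.1, y.2)
    rw [h4, h3]
  · funext l y
    have h4 := (h1.2.1.last l y.2).smul 0 0
    rw [zero_smul, zero_mul] at h4
    rw [pb_apply, Pi.add_apply, Pi.add_apply, pb_apply, pb_apply]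
    simp only [(s1_i2 y.1).1, (s1_i2 y.1).2]
    rw [h4, zero_add]

/-- Every cochain on `K` extends to a cochain on `P`. -/
lemma exists_lift_Km {n : ℕ} {χ : Wd (Km k)} (h : χ ∈ R _ n) :
    ∃ ψ ∈ R (Pm k) n, pb j1 ψ = χ :=
  ⟨pb kk χ, pb_mem kk_dN h, funext₂ fun l y => by simp [kk_j1]⟩

/-! #### The complex `CQ → P² → K` -/

/-- The map `p ↦ p g₂` from `P` to `K`. -/
noncomputable def i3 : Pm k →ₗ[k] Km k := mulR g2 fun _ ha => mul_g2_mem_Km ha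
/-- The map `p ↦ p c` from `P` to `K`. -/
noncomputable def i4 : Pm k →ₗ[k] Km k := mulR cc fun a _ => mul_cc_mem_Km a
/-- The map `a ↦ a c` from `CQ` to `P`. -/
noncomputable def j3 : CQ k →ₗ[k] Pm k := mulR cc fun a _ => mul_cc_mem_Pm a
/-- The map `a ↦ a g₂` from `CQ` to `P`. -/
noncomputable def j4 : CQ k →ₗ[k] Pm k := mulR g2 fun _ ha => mul_g2_mem_Pm ha

/-- Exactness of `CQ → P² → K` in the middle. -/
lemma exists_of_i3_add_i4 {p q : Pm k} (h : i3 p + i4 q = 0) :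
    ∃ r : CQ k, p = -j3 r ∧ q = j4 r := by
  have h1 := congrArg Subtype.val h
  rw [Submodule.coe_add, i3, i4, coe_mulR, coe_mulR, Submodule.coe_zero] at h1
  have h2 : ∀ x y, ev x y 1 (p : Sym k) = 0 := fun x y => by
    simpa using congrArg (ev x y 1) h1
  obtain ⟨r, hr⟩ : cc ∣ (p : Sym k) := cc_dvd (fun x y => by rw [p.2 x y, h2, mul_zero]) h2
  have h3 : (q : Sym k) = -r * g2 := by
    refine mul_left_cancel₀ cc_ne_zero ?_
    rw [hr] at h1
    linear_combination h1
  have hrC : -r ∈ CQ k := fun x y => by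
    have := q.2 x y
    rw [h3] at this
    simp at this ⊢
    linear_combination this
  refine ⟨⟨-r, hrC⟩, Subtype.ext ?_, Subtype.ext ?_⟩
  · rw [Submodule.coe_neg, j3, coe_mulR, hr]
    ring
  · rw [j4, coe_mulR, h3]

/-- The symbol `x y (1 - Δ) + Δ` of `K`. -/
noncomputable def k0 : Sym k := X 0 * X 1 * (1 - X 2) + X 2

lemma exists_tK : ∃ f : Km k →ₗ[k] Sym k, ∀ a : Km k,
    cc * f a = (a : Sym k) - e1 (a : Sym k) * k0 := by
  refine exists_quot ((Km k).subtype -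
    LinearMap.mulRight k k0 ∘ₗ e1.toLinearMap ∘ₗ (Km k).subtype) _ cc_ne_zero fun p => ?_
  refine cc_dvd (fun x y => ?_) (fun x y => ?_)
  · simp [p.2 x y, k0, mul_comm]
  · simp [k0]

/-- The polynomial `t` of `a = a(x, y, 1) k₀ + c t ∈ K`. -/
noncomputable def tK : Km k →ₗ[k] Sym k := exists_tK.choose

lemma Km_eq (a : Km k) : (a : Sym k) = e1 (a : Sym k) * k0 + cc * tK a := by
  rw [tK, exists_tK.choose_spec a]; ring

lemma tK_dN (a : Km k) : tK (dN _ a) = del * tK a := by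
  refine mul_left_cancel₀ cc_ne_zero ?_
  have h := Km_eq (dN _ a)
  rw [coe_dN, map_mul, e1_del] at h
  linear_combination -h + del * Km_eq a

/-- The value of an element of `K` at `Δ = 1`. -/
noncomputable def qK : Km k →ₗ[k] Sym k := e1.toLinearMap ∘ₗ (Km k).subtype

lemma qK_apply (a : Km k) : qK a = e1 (a : Sym k) := rfl

lemma qK_dN (a : Km k) : qK (dN _ a) = del * qK a := by
  rw [qK_apply, coe_dN, map_mul, e1_del]; rfl

/-- For `a = q k₀ + c t`, the symbol `d` with `a = q p₀ g₂ + c d`: the defect of `(q p₀, 0)` as a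
lift of `a` along `P² → K`. -/
noncomputable def aK : Km k →ₗ[k] Sym k :=
  tK - LinearMap.mulRight k (X 0 * X 1 + 1 - X 0 - X 1) ∘ₗ qK

lemma aK_apply (a : Km k) : aK a = tK a - qK a * (X 0 * X 1 + 1 - X 0 - X 1) := rfl

lemma aK_dN (a : Km k) : aK (dN _ a) = del * aK a := by
  rw [aK_apply, aK_apply, tK_dN, qK_dN]; ring

/-- The correction term of the lift of `∂ a`. -/
noncomputable def rK : Km k →ₗ[k] Sym k :=
  LinearMap.mulLeft k (-(1 - X 2)) ∘ₗ e0.toLinearMap ∘ₗ aK +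
    LinearMap.mulLeft k (X 2) ∘ₗ (LinearMap.mulLeft k del ∘ₗ e1.toLinearMap ∘ₗ aK -
      e0.toLinearMap ∘ₗ aK)

lemma rK_apply (a : Km k) :
    rK a = -(1 - X 2) * e0 (aK a) + X 2 * (del * e1 (aK a) - e0 (aK a)) := rfl

lemma rK_dN (a : Km k) : rK (dN _ a) = del * rK a := by
  rw [rK_apply, rK_apply, aK_dN, map_mul, map_mul, e0_del, e1_del]; ring

/-- The first component of a lift of `∂ a` to `P²`. -/
noncomputable def l1 : Km k →ₗ[k] Pm k :=
  LinearMap.codRestrict (Pm k) (LinearMap.mulRight k p0 ∘ₗ LinearMap.mulLeft k del ∘ₗ qK +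
    LinearMap.mulRight k cc ∘ₗ rK) fun a => by
      refine (Pm k).add_mem (fun x y => ?_) (mul_cc_mem_Pm _)
      simp [qK_apply]
      ring

/-- The second component of a lift of `∂ a` to `P²`. -/
noncomputable def l2 : Km k →ₗ[k] Pm k :=
  LinearMap.codRestrict (Pm k) (LinearMap.mulLeft k del ∘ₗ aK - LinearMap.mulRight k g2 ∘ₗ rK)
    fun a x y => by
      simp [rK_apply]
      ring

lemma coe_l1 (a : Km k) : (l1 a : Sym k) = del * qK a * p0 + rK a * cc := rfl
lemma coe_l2 (a : Km k) : (l2 a : Sym k) = del * aK a - rK a * g2 := rfl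

/-- The map `P² → K` is not surjective, but its image contains all `∂ a`. -/
lemma lift_eq (a : Km k) : i3 (l1 a) + i4 (l2 a) = dN _ a := by
  refine Subtype.ext ?_
  rw [Submodule.coe_add, i3, i4, coe_mulR, coe_mulR, coe_l1, coe_l2, coe_dN, aK_apply]
  conv_rhs => rw [Km_eq a, ← qK_apply]
  simp only [p0, g2, cc, k0]
  ring

lemma l1_dN (a : Km k) : l1 (dN _ a) = dN _ (l1 a) := Subtype.ext <| by
  rw [coe_l1, coe_dN, coe_l1, qK_dN, rK_dN]; ring

lemma l2_dN (a : Km k) : l2 (dN _ a) = dN _ (l2 a) := Subtype.ext <| by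
  rw [coe_l2, coe_dN, coe_l2, aK_dN, rK_dN]; ring

variable (k) in
/-- The symbol `c` as an element of `P`. -/
noncomputable def cP : Pm k := ⟨cc, by simpa using mul_cc_mem_Pm (1 : Sym k)⟩
variable (k) in
/-- The symbol `c` as an element of `K`. -/
noncomputable def cK : Km k := ⟨cc, by simpa using mul_cc_mem_Km (1 : Sym k)⟩

/-- The cokernel of `P² → K` is spanned by `c`. -/
lemma exists_Km_eq (a : Km k) : ∃ (α : k) (p q : Pm k), a = α • cK k + (i3 p + i4 q) := by
  set α : k := ev 0 0 0 (aK a) with hα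
  set h : Sym k := e0 (aK a) - C α with hh
  obtain ⟨w, hw⟩ : X 1 ∣ h - sub (X 0) 0 (X 2) h := dvd_sub_sub _ _ _ _ (by simp) (by simp)
    (by simp) h
  obtain ⟨u, hu⟩ : X 0 ∣ sub (X 0) 0 (X 2) h := X0_dvd fun y d => by
    simp [ev_sub, hh, hα]
  set r : Sym k := (1 - X 2) * e0 w + X 2 * (e1 (aK a) - C α - e0 u)
  have hp : qK a * p0 + r * cc ∈ Pm k := (Pm k).add_mem (fun x y => by
    simp [qK_apply]; ring) (mul_cc_mem_Pm _)
  have hq : aK a - C α - r * g2 ∈ Pm k := fun x y => by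
    have h1 := congrArg (ev x y 0) hw
    rw [hu] at h1
    simp [hh] at h1
    simp [r]
    linear_combination h1
  refine ⟨α, ⟨_, hp⟩, ⟨_, hq⟩, Subtype.ext ?_⟩
  rw [Submodule.coe_add, Submodule.coe_add, i3, i4, coe_mulR, coe_mulR, Submodule.coe_smul,
    smul_eq_C_mul]
  change _ = C α * cc + ((qK a * p0 + r * cc) * g2 + (aK a - C α - r * g2) * cc)
  conv_lhs => rw [Km_eq a, ← qK_apply]
  rw [aK_apply]
  simp only [p0, g2, cc, k0]
  ring

/-- The value of a pair of cochains at a lift to `P²` does not depend on the lift, if the pair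
vanishes on the kernel of `P² → K`. -/
lemma lift_eval {ψ₁ ψ₂ : Wd (Pm k)} (h1 : IsMulti ψ₁) (h2 : IsMulti ψ₂)
    (h : pb j3 ψ₁ = pb j4 ψ₂) {p p' q q' : Pm k} (hpq : i3 p + i4 q = i3 p' + i4 q')
    (l : List (Pt (CQ k))) (m : k) :
    ψ₁ l (p, m) + ψ₂ l (q, m) = ψ₁ l (p', m) + ψ₂ l (q', m) := by
  obtain ⟨r, hr, hr'⟩ := exists_of_i3_add_i4 (p := p - p') (q := q - q') (by
    rw [map_sub, map_sub, sub_add_sub_comm, hpq, sub_self])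
  have h3 := congrFun (congrFun h l) (r, m)
  rw [pb_apply, pb_apply] at h3
  have h4 := (h1.last l m).add p' (p - p')
  have h5 := (h2.last l m).add q' (q - q')
  have h6 := (h1.last l m).smul (-1) (j3 r)
  rw [add_sub_cancel] at h4 h5
  rw [hr, ← neg_one_smul k, h6] at h4
  rw [hr'] at h5
  rw [h4, h5]
  change ψ₁ l (j3 r, m) = ψ₂ l (j4 r, m) at h3
  rw [h3]
  ring

/-- A cochain on `K` is determined by its pullbacks to `P`. -/
lemma Km_ext {n : ℕ} {φ : Wd (Km k)} (h : φ ∈ R _ n) (h1 : pb i3 φ = 0) (h2 : pb i4 φ = 0) :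
    φ = 0 := by
  refine eq_zero_of_mul_eq_zero h fun l b m => ?_
  have h3 := congrFun (congrFun h1 l) (l1 b, m)
  have h4 := congrFun (congrFun h2 l) (l2 b, m)
  rw [pb_apply] at h3 h4
  have h5 := (h.2.1.last l m).add (i3 (l1 b)) (i4 (l2 b))
  have h6 := (h.2.1.last l m).del b
  rw [lift_eq, h6] at h5
  simp only [Pi.zero_apply] at h3 h4
  simp only [h3, h4] at h5
  linear_combination -h5

/-- The functional `η` of a pair of cochains on `P`: its value at `(-c, p₀)` for `m = 0`. The image
of `(-c, p₀)` in `K` is a multiple of `∂`, so `η` vanishes on the pairs that come from `K`. -/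
noncomputable def etaF (ψ₁ ψ₂ : Wd (Pm k)) (l : List (Pt (CQ k))) : k :=
  ψ₂ l (p0' k, 0) - ψ₁ l (cP k, 0)

/-- A pair of cochains on `P` comes from a cochain on `K`, if it vanishes on the kernel of `P² → K`
and if `η` vanishes. The cochain is determined by `-m φ(a) = φ(∂ a)`, where `∂ a` lifts to `P²`; the
division by `m` requires the right hand side to vanish for `m = 0`, which `η = 0` ensures at the
generator `c` of the cokernel. -/
lemma exists_Km {n : ℕ} {ψ₁ ψ₂ : Wd (Pm k)} (h1 : ψ₁ ∈ R _ n) (h2 : ψ₂ ∈ R _ n)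
    (h : pb j3 ψ₁ = pb j4 ψ₂) (he : ∀ l, etaF ψ₁ ψ₂ l = 0) :
    ∃ φ ∈ R (Km k) n, pb i3 φ = ψ₁ ∧ pb i4 φ = ψ₂ := by
  set Φ : Wd (Km k) := pb l1 ψ₁ + pb l2 ψ₂ with hΦ
  have hΦR : Φ ∈ R (Km k) n := (R _ n).add_mem (pb_mem l1_dN h1) (pb_mem l2_dN h2)
  have hz1 : ∀ l m, ψ₁ l (0, m) = 0 := fun l m => by
    have := (h1.2.1.last l m).smul 0 0
    rwa [zero_smul, zero_mul] at this
  have hz2 : ∀ l m, ψ₂ l (0, m) = 0 := fun l m => by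
    have := (h2.2.1.last l m).smul 0 0
    rwa [zero_smul, zero_mul] at this
  have hi3 : ∀ l p m, Φ l (i3 p, m) = -m * ψ₁ l (p, m) := by
    intro l p m
    have h3 := lift_eval h1.2.1 h2.2.1 h (p := l1 (i3 p)) (q := l2 (i3 p)) (p' := dN _ p)
      (q' := 0) (by rw [lift_eq, map_zero, add_zero, i3, mulR_dN]) l m
    rw [hz2, add_zero, (h1.2.1.last l m).del p] at h3
    exact h3
  have hi4 : ∀ l p m, Φ l (i4 p, m) = -m * ψ₂ l (p, m) := by
    intro l p m
    have h3 := lift_eval h1.2.1 h2.2.1 h (p := l1 (i4 p)) (q := l2 (i4 p)) (p' := 0)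
      (q' := dN _ p) (by rw [lift_eq, map_zero, zero_add, i4, mulR_dN]) l m
    rw [hz1, zero_add, (h2.2.1.last l m).del p] at h3
    exact h3
  have hc : ∀ l, Φ l (cK k, 0) = 0 := by
    intro l
    -- The lift of `∂ c` is `(-c, p₀)` up to the kernel of `P² → K` and multiples of `∂`.
    set u : Pm k := ⟨X 2 * cc, mul_cc_mem_Pm _⟩
    set w : Pm k := ⟨X 2 * (1 - g2), fun x y => by simp⟩
    have h3 := lift_eval h1.2.1 h2.2.1 h (p := l1 (cK k)) (q := l2 (cK k))
      (p' := (-1 : k) • cP k + dN _ u) (q' := p0' k + dN _ w) (by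
        rw [lift_eq]
        refine Subtype.ext (sym_ext fun x y d => ?_)
        simp [i3, i4, cP, cK, p0', u, w]
        ring) l 0
    rw [(h1.2.1.last l 0).add, (h1.2.1.last l 0).smul, (h1.2.1.last l 0).del,
      (h2.2.1.last l 0).add, (h2.2.1.last l 0).del] at h3
    have h4 := he l
    rw [etaF] at h4
    refine h3.trans ?_
    linear_combination h4
  have h0 : ∀ l b, Φ l (b, 0) = 0 := by
    intro l b
    obtain ⟨α, p, q, rfl⟩ := exists_Km_eq b
    rw [(hΦR.2.1.last l 0).add, (hΦR.2.1.last l 0).smul, (hΦR.2.1.last l 0).add, hi3, hi4, hc]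
    simp
  obtain ⟨φ, hφ, hm⟩ := exists_div hΦR h0
  refine ⟨-φ, (R (Km k) n).neg_mem hφ, ?_, ?_⟩
  · refine sub_eq_zero.1 (eq_zero_of_mul_eq_zero (n := n) ((R (Pm k) n).sub_mem
      (pb_mem (fun a => mulR_dN _ _ a) ((R (Km k) n).neg_mem hφ)) h1) fun l b m => ?_)
    have := hm l (i3 b) m
    rw [hi3] at this
    simp only [Pi.sub_apply, pb_apply, Pi.neg_apply]
    linear_combination -this
  · refine sub_eq_zero.1 (eq_zero_of_mul_eq_zero (n := n) ((R (Pm k) n).sub_mem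
      (pb_mem (fun a => mulR_dN _ _ a) ((R (Km k) n).neg_mem hφ)) h2) fun l b m => ?_)
    have := hm l (i4 b) m
    rw [hi4] at this
    simp only [Pi.sub_apply, pb_apply, Pi.neg_apply]
    linear_combination -this

/-! #### Surjectivity onto the cochains of `CQ` -/

/-- The substitution `x ↦ 0`, `y ↦ y - x`, `Δ ↦ 0`, which preserves `∂`. -/
noncomputable def sh : Sym k →ₐ[k] Sym k := sub 0 (X 1 - X 0) 0

lemma exists_uQ : ∃ f : Sym k →ₗ[k] Sym k, ∀ s : Sym k, X 0 * f s = e0 s - sh s := by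
  refine exists_quot (e0.toLinearMap - sh.toLinearMap) _ (X_ne_zero (R := k) (0 : Fin 3))
    fun s => ?_
  exact X0_dvd fun y d => by simp [sh, ev_sub]

/-- The quotient of `s(x, y, 0) - s(0, y - x, 0)` by `x`. -/
noncomputable def uQ : Sym k →ₗ[k] Sym k := exists_uQ.choose

lemma X0_mul_uQ (s : Sym k) : X 0 * uQ s = e0 s - sh s := exists_uQ.choose_spec s

lemma ev_X0_mul_uQ (x y d : k) (s : Sym k) :
    x * ev x y d (uQ s) = ev x y 0 s - ev 0 (y - x) 0 s := by
  simpa [sh, ev_sub] using congrArg (ev x y d) (X0_mul_uQ s)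

lemma uQ_unique {s u : Sym k} (h : X 0 * u = e0 s - sh s) : uQ s = u :=
  mul_left_cancel₀ (X_ne_zero (R := k) (0 : Fin 3)) ((X0_mul_uQ s).trans h.symm)

lemma uQ_del (s : Sym k) : uQ (del * s) = del * uQ s := uQ_unique <| by
  have : sh (del : Sym k) = del := sym_ext fun x y d => by simp [sh, ev_sub]
  rw [map_mul, map_mul, e0_del, this]
  linear_combination del * X0_mul_uQ s

/-- A retraction of the space of all symbols onto `CQ` that commutes with `∂` and annihilates
`1`. -/
noncomputable def rho : Sym k →ₗ[k] Sym k :=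
  LinearMap.id - LinearMap.mulLeft k (1 - X 2) ∘ₗ e0.toLinearMap -
    LinearMap.mulLeft k (X 2) ∘ₗ e1.toLinearMap + LinearMap.mulRight k vS ∘ₗ e0.toLinearMap ∘ₗ uQ

lemma rho_apply (s : Sym k) : rho s = s - (1 - X 2) * e0 s - X 2 * e1 s + e0 (uQ s) * vS := rfl

lemma rho_mem (s : Sym k) : rho s ∈ CQ k := fun x y => by
  simp [rho_apply]
  ring

lemma rho_CQ (r : CQ k) : rho (r : Sym k) = r := by
  refine mul_left_cancel₀ (mul_ne_zero (X_ne_zero (R := k) (0 : Fin 3))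
    (X_ne_zero (R := k) (0 : Fin 3))) (sym_ext fun x y d => ?_)
  have h1 := ev_X0_mul_uQ x y 0 (r : Sym k)
  have h2 := ev_mul_qC r 0 (y - x) 0
  rw [zero_mul] at h2
  have h3 := r.2 x y
  rw [← h2, sub_zero] at h1
  simp only [rho_apply, map_add, map_sub, map_mul, map_one, ev_X0, ev_X2, ev_e0, ev_e1, ev_vS]
  linear_combination x * (x + d * (y - x)) * h1 + d * x * h3

lemma rho_one : rho (1 : Sym k) = 0 := by
  rw [rho_apply, uQ_unique (u := 0) (by simp)]
  simp

lemma rho_del (s : Sym k) : rho (del * s) = del * rho s := by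
  rw [rho_apply, rho_apply, uQ_del, map_mul, map_mul, map_mul, e0_del, e1_del]
  ring

/-- A retraction of `P` onto `CQ`, embedded by `a ↦ a c`. -/
noncomputable def rP : Pm k →ₗ[k] CQ k := (rho ∘ₗ tP).codRestrict (CQ k) fun p => rho_mem (tP p)

lemma coe_rP (p : Pm k) : (rP p : Sym k) = rho (tP p) := rfl

lemma rP_dN (p : Pm k) : rP (dN _ p) = dN _ (rP p) := Subtype.ext <| by
  rw [coe_rP, tP_dN, rho_del, coe_dN, coe_rP]

lemma rP_j3 (r : CQ k) : rP (j3 r) = r := Subtype.ext <| by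
  have : j3 r = ⟨(r : Sym k) * cc, mul_cc_mem_Pm _⟩ := rfl
  rw [coe_rP, this, tP_cc, rho_CQ]

lemma tP_cP : tP (cP k) = 1 := by
  have := tP_cc (1 : Sym k) (mul_cc_mem_Pm 1)
  simp only [one_mul] at this
  exact this

lemma rP_cP : rP (cP k) = 0 := Subtype.ext <| by
  rw [coe_rP, tP_cP, rho_one, Submodule.coe_zero]

/-- Every cochain on `CQ` lifts to a pair of cochains on `P` with `η = 0`. -/
lemma exists_lift_CQ {n : ℕ} {χ : Wd (CQ k)} (h : χ ∈ R _ n) :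
    ∃ ψ ∈ R (Pm k) n, pb j3 ψ = χ ∧ ∀ l, etaF ψ 0 l = 0 := by
  refine ⟨pb rP χ, pb_mem rP_dN h, funext₂ fun l y => by simp [rP_j3], fun l => ?_⟩
  have := (h.2.1.last l 0).smul 0 0
  rw [zero_smul, zero_mul] at this
  simp [etaF, rP_cP, this]

end Resolutions

/-! ### The cohomology of `CQ` and of `K` -/

section Relations

universe u

variable {k : Type u} [Field k]

/-- The quotient of cocycles by coboundaries. -/
abbrev HQ {V : Type*} [AddCommGroup V] [Module k V] (Z B : Submodule k V) := Z ⧸ B.submoduleOf Z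

/-- A linear relation between two spaces of cocycles, surjective on both sides and compatible with
coboundaries, identifies the quotients. -/
lemma rank_HQ_eq {X : Type*} {V V' : Type u} [AddCommGroup X] [Module k X] [AddCommGroup V]
    [Module k V] [AddCommGroup V'] [Module k V'] {Z B : Submodule k V} {Z' B' : Submodule k V'}
    (W : Submodule k X) (f : X →ₗ[k] V) (f' : X →ₗ[k] V') (hf : ∀ w ∈ W, f w ∈ Z)
    (hf' : ∀ w ∈ W, f' w ∈ Z') (hs : ∀ z ∈ Z, ∃ w ∈ W, f w = z) (hs' : ∀ z ∈ Z', ∃ w ∈ W, f' w = z)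
    (hB : ∀ w ∈ W, f w ∈ B ↔ f' w ∈ B') :
    Module.rank k (HQ Z B) = Module.rank k (HQ Z' B') := by
  set F : W →ₗ[k] HQ Z B := (B.submoduleOf Z).mkQ ∘ₗ f.restrict hf
  set F' : W →ₗ[k] HQ Z' B' := (B'.submoduleOf Z').mkQ ∘ₗ f'.restrict hf'
  have hF : Function.Surjective F := (Submodule.mkQ_surjective _).comp fun z => by
    obtain ⟨w, hw, h⟩ := hs z z.2
    exact ⟨⟨w, hw⟩, Subtype.ext h⟩
  have hF' : Function.Surjective F' := (Submodule.mkQ_surjective _).comp fun z => by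
    obtain ⟨w, hw, h⟩ := hs' z z.2
    exact ⟨⟨w, hw⟩, Subtype.ext h⟩
  have hk : LinearMap.ker F = LinearMap.ker F' := by
    ext w
    rw [LinearMap.mem_ker, LinearMap.mem_ker]
    refine (Submodule.Quotient.mk_eq_zero _).trans (Iff.trans ?_
      (Submodule.Quotient.mk_eq_zero _).symm)
    exact hB w w.2
  exact (((F.quotKerEquivOfSurjective hF).symm.trans (Submodule.quotEquivOfEq _ _ hk)).trans
    (F'.quotKerEquivOfSurjective hF')).rank_eq

lemma rank_HQ_top_bot {V : Type*} [AddCommGroup V] [Module k V] :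
    Module.rank k (HQ (⊤ : Submodule k V) ⊥) = Module.rank k V := by
  have h : (⊥ : Submodule k V).submoduleOf ⊤ = ⊥ := by
    rw [Submodule.submoduleOf, Submodule.comap_bot, Submodule.ker_subtype]
  exact ((Submodule.quotEquivOfEqBot _ h).trans Submodule.topEquiv).rank_eq

lemma rank_HQ_eq_zero {V : Type*} [AddCommGroup V] [Module k V] {Z B : Submodule k V}
    (h : Z ≤ B) : Module.rank k (HQ Z B) = 0 := by
  have h1 : B.submoduleOf Z = ⊤ := Submodule.submoduleOf_eq_top.2 h
  have : Subsingleton (HQ Z B) := Submodule.Quotient.subsingleton_iff.2 h1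
  exact rank_subsingleton' k _

end Relations

section Cohomology

variable {k : Type*} [Field k] [CharZero k]

section

variable (N : Submodule k (Sym k)) [IsMod N]

/-- The cocycles of degree `n`. -/
noncomputable def Zc (n : ℕ) : Submodule k (Wd N) := R N n ⊓ LinearMap.ker (dW N)

/-- The coboundaries of degree `n`, with no coboundaries in degree zero. -/
noncomputable def Bc : ℕ → Submodule k (Wd N)
  | 0 => ⊥
  | n + 1 => (R N n).map (dW N)

end

lemma mem_Zc {N : Submodule k (Sym k)} [IsMod N] {n : ℕ} {φ : Wd N} :
    φ ∈ Zc N n ↔ φ ∈ R N n ∧ dW N φ = 0 := Iff.rfl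

lemma mem_Bc_succ {N : Submodule k (Sym k)} [IsMod N] {n : ℕ} {φ : Wd N} :
    φ ∈ Bc N (n + 1) ↔ ∃ ψ ∈ R N n, dW N ψ = φ := Iff.rfl

lemma pb_comm_i1 (φ : Wd (CQ k)) : pb i1 (dW _ φ) = dW _ (pb i1 φ) :=
  pb_dW (fun l a b => mulR_actN isRight_g1 _ l a b) φ
lemma pb_comm_i2 (φ : Wd (CQ k)) : pb i2 (dW _ φ) = dW _ (pb i2 φ) :=
  pb_dW (fun l a b => mulR_actN isRight_cc _ l a b) φ
lemma pb_comm_j1 (φ : Wd (Pm k)) : pb j1 (dW _ φ) = dW _ (pb j1 φ) :=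
  pb_dW (fun l a b => mulR_actN isRight_cc _ l a b) φ
lemma pb_comm_j2 (φ : Wd (Pm k)) : pb j2 (dW _ φ) = dW _ (pb j2 φ) :=
  pb_dW (fun l a b => mulR_actN isRight_g1 _ l a b) φ
lemma pb_comm_i3 (φ : Wd (Km k)) : pb i3 (dW _ φ) = dW _ (pb i3 φ) :=
  pb_dW (fun l a b => mulR_actN isRight_g2 _ l a b) φ
lemma pb_comm_i4 (φ : Wd (Km k)) : pb i4 (dW _ φ) = dW _ (pb i4 φ) :=
  pb_dW (fun l a b => mulR_actN isRight_cc _ l a b) φ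
lemma pb_comm_j3 (φ : Wd (Pm k)) : pb j3 (dW _ φ) = dW _ (pb j3 φ) :=
  pb_dW (fun l a b => mulR_actN isRight_cc _ l a b) φ

lemma pb_i1_mem {n : ℕ} {φ : Wd (CQ k)} (h : φ ∈ R _ n) : pb i1 φ ∈ R _ n := pb_mem (mulR_dN _ _) h
lemma pb_i2_mem {n : ℕ} {φ : Wd (CQ k)} (h : φ ∈ R _ n) : pb i2 φ ∈ R _ n := pb_mem (mulR_dN _ _) h
lemma pb_j1_mem {n : ℕ} {φ : Wd (Pm k)} (h : φ ∈ R _ n) : pb j1 φ ∈ R _ n := pb_mem (mulR_dN _ _) h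
lemma pb_j2_mem {n : ℕ} {φ : Wd (Pm k)} (h : φ ∈ R _ n) : pb j2 φ ∈ R _ n := pb_mem (mulR_dN _ _) h
lemma pb_i3_mem {n : ℕ} {φ : Wd (Km k)} (h : φ ∈ R _ n) : pb i3 φ ∈ R _ n := pb_mem (mulR_dN _ _) h
lemma pb_i4_mem {n : ℕ} {φ : Wd (Km k)} (h : φ ∈ R _ n) : pb i4 φ ∈ R _ n := pb_mem (mulR_dN _ _) h

/-- The composition `K → P² → CQ` vanishes. -/
lemma pb_j1_i1 (φ : Wd (CQ k)) : pb j1 (pb i1 φ) = pb j2 (pb i2 φ) := by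
  have h : ∀ a : Km k, i1 (j1 a) = i2 (j2 a) := fun a =>
    Subtype.ext (by simp only [i1, i2, j1, j2, coe_mulR]; ring)
  funext l y
  simp only [pb_apply, h]

lemma aug_cons {N : Submodule k (Sym k)} (s : Pt (CQ k)) (l : List (Pt (CQ k))) (y : Pt N) :
    aug N (s :: l) y = 0 := rfl

lemma aug_nil {N : Submodule k (Sym k)} (y : Pt N) : aug N [] y = ev (-y.2) 0 0 (y.1 : Sym k) := rfl

lemma pb_i1_aug : pb i1 (aug (CQ k)) = aug (Pm k) := funext₂ fun l y => by
  cases l <;> simp [aug, i1]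
lemma pb_i2_aug : pb i2 (aug (CQ k)) = 0 := funext₂ fun l y => by
  cases l <;> simp [aug, i2]
lemma pb_j1_aug : pb j1 (aug (Pm k)) = 0 := funext₂ fun l y => by
  cases l <;> simp [aug, j1]
lemma pb_j2_aug : pb j2 (aug (Pm k)) = 0 := funext₂ fun l y => by
  cases l <;> simp [aug, j2, y.1.2 (-y.2) 0]
lemma pb_j3_aug : pb j3 (aug (Pm k)) = 0 := funext₂ fun l y => by
  cases l <;> simp [aug, j3]
lemma pb_j4_aug : pb j4 (aug (Pm k)) = 0 := funext₂ fun l y => by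
  cases l <;> simp [aug, j4]

/-! #### The connecting isomorphism of `K → P² → CQ` -/

variable (k) in
/-- The relation that defines the connecting map of `K → P² → CQ`: the triples of two cochains on
`P` and a cochain on `CQ` whose pullbacks are the differentials of the first two. -/
noncomputable def W1 (n : ℕ) : Submodule k (Wd (Pm k) × Wd (Pm k) × Wd (CQ k)) where
  carrier := {w | (w.1 ∈ R _ n ∧ w.2.1 ∈ R _ n ∧ w.2.2 ∈ R _ (n + 1)) ∧
    dW _ w.1 = pb i1 w.2.2 ∧ dW _ w.2.1 = pb i2 w.2.2}
  add_mem' h h' := ⟨⟨add_mem h.1.1 h'.1.1, add_mem h.1.2.1 h'.1.2.1, add_mem h.1.2.2 h'.1.2.2⟩,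
    by simp [h.2.1, h'.2.1], by simp [h.2.2, h'.2.2]⟩
  zero_mem' := ⟨⟨zero_mem _, zero_mem _, zero_mem _⟩, by simp, by simp⟩
  smul_mem' c w h := ⟨⟨Submodule.smul_mem _ c h.1.1, Submodule.smul_mem _ c h.1.2.1,
    Submodule.smul_mem _ c h.1.2.2⟩, by simp [h.2.1], by simp [h.2.2]⟩

/-- Since `P` is acyclic, the connecting map is an isomorphism. In degree zero it is so because the
invariant functionals of `P` vanish on `K`. -/
lemma rank_CQ_succ (n : ℕ) : Module.rank k (HQ (Zc (CQ k) (n + 1)) (Bc (CQ k) (n + 1))) =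
    Module.rank k (HQ (Zc (Km k) n) (Bc (Km k) n)) := by
  set f : Wd (Pm k) × Wd (Pm k) × Wd (CQ k) →ₗ[k] Wd (CQ k) :=
    LinearMap.snd _ _ _ ∘ₗ LinearMap.snd _ _ _ with hf
  set f' : Wd (Pm k) × Wd (Pm k) × Wd (CQ k) →ₗ[k] Wd (Km k) :=
    pb j1 ∘ₗ LinearMap.fst _ _ _ - pb j2 ∘ₗ LinearMap.fst _ _ _ ∘ₗ LinearMap.snd _ _ _ with hf'
  have hfa : ∀ w, f w = w.2.2 := fun w => rfl
  have hfa' : ∀ w, f' w = pb j1 w.1 - pb j2 w.2.1 := fun w => rfl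
  have hcoc : ∀ w ∈ W1 k n, dW _ w.2.2 = 0 := fun w hw =>
    CQ_ext (dW_mem hw.1.2.2).2.1 (by rw [pb_comm_i1, ← hw.2.1, dW_dW])
      (by rw [pb_comm_i2, ← hw.2.2, dW_dW])
  refine rank_HQ_eq (W1 k n) f f' (fun w hw => ⟨hw.1.2.2, hcoc w hw⟩) (fun w hw => ⟨?_, ?_⟩)
    (fun z hz => ?_) (fun z hz => ?_) (fun w hw => ⟨fun h => ?_, fun h => ?_⟩)
  · exact Submodule.sub_mem _ (pb_j1_mem hw.1.1) (pb_j2_mem hw.1.2.1)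
  · change dW _ (f' w) = 0
    rw [hfa', map_sub, ← pb_comm_j1, ← pb_comm_j2, hw.2.1, hw.2.2, pb_j1_i1,
      sub_self]
  · obtain ⟨ψ₁, h1, h1'⟩ := exists_of_cocycle_Pm (pb_i1_mem hz.1)
      (by rw [← pb_comm_i1, (mem_Zc.1 hz).2, map_zero])
    obtain ⟨ψ₂, h2, h2'⟩ := exists_of_cocycle_Pm (pb_i2_mem hz.1)
      (by rw [← pb_comm_i2, (mem_Zc.1 hz).2, map_zero])
    exact ⟨(ψ₁, ψ₂, z), ⟨⟨h1, h2, hz.1⟩, h1', h2'⟩, rfl⟩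
  · obtain ⟨ψ, h1, rfl⟩ := exists_lift_Km hz.1
    obtain ⟨φ, hφ, h2, h3⟩ := exists_CQ (dW_mem h1) (zero_mem (R (Pm k) (n + 1)))
      (by rw [pb_comm_j1, (mem_Zc.1 hz).2, map_zero])
    exact ⟨(ψ, 0, φ), ⟨⟨h1, zero_mem _, hφ⟩, h2.symm, by rw [h3, map_zero]⟩,
      by rw [hfa', map_zero, sub_zero]⟩
  · obtain ⟨φ, hφ, h1⟩ := mem_Bc_succ.1 h
    rw [hfa] at h1
    have hd1 : dW _ (w.1 - pb i1 φ) = 0 := by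
      rw [map_sub, ← pb_comm_i1, h1, hw.2.1, sub_self]
    have hd2 : dW _ (w.2.1 - pb i2 φ) = 0 := by
      rw [map_sub, ← pb_comm_i2, h1, hw.2.2, sub_self]
    have hR1 : w.1 - pb i1 φ ∈ R _ n := Submodule.sub_mem _ hw.1.1 (pb_i1_mem hφ)
    have hR2 : w.2.1 - pb i2 φ ∈ R _ n := Submodule.sub_mem _ hw.1.2.1 (pb_i2_mem hφ)
    have h2 : f' w = pb j1 (w.1 - pb i1 φ) - pb j2 (w.2.1 - pb i2 φ) := by
      rw [hfa', map_sub, map_sub, pb_j1_i1]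
      abel
    rw [h2]
    cases n with
    | zero =>
      obtain ⟨α, hα⟩ := eq_smul_aug_of_cocycle hR1 hd1
      obtain ⟨β, hβ⟩ := eq_smul_aug_of_cocycle hR2 hd2
      rw [hα, hβ, map_smul, map_smul, pb_j1_aug, pb_j2_aug]
      simp
    | succ n =>
      obtain ⟨ψ₁, h3, h3'⟩ := exists_of_cocycle_Pm hR1 hd1
      obtain ⟨ψ₂, h4, h4'⟩ := exists_of_cocycle_Pm hR2 hd2
      refine mem_Bc_succ.2 ⟨pb j1 ψ₁ - pb j2 ψ₂,
        Submodule.sub_mem _ (pb_j1_mem h3) (pb_j2_mem h4), ?_⟩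
      rw [← h3', ← h4', map_sub, pb_comm_j1, pb_comm_j2]
  · have key : ∀ ψ₁ ∈ R (Pm k) n, ∀ ψ₂ ∈ R (Pm k) n, dW _ ψ₁ = dW _ w.1 → dW _ ψ₂ = dW _ w.2.1 →
        pb j1 ψ₁ = pb j2 ψ₂ → f w ∈ Bc (CQ k) (n + 1) := by
      intro ψ₁ h1 ψ₂ h2 hd1 hd2 hj
      obtain ⟨φ, hφ, rfl, rfl⟩ := exists_CQ h1 h2 hj
      refine mem_Bc_succ.2 ⟨φ, hφ, sub_eq_zero.1 ?_⟩
      refine CQ_ext (Submodule.sub_mem _ (dW_mem hφ) hw.1.2.2).2.1 ?_ ?_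
      · rw [hfa, map_sub, pb_comm_i1, hd1, hw.2.1, sub_self]
      · rw [hfa, map_sub, pb_comm_i2, hd2, hw.2.2, sub_self]
    cases n with
    | zero => exact key _ hw.1.1 _ hw.1.2.1 rfl rfl (sub_eq_zero.1 h)
    | succ n =>
      obtain ⟨χ, hχ, h1⟩ := mem_Bc_succ.1 h
      obtain ⟨ψ, hψ, rfl⟩ := exists_lift_Km hχ
      refine key (w.1 - dW _ ψ) (Submodule.sub_mem _ hw.1.1 (dW_mem hψ)) w.2.1 hw.1.2.1
        (by rw [map_sub, dW_dW, sub_zero]) rfl ?_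
      rw [map_sub, pb_comm_j1, h1, hfa']
      abel

/-! #### Degree zero -/

/-- Every pair of cocycles of degree zero of `P` comes from `CQ`. -/
lemma exists_cocycle_CQ (α β : k) :
    ∃ φ ∈ R (CQ k) 0, pb i1 φ = α • aug _ ∧ pb i2 φ = β • aug _ :=
  exists_CQ (Submodule.smul_mem _ _ aug_mem) (Submodule.smul_mem _ _ aug_mem)
    (by rw [map_smul, map_smul, pb_j1_aug, pb_j2_aug, smul_zero, smul_zero])

/-- The cocycles of degree zero of `CQ` are the pairs of multiples of `aug` on `P`, and `aug` on
`CQ` is one such pair. -/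
lemma rank_CQ_zero :
    Module.rank k (HQ (Zc (CQ k) 0) (Submodule.span k {aug (CQ k)})) = 1 := by
  let W : Submodule k (Wd (CQ k) × (k × k)) :=
    { carrier := {w | w.1 ∈ R _ 0 ∧ pb i1 w.1 = w.2.1 • aug _ ∧ pb i2 w.1 = w.2.2 • aug _}
      add_mem' := fun h h' => ⟨add_mem h.1 h'.1, by simp [h.2.1, h'.2.1, add_smul],
        by simp [h.2.2, h'.2.2, add_smul]⟩
      zero_mem' := ⟨zero_mem _, by simp, by simp⟩
      smul_mem' := fun c w h => ⟨Submodule.smul_mem _ c h.1, by simp [h.2.1, mul_smul],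
        by simp [h.2.2, mul_smul]⟩ }
  rw [← Module.rank_self k, ← rank_HQ_top_bot (k := k) (V := k)]
  refine rank_HQ_eq W (LinearMap.fst _ _ _) (LinearMap.snd _ _ _ ∘ₗ LinearMap.snd _ _ _)
    (fun w hw => ⟨hw.1, ?_⟩) (fun _ _ => trivial) (fun z hz => ?_) (fun z _ => ?_)
    (fun w hw => ⟨fun h => ?_, fun h => ?_⟩)
  · exact CQ_ext (dW_mem hw.1).2.1
      (by rw [LinearMap.fst_apply, pb_comm_i1, hw.2.1, map_smul, dW_aug, smul_zero])
      (by rw [LinearMap.fst_apply, pb_comm_i2, hw.2.2, map_smul, dW_aug, smul_zero])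
  · obtain ⟨α, hα⟩ := eq_smul_aug_of_cocycle (pb_i1_mem hz.1)
      (by rw [← pb_comm_i1, (mem_Zc.1 hz).2, map_zero])
    obtain ⟨β, hβ⟩ := eq_smul_aug_of_cocycle (pb_i2_mem hz.1)
      (by rw [← pb_comm_i2, (mem_Zc.1 hz).2, map_zero])
    exact ⟨(z, α, β), ⟨hz.1, hα, hβ⟩, rfl⟩
  · obtain ⟨φ, h, h1, h2⟩ := exists_cocycle_CQ 0 z
    exact ⟨(φ, 0, z), ⟨h, h1, h2⟩, rfl⟩
  · obtain ⟨c, hc⟩ := Submodule.mem_span_singleton.1 h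
    have h1 := hw.2.2
    rw [LinearMap.fst_apply] at hc
    rw [← hc, map_smul, pb_i2_aug, smul_zero] at h1
    exact smul_aug_inj (h1.symm.trans (zero_smul k _).symm)
  · have h2 : w.2.2 = 0 := h
    refine Submodule.mem_span_singleton.2 ⟨w.2.1, (sub_eq_zero.1 ?_).symm⟩
    refine CQ_ext (Submodule.sub_mem _ hw.1 (Submodule.smul_mem _ w.2.1 aug_mem)).2.1 ?_ ?_
    · rw [LinearMap.fst_apply, map_sub, hw.2.1, map_smul, pb_i1_aug, sub_self]
    · rw [LinearMap.fst_apply, map_sub, hw.2.2, map_smul, pb_i2_aug, smul_zero, h2, zero_smul,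
        sub_self]

/-- The functional `η` vanishes on the invariant functionals. -/
lemma etaF_aug (α β : k) (l : List (Pt (CQ k))) :
    etaF (α • aug (Pm k)) (β • aug (Pm k)) l = 0 := by
  cases l <;> simp [etaF, aug, p0', cP]

/-- The cocycles of degree zero of `K` are the pairs of multiples of `aug` on `P`. -/
lemma rank_Km_zero : Module.rank k (HQ (Zc (Km k) 0) (Bc (Km k) 0)) = 2 := by
  let W : Submodule k (Wd (Km k) × (k × k)) :=
    { carrier := {w | w.1 ∈ R _ 0 ∧ pb i3 w.1 = w.2.1 • aug _ ∧ pb i4 w.1 = w.2.2 • aug _}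
      add_mem' := fun h h' => ⟨add_mem h.1 h'.1, by simp [h.2.1, h'.2.1, add_smul],
        by simp [h.2.2, h'.2.2, add_smul]⟩
      zero_mem' := ⟨zero_mem _, by simp, by simp⟩
      smul_mem' := fun c w h => ⟨Submodule.smul_mem _ c h.1, by simp [h.2.1, mul_smul],
        by simp [h.2.2, mul_smul]⟩ }
  have h2 : Module.rank k (k × k) = 2 := by
    rw [rank_prod', Module.rank_self, one_add_one_eq_two]
  rw [← h2, ← rank_HQ_top_bot (k := k) (V := k × k)]
  refine rank_HQ_eq W (LinearMap.fst _ _ _) (LinearMap.snd _ _ _)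
    (fun w hw => ⟨hw.1, ?_⟩) (fun _ _ => trivial) (fun z hz => ?_) (fun z _ => ?_)
    (fun w hw => ⟨fun h => ?_, fun h => ?_⟩)
  · exact Km_ext (dW_mem hw.1)
      (by rw [LinearMap.fst_apply, pb_comm_i3, hw.2.1, map_smul, dW_aug, smul_zero])
      (by rw [LinearMap.fst_apply, pb_comm_i4, hw.2.2, map_smul, dW_aug, smul_zero])
  · obtain ⟨α, hα⟩ := eq_smul_aug_of_cocycle (pb_i3_mem hz.1)
      (by rw [← pb_comm_i3, (mem_Zc.1 hz).2, map_zero])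
    obtain ⟨β, hβ⟩ := eq_smul_aug_of_cocycle (pb_i4_mem hz.1)
      (by rw [← pb_comm_i4, (mem_Zc.1 hz).2, map_zero])
    exact ⟨(z, α, β), ⟨hz.1, hα, hβ⟩, rfl⟩
  · obtain ⟨φ, h, h1, h2⟩ := exists_Km (Submodule.smul_mem _ z.1 aug_mem)
      (Submodule.smul_mem _ z.2 aug_mem)
      (by rw [map_smul, map_smul, pb_j3_aug, pb_j4_aug, smul_zero, smul_zero]) (etaF_aug z.1 z.2)
    exact ⟨(φ, z), ⟨h, h1, h2⟩, rfl⟩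
  · have h1 : w.1 = 0 := h
    have h2 := hw.2.1
    have h3 := hw.2.2
    rw [h1, map_zero] at h2 h3
    exact Prod.ext (smul_aug_inj (h2.symm.trans (zero_smul k _).symm))
      (smul_aug_inj (h3.symm.trans (zero_smul k _).symm))
  · have h1 : w.2 = 0 := h
    exact Km_ext hw.1 (by rw [LinearMap.fst_apply, hw.2.1, h1, Prod.fst_zero, zero_smul])
      (by rw [LinearMap.fst_apply, hw.2.2, h1, Prod.snd_zero, zero_smul])

/-! #### Positive degrees of `K` -/

/-- `η` vanishes on the pairs that come from `K`. -/
lemma etaF_pb {n : ℕ} {φ : Wd (Km k)} (h : φ ∈ R _ n) (l : List (Pt (CQ k))) :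
    etaF (pb i3 φ) (pb i4 φ) l = 0 := by
  have hl := h.2.1.last l 0
  have h1 : i4 (p0' k) = i3 (cP k) + dN _ (⟨(1 - MvPolynomial.X 2) * cc, mul_cc_mem_Km _⟩ : Km k) :=
    Subtype.ext (sym_ext fun x y d => by simp [i3, i4, p0', cP]; ring)
  have h2 := hl.add (i3 (cP k)) (dN _ (⟨(1 - MvPolynomial.X 2) * cc, mul_cc_mem_Km _⟩ : Km k))
  rw [← h1, hl.del] at h2
  rw [etaF, pb_apply, pb_apply]
  linear_combination h2

/-- The functional `η` of a pair as a function on words with a last entry in `CQ`. -/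
noncomputable def kap (ψ₁ ψ₂ : Wd (Pm k)) : Wd (CQ k) :=
  ap id (p0' k, 0) ψ₂ - ap id (cP k, 0) ψ₁

lemma kap_apply (ψ₁ ψ₂ : Wd (Pm k)) (l : List (Pt (CQ k))) (s : Pt (CQ k)) :
    kap ψ₁ ψ₂ l s = etaF ψ₁ ψ₂ (l ++ [s]) := rfl

lemma kap_mem {n : ℕ} {ψ₁ ψ₂ : Wd (Pm k)} (h1 : ψ₁ ∈ R _ (n + 1)) (h2 : ψ₂ ∈ R _ (n + 1)) :
    kap ψ₁ ψ₂ ∈ R (CQ k) n :=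
  Submodule.sub_mem _ (ap_mem (fun m _ hf => hf m) (fun _ hy => hy) h2)
    (ap_mem (fun m _ hf => hf m) (fun _ hy => hy) h1)

/-- The functional `η` of a differential. The product of `r ∈ CQ` with `(-c, p₀)` is the element
`(-r c, r g₂)` of the kernel of `P² → K`, up to symbols with the same values on the line
`y = x + m`; so the value of the pair on this kernel enters. -/
lemma kap_dW {n : ℕ} {ψ₁ ψ₂ : Wd (Pm k)} (h1 : ψ₁ ∈ R _ n) (h2 : ψ₂ ∈ R _ n)
    (l : List (Pt (CQ k))) (s : Pt (CQ k)) : kap (dW _ ψ₁) (dW _ ψ₂) l s =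
      dW _ (kap ψ₁ ψ₂) l s + (-1) ^ n * (pb j3 ψ₁ l s - pb j4 ψ₂ l s) +
        if l = [] then wt s 0 * etaF ψ₁ ψ₂ [] else 0 := by
  have hA := ap_dW (g := id) (y₀ := ((p0' k, 0) : Pt (Pm k))) (fun _ _ => rfl) (fun y => by simp)
    ψ₂ l s
  have hB := ap_dW (g := id) (y₀ := ((cP k, 0) : Pt (Pm k))) (fun _ _ => rfl) (fun y => by simp)
    ψ₁ l s
  have hp : ψ₂ l (sm (id s) (p0' k, 0)) = pb j4 ψ₂ l s := by
    change ψ₂ l (_, s.2 + 0) = ψ₂ l (j4 s.1, s.2)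
    rw [add_zero]
    refine (h2.2.1.last l s.2).congr fun x d => ?_
    simp [p0', j4]
    left
    ring
  have hc : ψ₁ l (sm (id s) (cP k, 0)) = pb j3 ψ₁ l s := by
    change ψ₁ l (_, s.2 + 0) = ψ₁ l (j3 s.1, s.2)
    rw [add_zero]
    refine (h1.2.1.last l s.2).congr fun x d => ?_
    simp [cP, j3]
  have hlen : ∀ ψ ∈ R (Pm k) n, ∀ y, (-1 : k) ^ l.length * ψ l y = (-1) ^ n * ψ l y := by
    intro ψ hψ y
    by_cases hl : l.length = n
    · rw [hl]
    · rw [hψ.1 l y hl, mul_zero, mul_zero]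
  have hl1 := hlen ψ₁ h1 (j3 s.1, s.2)
  have hl2 := hlen ψ₂ h2 (j4 s.1, s.2)
  rw [hp] at hA
  rw [hc] at hB
  have e : dW _ (kap ψ₁ ψ₂) l s =
      dW _ (ap id ((p0' k, 0) : Pt (Pm k)) ψ₂) l s -
        dW _ (ap id ((cP k, 0) : Pt (Pm k)) ψ₁) l s := by
    rw [kap, map_sub]; rfl
  rw [e, kap, Pi.sub_apply, Pi.sub_apply, hA, hB, etaF]
  simp only [pb_apply, id_eq] at hl1 hl2 ⊢
  rw [hl1, hl2]
  split_ifs <;> ring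

/-- The cohomology of `K` vanishes in degrees at least two. A cocycle is the differential of a pair
of cochains on `P`, which is corrected to come from `K`. -/
lemma Zc_Km_le (n : ℕ) : Zc (Km k) (n + 2) ≤ Bc (Km k) (n + 2) := by
  intro χ hχ
  obtain ⟨ψ₁, h1, h1'⟩ := exists_of_cocycle_Pm (n := n + 1) (pb_i3_mem hχ.1)
    (by rw [← pb_comm_i3, (mem_Zc.1 hχ).2, map_zero])
  obtain ⟨ψ₂, h2, h2'⟩ := exists_of_cocycle_Pm (n := n + 1) (pb_i4_mem hχ.1)
    (by rw [← pb_comm_i4, (mem_Zc.1 hχ).2, map_zero])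
  set ε : k := (-1) ^ n with hε
  have hεε : ε * ε = 1 := by rw [hε, ← mul_pow]; simp
  -- The differential of `(ω, 0)` has the same `η` as `(ψ₁, ψ₂)`, and the same values on the kernel
  -- of `P² → K`.
  obtain ⟨ω, hω, hj, he⟩ := exists_lift_CQ (Submodule.smul_mem _ ε (kap_mem h1 h2))
  have hη1 : ∀ l, etaF ψ₁ ψ₂ [] = 0 ∧ kap (dW _ ψ₁) (dW _ ψ₂) l = 0 := by
    intro l
    refine ⟨by rw [etaF, h1.1 [] _ (by simp), h2.1 [] _ (by simp), sub_zero], funext fun s => ?_⟩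
    rw [kap_apply, h1', h2', etaF_pb hχ.1]; rfl
  have hθ : ∀ l s, dW _ (kap ψ₁ ψ₂) l s = ε * (pb j3 ψ₁ l s - pb j4 ψ₂ l s) := by
    intro l s
    have h3 := kap_dW h1 h2 l s
    rw [(hη1 l).1, (hη1 l).2, mul_zero, ite_self, add_zero, pow_succ, ← hε, Pi.zero_apply] at h3
    linear_combination -h3
  have hκ0 : kap ω 0 = 0 := funext₂ fun l s => by rw [kap_apply, he]; rfl
  have hηω : ∀ l s, kap (dW _ ω) 0 l s = kap ψ₁ ψ₂ l s := by
    intro l s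
    have h3 := kap_dW hω (zero_mem (R (Pm k) n)) l s
    rw [map_zero, hκ0, he, map_zero, hj, map_zero, mul_zero, ite_self, ← hε] at h3
    rw [h3]
    simp only [Pi.zero_apply, Pi.smul_apply, smul_eq_mul]
    linear_combination (kap ψ₁ ψ₂ l s) * hεε
  have hR : ψ₁ - dW _ ω ∈ R (Pm k) (n + 1) := Submodule.sub_mem _ h1 (dW_mem hω)
  obtain ⟨φ, hφ, h3, h4⟩ := exists_Km hR h2 (by
      funext l s
      rw [map_sub, pb_comm_j3, hj, map_smul]
      have := hθ l s
      simp only [Pi.sub_apply, Pi.smul_apply, smul_eq_mul, this]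
      linear_combination -(pb j3 ψ₁ l s - pb j4 ψ₂ l s) * hεε) (by
      intro l
      rcases List.eq_nil_or_concat l with rfl | ⟨l, s, rfl⟩
      · rw [etaF, hR.1 [] _ (by simp), h2.1 [] _ (by simp), sub_zero]
      · have h3 := hηω l s
        rw [kap_apply, kap_apply] at h3
        simp only [etaF, List.concat_eq_append, Pi.sub_apply, Pi.zero_apply] at h3 ⊢
        linear_combination -h3)
  refine mem_Bc_succ.2 ⟨φ, hφ, sub_eq_zero.1 (Km_ext (Submodule.sub_mem _ (dW_mem hφ) hχ.1) ?_ ?_)⟩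
  · rw [map_sub, pb_comm_i3, h3, map_sub, dW_dW, sub_zero, h1', sub_self]
  · rw [map_sub, pb_comm_i4, h4, h2', sub_self]

/-- The map `tP` with values in the module of all symbols, whose functional `aug` is available. -/
noncomputable def tT : Pm k →ₗ[k] (⊤ : Submodule k (Sym k)) := tP.codRestrict ⊤ fun _ => trivial

/-- All values of `η` occur in degree zero, on pairs whose values on the kernel of `P² → K` are
multiples of `aug`. -/
lemma exists_eta (e : k) : ∃ ψ ∈ R (Pm k) 0, etaF ψ 0 [] = e ∧ pb j3 ψ = -e • aug (CQ k) := by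
  refine ⟨-e • pb tT (aug ⊤), Submodule.smul_mem _ _ (pb_mem (fun p => Subtype.ext (tP_dN p))
    aug_mem), ?_, ?_⟩
  · have : ((tT (cP k) : (⊤ : Submodule k (Sym k))) : Sym k) = 1 := tP_cP
    simp [etaF, aug, this]
  · funext l y
    have : ((tT (j3 y.1) : (⊤ : Submodule k (Sym k))) : Sym k) = y.1 := tP_cc _ _
    cases l <;> simp [aug, this]

/-- A cocycle of degree one is the differential of a pair of functionals on `P`; its class is given
by the value of `η` at this pair. -/
lemma rank_Km_one : Module.rank k (HQ (Zc (Km k) 1) (Bc (Km k) 1)) = 1 := by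
  let W : Submodule k (Wd (Pm k) × Wd (Pm k) × Wd (Km k)) :=
    { carrier := {w | (w.1 ∈ R _ 0 ∧ w.2.1 ∈ R _ 0 ∧ w.2.2 ∈ R _ 1) ∧
        dW _ w.1 = pb i3 w.2.2 ∧ dW _ w.2.1 = pb i4 w.2.2}
      add_mem' := fun h h' => ⟨⟨add_mem h.1.1 h'.1.1, add_mem h.1.2.1 h'.1.2.1,
        add_mem h.1.2.2 h'.1.2.2⟩, by simp [h.2.1, h'.2.1], by simp [h.2.2, h'.2.2]⟩
      zero_mem' := ⟨⟨zero_mem _, zero_mem _, zero_mem _⟩, by simp, by simp⟩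
      smul_mem' := fun c w h => ⟨⟨Submodule.smul_mem _ c h.1.1, Submodule.smul_mem _ c h.1.2.1,
        Submodule.smul_mem _ c h.1.2.2⟩, by simp [h.2.1], by simp [h.2.2]⟩ }
  let f' : Wd (Pm k) × Wd (Pm k) × Wd (Km k) →ₗ[k] k :=
    { toFun := fun w => etaF w.1 w.2.1 []
      map_add' := fun w w' => by simp only [etaF, Prod.fst_add, Prod.snd_add, Pi.add_apply]; ring
      map_smul' := fun c w => by
        simp only [etaF, Prod.smul_fst, Prod.smul_snd, Pi.smul_apply, smul_eq_mul,
          RingHom.id_apply]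
        ring }
  have hz : ∀ ψ₁ ∈ R (Pm k) 0, ∀ ψ₂ ∈ R (Pm k) 0, kap ψ₁ ψ₂ = 0 := fun ψ₁ h1 ψ₂ h2 =>
    funext₂ fun l s => by
      rw [kap_apply, etaF, h1.1 _ _ (by simp), h2.1 _ _ (by simp), sub_zero]; rfl
  rw [← Module.rank_self k, ← rank_HQ_top_bot (k := k) (V := k)]
  refine rank_HQ_eq W (LinearMap.snd _ _ _ ∘ₗ LinearMap.snd _ _ _) f'
    (fun w hw => ⟨hw.1.2.2, ?_⟩) (fun _ _ => trivial) (fun z hz => ?_) (fun e _ => ?_)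
    (fun w hw => ⟨fun h => ?_, fun h => ?_⟩)
  · exact Km_ext (dW_mem hw.1.2.2) (by
      change pb i3 (dW _ w.2.2) = 0
      rw [pb_comm_i3, ← hw.2.1, dW_dW]) (by
      change pb i4 (dW _ w.2.2) = 0
      rw [pb_comm_i4, ← hw.2.2, dW_dW])
  · obtain ⟨ψ₁, h1, h1'⟩ := exists_of_cocycle_Pm (pb_i3_mem hz.1)
      (by rw [← pb_comm_i3, (mem_Zc.1 hz).2, map_zero])
    obtain ⟨ψ₂, h2, h2'⟩ := exists_of_cocycle_Pm (pb_i4_mem hz.1)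
      (by rw [← pb_comm_i4, (mem_Zc.1 hz).2, map_zero])
    exact ⟨(ψ₁, ψ₂, z), ⟨⟨h1, h2, hz.1⟩, h1', h2'⟩, rfl⟩
  · obtain ⟨ψ, hψ, he, hj⟩ := exists_eta e
    obtain ⟨φ, hφ, h3, h4⟩ := exists_Km (dW_mem hψ) (zero_mem (R (Pm k) 1))
      (by rw [pb_comm_j3, hj, map_smul, dW_aug, smul_zero, map_zero]) (by
        intro l
        rcases List.eq_nil_or_concat l with rfl | ⟨l, s, rfl⟩
        · simp [etaF, dW_apply]
        · have h5 := kap_dW hψ (zero_mem (R (Pm k) 0)) l s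
          rw [map_zero, kap_apply, hz ψ hψ 0 (zero_mem _), map_zero, hj, he] at h5
          rw [List.concat_eq_append, h5]
          cases l with
          | nil => simp [aug, wt]; ring
          | cons s' l => simp [aug])
    exact ⟨(ψ, 0, φ), ⟨⟨hψ, zero_mem _, hφ⟩, h3.symm, by rw [h4, map_zero]⟩, he⟩
  · obtain ⟨φ, hφ, h1⟩ := mem_Bc_succ.1 h
    change dW _ φ = w.2.2 at h1
    obtain ⟨α, hα⟩ := eq_smul_aug_of_cocycle (Submodule.sub_mem _ hw.1.1 (pb_i3_mem hφ))
      (by rw [map_sub, ← pb_comm_i3, h1, hw.2.1, sub_self])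
    obtain ⟨β, hβ⟩ := eq_smul_aug_of_cocycle (Submodule.sub_mem _ hw.1.2.1 (pb_i4_mem hφ))
      (by rw [map_sub, ← pb_comm_i4, h1, hw.2.2, sub_self])
    have h2 := etaF_aug α β []
    have h3 := etaF_pb hφ []
    rw [← hα, ← hβ] at h2
    change etaF w.1 w.2.1 [] = 0
    simp only [etaF, Pi.sub_apply] at h2 h3 ⊢
    linear_combination h2 + h3
  · have h0 : etaF w.1 w.2.1 [] = 0 := h
    obtain ⟨φ, hφ, h3, h4⟩ := exists_Km hw.1.1 hw.1.2.1 (by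
      funext l s
      have h5 := kap_dW hw.1.1 hw.1.2.1 l s
      rw [hw.2.1, hw.2.2, kap_apply, etaF_pb hw.1.2.2, hz _ hw.1.1 _ hw.1.2.1, map_zero, h0,
        mul_zero, ite_self] at h5
      simp only [Pi.zero_apply, pow_zero] at h5
      linear_combination -h5) (by
      intro l
      cases l with
      | nil => exact h0
      | cons s l => rw [etaF, hw.1.1.1 _ _ (by simp), hw.1.2.1.1 _ _ (by simp), sub_zero])
    refine mem_Bc_succ.2 ⟨φ, hφ, sub_eq_zero.1 ?_⟩
    change dW _ φ - w.2.2 = 0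
    refine Km_ext (Submodule.sub_mem _ (dW_mem hφ) hw.1.2.2) ?_ ?_
    · rw [map_sub, pb_comm_i3, h3, hw.2.1, sub_self]
    · rw [map_sub, pb_comm_i4, h4, hw.2.2, sub_self]

end Cohomology

/-! ### Values of polynomials stored by their coefficients -/

section Values

variable {k : Type*} [Field k] {V W : Type*} [AddCommGroup V] [Module k V] [AddCommGroup W]
  [Module k W] {n : ℕ}

/-- The value at `l` of the polynomial with coefficients `u(m) / ∏ᵢ mᵢ!`. -/
noncomputable def gf (l : Fin n → k) (u : (Fin n → ℕ) → V) : V :=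
  ∑ᶠ m, (∏ i, l i ^ m i / ((m i).factorial : k)) • u m

lemma finite_smul {u : (Fin n → ℕ) → V} (hu : {m | u m ≠ 0}.Finite) (c : (Fin n → ℕ) → k) :
    (Function.support fun m => c m • u m).Finite :=
  hu.subset fun m hm h => hm (by simp [h])

lemma gf_add (l : Fin n → k) {u v : (Fin n → ℕ) → V} (hu : {m | u m ≠ 0}.Finite)
    (hv : {m | v m ≠ 0}.Finite) : gf l (u + v) = gf l u + gf l v := by
  simp only [gf, Pi.add_apply, smul_add]
  exact finsum_add_distrib (finite_smul hu _) (finite_smul hv _)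

lemma gf_map (l : Fin n → k) {u : (Fin n → ℕ) → V} (hu : {m | u m ≠ 0}.Finite) (T : V →ₗ[k] W) :
    gf l (fun m => T (u m)) = T (gf l u) := by
  have h := AddMonoidHom.map_finsum (T : V →+ W) (finite_smul hu
    fun m => ∏ i, l i ^ m i / ((m i).factorial : k))
  refine Eq.trans ?_ h.symm
  simp [gf]

lemma gf_zero (l : Fin n → k) : gf l (fun _ => (0 : V)) = 0 := by simp [gf]

lemma gf_sum {ι : Type*} (s : Finset ι) (l : Fin n → k) {u : ι → (Fin n → ℕ) → V}
    (hu : ∀ i, {m | u i m ≠ 0}.Finite) : gf l (fun m => ∑ i ∈ s, u i m) = ∑ i ∈ s, gf l (u i) := by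
  simp only [gf, Finset.smul_sum]
  exact finsum_sum_comm s _ fun i _ => finite_smul (hu i) _

lemma gf_nil (l : Fin 0 → k) (u : (Fin 0 → ℕ) → V) : gf l u = u ![] := by
  rw [gf, finsum_eq_single _ ![] fun m h => absurd (Subsingleton.elim _ _) h]
  simp

lemma finite_cons {u : (Fin (n + 1) → ℕ) → V} (hu : {m | u m ≠ 0}.Finite) (p : ℕ) :
    {m | u (Fin.cons p m) ≠ 0}.Finite :=
  hu.preimage (f := fun m => (Fin.cons p m : Fin (n + 1) → ℕ))
    (Fin.cons_right_injective (α := fun _ => ℕ) p).injOn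

lemma exists_bound {u : (Fin n → ℕ) → V} (hu : {m | u m ≠ 0}.Finite) :
    ∃ N, ∀ m i, N ≤ m i → u m = 0 := by
  obtain ⟨b, hb⟩ := hu.bddAbove
  refine ⟨∑ i, b i + 1, fun m i hm => ?_⟩
  by_contra h
  have h1 : m i ≤ b i := hb h i
  have h2 := Finset.single_le_sum (f := b) (fun _ _ => Nat.zero_le _) (Finset.mem_univ i)
  omega

/-- Evaluation of the variables one at a time. -/
lemma gf_succ (l : Fin (n + 1) → k) {u : (Fin (n + 1) → ℕ) → V} (hu : {m | u m ≠ 0}.Finite) :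
    gf l u = egf (l 0) fun p => gf (Fin.tail l) fun m => u (Fin.cons p m) := by
  have h1 := (finite_smul hu fun m => ∏ i, l i ^ m i / ((m i).factorial : k)).preimage
    (Fin.consEquiv fun _ : Fin (n + 1) => ℕ).injective.injOn
  have h2 := finsum_comp_equiv (Fin.consEquiv fun _ : Fin (n + 1) => ℕ)
    (f := fun m => (∏ i, l i ^ m i / ((m i).factorial : k)) • u m)
  refine h2.symm.trans ((finsum_curry _ h1).trans (finsum_congr fun p => ?_))
  refine Eq.trans ?_ (smul_finsum' _ (finite_smul (finite_cons hu p) _)).symm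
  refine finsum_congr fun m => ?_
  rw [smul_smul]
  simp [Fin.consEquiv, Fin.prod_univ_succ, Fin.tail]
  rw [mul_div_mul_comm]

/-! #### Coefficients of polynomials -/

open MvPolynomial

variable {S : Type*} [CommRing S] [Algebra k S]

variable (k n S) in
/-- The coefficients of a polynomial, multiplied by factorials. -/
noncomputable def fa : MvPolynomial (Fin n) S →ₗ[k] ((Fin n → ℕ) → S) :=
  LinearMap.pi fun m => ((∏ i, (m i).factorial : ℕ) : k) •
    (lcoeff S (Finsupp.equivFunOnFinite.symm m)).restrictScalars k

lemma fa_apply (Q : MvPolynomial (Fin n) S) (m : Fin n → ℕ) : fa k n S Q m =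
    ((∏ i, (m i).factorial : ℕ) : k) • coeff (Finsupp.equivFunOnFinite.symm m) Q := rfl

lemma fa_finite (Q : MvPolynomial (Fin n) S) : {m | fa k n S Q m ≠ 0}.Finite := by
  refine (Q.support.finite_toSet.image Finsupp.equivFunOnFinite).subset fun m hm => ?_
  refine ⟨Finsupp.equivFunOnFinite.symm m, ?_, by simp⟩
  rw [Finset.mem_coe, mem_support_iff]
  exact fun h => hm (by rw [fa_apply, h, smul_zero])

lemma prod_factorial_ne_zero [CharZero k] (m : Fin n → ℕ) :
    ((∏ i, (m i).factorial : ℕ) : k) ≠ 0 := by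
  rw [Nat.cast_ne_zero]
  exact Finset.prod_ne_zero_iff.2 fun i _ => Nat.factorial_ne_zero _

/-- Every finite family of coefficients belongs to a polynomial. -/
lemma exists_fa [CharZero k] {u : (Fin n → ℕ) → S} (hu : {m | u m ≠ 0}.Finite) :
    ∃ Q, fa k n S Q = u := by
  refine ⟨∑ m ∈ hu.toFinset, monomial (Finsupp.equivFunOnFinite.symm m)
    (((∏ i, (m i).factorial : ℕ) : k)⁻¹ • u m), funext fun m => ?_⟩
  rw [fa_apply, coeff_sum]
  simp only [coeff_monomial, EmbeddingLike.apply_eq_iff_eq]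
  rw [Finset.sum_ite_eq']
  split_ifs with h
  · rw [smul_smul, mul_inv_cancel₀ (prod_factorial_ne_zero m), one_smul]
  · rw [smul_zero]
    simpa using Eq.symm (by simpa using h)

/-- The coefficients of the product with a variable. -/
lemma fa_X_mul (i : Fin n) (Q : MvPolynomial (Fin n) S) (m : Fin n → ℕ) :
    fa k n S (X i * Q) m = m i • fa k n S Q (Function.update m i (m i - 1)) := by
  rw [fa_apply, fa_apply, coeff_X_mul']
  split_ifs with h <;> rw [Finsupp.mem_support_iff] at h
  · change m i ≠ 0 at h
    have h1 : Finsupp.equivFunOnFinite.symm m - Finsupp.single i 1 =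
        Finsupp.equivFunOnFinite.symm (Function.update m i (m i - 1)) := by
      ext j
      rcases eq_or_ne j i with rfl | hj
      · simp
      · simp [hj]
    have h2 : ∏ j, (m j).factorial =
        m i * ∏ j, (Function.update m i (m i - 1) j).factorial := by
      rw [← Finset.mul_prod_erase _ _ (Finset.mem_univ i),
        ← Finset.mul_prod_erase _ (fun j => (Function.update m i (m i - 1) j).factorial)
          (Finset.mem_univ i), Function.update_self, ← mul_assoc, Nat.mul_factorial_pred h]
      congr 1
      refine Finset.prod_congr rfl fun j hj => ?_
      rw [Function.update_of_ne (Finset.ne_of_mem_erase hj)]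
    rw [h1, h2, Nat.cast_mul, mul_smul, Nat.cast_smul_eq_nsmul]
  · rw [show m i = 0 from not_not.1 h, zero_smul, smul_zero]

lemma gf_fa [CharZero k] (l : Fin n → k) (Q : MvPolynomial (Fin n) S) :
    gf l (fa k n S Q) = eval (fun i => algebraMap k S (l i)) Q := by
  rw [eval_eq', gf]
  have h2 := finsum_comp_equiv (Finsupp.equivFunOnFinite : (Fin n →₀ ℕ) ≃ (Fin n → ℕ))
    (f := fun m => (∏ i, l i ^ m i / ((m i).factorial : k)) • fa k n S Q m)
  rw [← h2, finsum_eq_sum_of_support_subset (s := Q.support)]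
  · refine Finset.sum_congr rfl fun d _ => ?_
    have h3 : Finsupp.equivFunOnFinite.symm (Finsupp.equivFunOnFinite d) = d := by simp
    rw [fa_apply, h3, smul_smul, Finset.prod_div_distrib, ← Nat.cast_prod]
    simp only [Finsupp.equivFunOnFinite_apply]
    rw [div_mul_cancel₀ _ (prod_factorial_ne_zero _), Algebra.smul_def, map_prod, mul_comm]
    simp
  · intro d hd
    rw [Finset.mem_coe, mem_support_iff]
    intro h
    have h3 : Finsupp.equivFunOnFinite.symm (Finsupp.equivFunOnFinite d) = d := by simp
    exact hd (by simp only [fa_apply]; rw [h3, h, smul_zero, smul_zero])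

end Values

/-! ### The terms of the differential -/

section Contract

variable {α : Type*} {n : ℕ}

lemma contract_zero_cons (op : α → α → α) (a b : α) (w : Fin n → α) :
    Fin.contractNth (0 : Fin (n + 1)).castSucc op (Fin.cons a (Fin.cons b w) : Fin (n + 2) → α) =
      Fin.cons (op a b) w := by
  funext j
  refine Fin.cases ?_ (fun j => ?_) j
  · rw [ConformalHochschild.contract_self]; rfl
  · rw [ConformalHochschild.contract_of_gt _ (Fin.succ_pos j)]; rfl

lemma contract_succ_cons (op : α → α → α) (i : Fin n) (a : α) (w : Fin (n + 1) → α) :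
    Fin.contractNth i.succ.castSucc op (Fin.cons a w : Fin (n + 2) → α) =
      Fin.cons a (Fin.contractNth i.castSucc op w) := by
  funext j
  refine Fin.cases ?_ (fun j => ?_) j
  · rw [ConformalHochschild.contract_of_lt _ (Fin.succ_pos i)]; rfl
  · rcases lt_trichotomy j i with h | rfl | h
    · rw [ConformalHochschild.contract_of_lt _ (by simpa using h), Fin.cons_succ,
        ConformalHochschild.contract_of_lt _ h, ← Fin.succ_castSucc, Fin.cons_succ]
    · rw [ConformalHochschild.contract_self]
      exact (ConformalHochschild.contract_self op j w).symm
    · rw [ConformalHochschild.contract_of_gt _ (by simpa using h)]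
      exact (ConformalHochschild.contract_of_gt op h w).symm

lemma exists_cons (a : Fin (n + 1) → α) : ∃ x y, a = Fin.cons x y :=
  ⟨a 0, Fin.tail a, (Fin.cons_self_tail a).symm⟩

end Contract

section Terms

open ConformalHochschild

variable {k : Type*} [Field k] {V : Type*} [AddCommGroup V] [Module k V] {n : ℕ}

variable (k V n) in
/-- Multilinear maps with values in families of coefficients. -/
abbrev ML := MultilinearMap k (fun _ : Fin n => U3 k) ((Fin n → ℕ) → V)

/-- The condition that all values are polynomials, that is, have finitely many nonzero
coefficients. -/
def FS (φ : ML k V n) : Prop := ∀ a, {m | φ a m ≠ 0}.Finite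

/-- The value of a cochain at fixed values of the variables. -/
noncomputable def val (φ : ML k V n) (hφ : FS φ) (l : Fin n → k) :
    MultilinearMap k (fun _ : Fin n => U3 k) V where
  toFun a := gf l (φ a)
  map_update_add' a i x y := by rw [MultilinearMap.map_update_add, gf_add _ (hφ _) (hφ _)]
  map_update_smul' a i c x := by
    rw [MultilinearMap.map_update_smul]
    exact gf_map l (hφ _) (c • LinearMap.id)

lemma val_apply (φ : ML k V n) (hφ : FS φ) (l : Fin n → k) (a : Fin n → U3 k) :
    val φ hφ l a = gf l (φ a) := rfl

/-- A multilinear map as a function of its first entry. -/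
noncomputable def slotMap (f : MultilinearMap k (fun _ : Fin (n + 1) => U3 k) V)
    (a : Fin n → U3 k) : U3 k →ₗ[k] V where
  toFun x := f (Fin.cons x a)
  map_add' x y := f.cons_add a x y
  map_smul' c x := f.cons_smul a c x

lemma slotMap_apply (f : MultilinearMap k (fun _ : Fin (n + 1) => U3 k) V) (a : Fin n → U3 k)
    (x : U3 k) : slotMap f a x = f (Fin.cons x a) := rfl

/-- Fixing the first entry and the exponent of its variable. -/
noncomputable def fix (φ : ML k V (n + 1)) (a : U3 k) (p : ℕ) : ML k V n :=
  (LinearMap.funLeft k V fun m => Fin.cons p m).compMultilinearMap (φ.curryLeft a)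

lemma fix_apply (φ : ML k V (n + 1)) (a : U3 k) (p : ℕ) (b : Fin n → U3 k) (m : Fin n → ℕ) :
    fix φ a p b m = φ (Fin.cons a b) (Fin.cons p m) := rfl

lemma FS.fix {φ : ML k V (n + 1)} (hφ : FS φ) (a : U3 k) (p : ℕ) : FS (fix φ a p) :=
  fun b => finite_cons (hφ (Fin.cons a b)) p

lemma finite_of_bound {u : (Fin n → ℕ) → V} {N : ℕ} (h : ∀ m i, N ≤ m i → u m = 0) :
    {m | u m ≠ 0}.Finite := by
  refine (Set.finite_Iic fun _ : Fin n => N).subset fun m hm i => ?_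
  by_contra hi
  exact hm (h m i (not_le.1 hi).le)

/-- The expression of a term of the differential, with the conformal structure made explicit. -/
lemma dTerm_def (φ : ML k V n) (i : Fin n) (a : Fin (n + 1) → U3 k) (m : Fin (n + 1) → ℕ) :
    dTerm (k := k) φ i a m = ∑ s ∈ range (m i.castSucc + 1), (m i.castSucc).choose s •
      φ (Fin.contractNth i.castSucc (fun x y => U3.prod k s x y) a)
        (Fin.contractNth i.castSucc (fun p q => p + q - s) m) := rfl

lemma map_contract_eq_zero (φ : ML k V n) (i : Fin n) (a : Fin (n + 1) → U3 k)
    (op : U3 k → U3 k → U3 k) (h : op (a i.castSucc) (a i.succ) = 0) :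
    φ (Fin.contractNth i.castSucc op a) = 0 :=
  φ.map_coord_zero i (by rw [contract_self, h])

lemma dTerm_finite {φ : ML k V n} (hφ : FS φ) (i : Fin n) (a : Fin (n + 1) → U3 k) :
    {m | dTerm (k := k) φ i a m ≠ 0}.Finite := by
  obtain ⟨N, hN⟩ := U3.local_all k (a i.castSucc) (a i.succ)
  choose B hB using fun s =>
    exists_bound (hφ (Fin.contractNth i.castSucc (fun x y => U3.prod k s x y) a))
  refine finite_of_bound (N := N + ∑ s ∈ range N, B s) fun m j hj => ?_
  rw [dTerm_def]
  refine Finset.sum_eq_zero fun s hs => ?_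
  rw [Finset.mem_range] at hs
  rcases le_or_gt N s with h | h
  · rw [map_contract_eq_zero φ i a _ (hN s h), Pi.zero_apply, smul_zero]
  · have h1 := Finset.single_le_sum (f := B) (fun _ _ => Nat.zero_le _) (Finset.mem_range.2 h)
    have h2 : ∃ l, B s ≤ Fin.contractNth i.castSucc (fun p q => p + q - s) m l := by
      rcases index_cases i j with ⟨l, hl, rfl⟩ | rfl | rfl | ⟨l, hl, rfl⟩
      · exact ⟨l, by rw [contract_of_lt _ hl]; omega⟩
      · exact ⟨i, by rw [contract_self]; omega⟩
      · exact ⟨i, by rw [contract_self]; omega⟩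
      · exact ⟨l, by rw [contract_of_gt _ hl]; omega⟩
    obtain ⟨l, hl⟩ := h2
    rw [hB s _ l hl, smul_zero]

variable [CharZero k]

/-- The generating function of a term of the differential is obtained by the product of two
neighbours and the addition of their variables. -/
lemma gf_dTerm {φ : ML k V n} (hφ : FS φ) (i : Fin n) (a : Fin (n + 1) → U3 k)
    (l : Fin (n + 1) → k) : gf l (dTerm (k := k) φ i a) =
      gf (Fin.contractNth i.castSucc (fun x y => x + y) l) (φ (Fin.contractNth i.castSucc
        (fun x y => egf (l i.castSucc) fun s => U3.prod k s x y) a)) := by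
  induction n with
  | zero => exact i.elim0
  | succ n ih =>
    obtain ⟨a₀, a, rfl⟩ := exists_cons a
    obtain ⟨l₀, l, rfl⟩ := exists_cons l
    rw [gf_succ _ (dTerm_finite hφ i _), Fin.cons_zero, Fin.tail_cons]
    rcases Fin.eq_zero_or_eq_succ i with rfl | ⟨i, rfl⟩
    · obtain ⟨a₁, a, rfl⟩ := exists_cons a
      obtain ⟨l₁, l, rfl⟩ := exists_cons l
      rw [contract_zero_cons, contract_zero_cons,
        Fin.castSucc_zero, Fin.cons_zero]
      set G : ℕ → ℕ → V := fun r M =>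
        gf l fun m => φ (Fin.cons (U3.prod k r a₀ a₁) a) (Fin.cons M m) with hG
      obtain ⟨A, hA⟩ := U3.local_all k a₀ a₁
      choose B hB using fun r => exists_bound (hφ (Fin.cons (U3.prod k r a₀ a₁) a))
      have h1 : ∀ r M, A ≤ r → G r M = 0 := by
        intro r M hr
        simp only [hG, hA r hr]
        rw [φ.map_coord_zero 0 (by simp)]
        exact gf_zero l
      have h2 : ∀ r M, ∑ r ∈ range A, B r ≤ M → G r M = 0 := by
        intro r M hM
        rcases le_or_gt A r with h | h
        · exact h1 r M h
        · have h3 := Finset.single_le_sum (f := B) (fun _ _ => Nat.zero_le _)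
            (Finset.mem_range.2 h)
          have h4 : (fun m => φ (Fin.cons (U3.prod k r a₀ a₁) a) (Fin.cons M m)) = fun _ => 0 :=
            funext fun m => hB r _ 0 (by simpa using h3.trans hM)
          simp only [hG]
          rw [h4, gf_zero]
      have h5 := egf_map l₀ (U3.local_all k a₀ a₁) (slotMap (val φ hφ (Fin.cons (l₀ + l₁) l)) a)
      refine Eq.trans (congrArg _ (funext fun p => ?_))
        ((egf_binomial l₀ l₁ h1 h2).trans (Eq.trans (congrArg _ (funext fun r => ?_)) h5))
      · rw [gf_succ _ (finite_cons (dTerm_finite hφ 0 _) p), Fin.cons_zero, Fin.tail_cons]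
        refine congrArg _ (funext fun q => ?_)
        have h6 : (fun m => dTerm (k := k) φ 0 (Fin.cons a₀ (Fin.cons a₁ a))
            (Fin.cons p (Fin.cons q m))) = fun m => ∑ s ∈ range (p + 1),
              (p.choose s • LinearMap.id (R := k) (M := V))
                (φ (Fin.cons (U3.prod k s a₀ a₁) a) (Fin.cons (p + q - s) m)) := by
          funext m
          rw [dTerm_def]
          simp only [contract_zero_cons]
          rfl
        rw [h6, gf_sum]
        · refine Finset.sum_congr rfl fun s _ => ?_
          exact gf_map l (finite_cons (hφ _) _) _
        · exact fun s => (finite_cons (hφ (Fin.cons (U3.prod k s a₀ a₁) a)) (p + q - s)).subset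
            fun m hm h => hm (by rw [h, map_zero])
      · rw [slotMap_apply, val_apply, gf_succ _ (hφ _)]
        rfl
    · rw [contract_succ_cons, contract_succ_cons, gf_succ _ (hφ _)]
      refine congrArg _ (funext fun p => ?_)
      have h := ih (hφ.fix a₀ p) i a l
      simp only [Fin.tail_cons, ← Fin.succ_castSucc, Fin.cons_succ]
      refine Eq.trans ?_ (h.trans ?_)
      · refine congrArg _ (funext fun m => ?_)
        rw [dTerm_def, dTerm_def]
        simp only [contract_succ_cons, fix_apply]
        rfl
      · rfl

end Terms

/-! ### Functions of vectors and functions on words -/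

section Words

variable {k : Type*} [Field k]

lemma eq_const {α : Type*} (w : Fin (0 + 1) → α) : w = fun _ => w 0 :=
  funext fun i => congrArg w (Fin.fin_one_eq_zero i)

/-- Functions of `n + 1` points of `CQ`. -/
abbrev Vf (k : Type*) [Field k] (n : ℕ) := (Fin (n + 1) → Pt (CQ k)) → k

/-- A function of `n + 1` points as a function on words, supported on words of length `n`. -/
noncomputable def toWd : ∀ n, Vf k n → Wd (CQ k)
  | 0, T, [], y => T fun _ => y
  | 0, _, _ :: _, _ => 0
  | _ + 1, _, [], _ => 0
  | n + 1, T, s :: l, y => toWd n (fun w => T (Fin.cons s w)) l y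

/-- The restriction of a function on words to words of length `n`. -/
noncomputable def ofWd : ∀ n, Wd (CQ k) → Vf k n
  | 0, φ, w => φ [] (w 0)
  | n + 1, φ, w => ofWd n (fun l => φ (w 0 :: l)) (Fin.tail w)

lemma toWd_cons (n : ℕ) (T : Vf k (n + 1)) (s : Pt (CQ k)) (l : List (Pt (CQ k)))
    (y : Pt (CQ k)) : toWd (n + 1) T (s :: l) y = toWd n (fun w => T (Fin.cons s w)) l y := rfl

lemma ofWd_succ (n : ℕ) (φ : Wd (CQ k)) (w : Fin (n + 2) → Pt (CQ k)) :
    ofWd (n + 1) φ w = ofWd n (fun l => φ (w 0 :: l)) (Fin.tail w) := rfl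

lemma toWd_ofWd {n : ℕ} {φ : Wd (CQ k)} (h : ∀ l y, l.length ≠ n → φ l y = 0) :
    toWd n (ofWd n φ) = φ := by
  induction n generalizing φ with
  | zero =>
    funext l y
    cases l with
    | nil => rfl
    | cons s l => exact (h _ _ (by simp)).symm
  | succ n ih =>
    funext l y
    cases l with
    | nil => exact (h _ _ (by simp)).symm
    | cons s l =>
      have h1 := ih (φ := fun l => φ (s :: l)) fun l y hl => h _ _ (by simpa using hl)
      exact congrFun₂ h1 l y

lemma ofWd_toWd (n : ℕ) (T : Vf k n) : ofWd n (toWd n T) = T := by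
  induction n with
  | zero =>
    funext w
    exact congrArg T (eq_const w).symm
  | succ n ih =>
    funext w
    refine (congrFun (ih fun w' => T (Fin.cons (w 0) w')) (Fin.tail w)).trans ?_
    rw [Fin.cons_self_tail]

/-- A function on words obtained from a function of vectors either vanishes at a word, or is the
value at a vector. -/
lemma toWd_cases (n : ℕ) (l : List (Pt (CQ k))) (y : Pt (CQ k)) :
    (∀ T : Vf k n, toWd n T l y = 0) ∨
      l.length = n ∧ ∃ w, ∑ i, (w i).2 = deg l y ∧ ∀ T : Vf k n, toWd n T l y = T w := by
  induction n generalizing l with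
  | zero =>
    cases l with
    | nil => exact Or.inr ⟨rfl, fun _ => y, by simp, fun T => rfl⟩
    | cons s l => exact Or.inl fun T => rfl
  | succ n ih =>
    cases l with
    | nil => exact Or.inl fun T => rfl
    | cons s l =>
      rcases ih l with h | ⟨hl, w, hw, h⟩
      · exact Or.inl fun T => h _
      · exact Or.inr ⟨by simp [hl], Fin.cons s w, by simp [Fin.sum_univ_succ, hw], fun T => h _⟩

lemma ofWd_eq (n : ℕ) (w : Fin (n + 1) → Pt (CQ k)) : ∃ l y, ∀ φ, ofWd n φ w = φ l y := by
  induction n with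
  | zero => exact ⟨[], w 0, fun φ => rfl⟩
  | succ n ih =>
    obtain ⟨l, y, h⟩ := ih (Fin.tail w)
    exact ⟨w 0 :: l, y, fun φ => h _⟩

lemma toWd_supp (n : ℕ) (T : Vf k n) (l : List (Pt (CQ k))) (y : Pt (CQ k)) (hl : l.length ≠ n) :
    toWd n T l y = 0 := by
  rcases toWd_cases n l y with h | ⟨h, -⟩
  · exact h T
  · exact absurd h hl

lemma toWd_sub (n : ℕ) (T T' : Vf k n) : toWd n (T - T') = toWd n T - toWd n T' := by
  funext l y
  rcases toWd_cases n l y with h | ⟨-, w, -, h⟩ <;> simp [h]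

lemma toWd_add (n : ℕ) (T T' : Vf k n) : toWd n (T + T') = toWd n T + toWd n T' := by
  funext l y
  rcases toWd_cases n l y with h | ⟨-, w, -, h⟩ <;> simp [h]

lemma toWd_smul (n : ℕ) (c : k) (T : Vf k n) : toWd n (c • T) = c • toWd n T := by
  funext l y
  rcases toWd_cases n l y with h | ⟨-, w, -, h⟩ <;> simp [h]

lemma toWd_eq_zero_iff {n : ℕ} {T : Vf k n} : toWd n T = 0 ↔ T = 0 := by
  constructor
  · intro h
    have h1 := ofWd_toWd n T
    rw [h] at h1
    have h2 := ofWd_toWd n (0 : Vf k n)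
    have h3 : toWd n (0 : Vf k n) = 0 := by simpa using toWd_smul n 0 (0 : Vf k n)
    rw [h3] at h2
    rw [← h1, h2]
  · rintro rfl
    simpa using toWd_smul n 0 (0 : Vf k n)

/-! #### The differential -/

/-- The recursively defined map `E` is the alternating sum over the contractions. -/
lemma E_toWd (n : ℕ) (T : Vf k n) : E (CQ k) (toWd n T) = toWd (n + 1) fun w =>
    ∑ i : Fin (n + 1), (-1) ^ (i : ℕ) * T (Fin.contractNth i.castSucc sm w) := by
  induction n with
  | zero =>
    funext l y
    rcases l with _ | ⟨s, _ | ⟨s', l⟩⟩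
    · rfl
    · rw [E_cons, E_nil, sub_zero, toWd_cons]
      simp only [hd, toWd]
      rw [show (fun _ => y : Fin (0 + 1) → Pt (CQ k)) = Fin.cons y Fin.elim0 from
        (eq_const (Fin.cons y Fin.elim0 : Fin (0 + 1) → Pt (CQ k))).symm, Fin.sum_univ_succ,
        contract_zero_cons]
      simp only [Fin.val_zero, pow_zero, one_mul, Finset.univ_eq_empty, Finset.sum_empty, add_zero]
      exact congrArg T (eq_const (Fin.cons (sm s y) Fin.elim0 : Fin (0 + 1) → Pt (CQ k))).symm
    · have h : (fun l' => toWd 0 T (s :: l')) = 0 := rfl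
      rw [E_cons, h, map_zero]
      simp [hd, toWd]
  | succ n ih =>
    funext l y
    rcases l with _ | ⟨s, _ | ⟨s', l⟩⟩
    · rfl
    · simp [E_cons, hd, toWd]
    · have h : (fun l' => toWd (n + 1) T (s :: l')) = toWd n fun w => T (Fin.cons s w) := rfl
      rw [E_cons, h, ih, toWd_cons, toWd_cons, toWd_cons]
      simp only [hd, toWd_cons]
      refine (congrFun₂ (toWd_sub n _ _) l y).symm.trans ?_
      congr 1
      funext w
      rw [Fin.sum_univ_succ, contract_zero_cons, Pi.sub_apply, sub_eq_add_neg,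
        ← Finset.sum_neg_distrib]
      congr 1
      · simp
      · refine Finset.sum_congr rfl fun i _ => ?_
        rw [contract_succ_cons, Fin.val_succ, pow_succ]
        ring

lemma W_toWd (n : ℕ) (T : Vf k n) : W (CQ k) (toWd n T) = toWd (n + 1) fun w =>
    wt (w 0) (∑ i, (Fin.tail w i).2) * T (Fin.tail w) := by
  funext l y
  cases l with
  | nil => rfl
  | cons s l =>
    rw [W_cons, toWd_cons]
    rcases toWd_cases n l y with h | ⟨-, w, hw, h⟩
    · rw [h, h, mul_zero]
    · rw [h, h, Fin.cons_zero, Fin.tail_cons, hw]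

lemma dW_toWd (n : ℕ) (T : Vf k n) : dW (CQ k) (toWd n T) = toWd (n + 1) fun w =>
    wt (w 0) (∑ i, (Fin.tail w i).2) * T (Fin.tail w) -
      ∑ i : Fin (n + 1), (-1) ^ (i : ℕ) * T (Fin.contractNth i.castSucc sm w) := by
  rw [dW, LinearMap.sub_apply, E_toWd, W_toWd]
  exact (toWd_sub _ _ _).symm

/-! #### Antilinearity and polynomial dependence -/

/-- Antilinearity in all entries, for functions of vectors. -/
def SlotLin {n : ℕ} (T : Vf k n) : Prop :=
  ∀ w i, IsLin (CQ k) (w i).2 fun a => T (Function.update w i (a, (w i).2))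

lemma SlotLin.cons {n : ℕ} {T : Vf k (n + 1)} (h : SlotLin T) (s : Pt (CQ k)) :
    SlotLin fun w => T (Fin.cons s w) := fun w i => by
  simpa [Fin.cons_update] using h (Fin.cons s w) i.succ

lemma SlotLin.toWd {n : ℕ} {T : Vf k n} (h : SlotLin T) : IsMulti (toWd n T) where
  slot l₁ l₂ l y := by
    induction n generalizing l₁ with
    | zero => cases l₁ <;> exact isLin_zero l
    | succ n ih =>
      cases l₁ with
      | nil =>
        simp only [List.nil_append, toWd_cons]
        rcases toWd_cases n l₂ y with h' | ⟨-, w, -, h'⟩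
        · simp only [h']
          exact isLin_zero l
        · simp only [h']
          simpa using h (Fin.cons (0, l) w) 0
      | cons s l₁ => exact ih (h.cons s) l₁
  last l m := by
    induction n generalizing l with
    | zero =>
      cases l with
      | nil =>
        have h1 := h (fun _ => (0, m)) 0
        simp only [eq_const (Function.update _ _ _), Function.update_self] at h1
        exact h1
      | cons s l => exact isLin_zero m
    | succ n ih =>
      cases l with
      | nil => exact isLin_zero m
      | cons s l => exact ih (h.cons s) l

lemma SlotLin.ofWd {φ : Wd (CQ k)} (h : IsMulti φ) (n : ℕ) : SlotLin (ofWd n φ) := by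
  intro w i
  induction n generalizing φ with
  | zero =>
    rw [Fin.fin_one_eq_zero i]
    simpa [VirHoch.ofWd] using h.last [] (w 0).2
  | succ n ih =>
    refine Fin.cases ?_ (fun i => ?_) i
    · simp only [ofWd_succ, Function.update_self, ConformalHochschild.tail_update_zero]
      obtain ⟨l, y, hl⟩ := ofWd_eq n (Fin.tail w)
      simp only [hl]
      exact h.slot [] l (w 0).2 y
    · simp only [ofWd_succ, ConformalHochschild.tail_update_succ,
        Function.update_of_ne (Fin.succ_ne_zero i).symm]
      exact ih (h.cons (w 0)) (Fin.tail w) i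

/-- Polynomial dependence on the variables, for families of functions of vectors. -/
def VPoly {n : ℕ} (T : (ℕ → k) → Vf k n) : Prop :=
  ∀ w : Fin (n + 1) → (ℕ → k) → Pt (CQ k), (∀ i, FamPt (CQ k) (w i)) →
    (fun t => T t fun i => w i t) ∈ PF k

lemma VPoly.toWd {n : ℕ} {T : (ℕ → k) → Vf k n} (h : VPoly T) : IsPoly fun t => toWd n (T t) := by
  intro l y hl hy
  induction n generalizing l with
  | zero =>
    cases l with
    | nil => exact h (fun _ => y) fun _ => hy
    | cons s l => exact const_mem_PF 0
  | succ n ih =>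
    cases l with
    | nil => exact const_mem_PF 0
    | cons s l =>
      refine ih (T := fun t w => T t (Fin.cons (s t) w)) (fun w hw => ?_) l
        fun s' hs' => hl s' (by simp [hs'])
      have h1 := h (Fin.cons s w) (Fin.cases (hl s (by simp)) hw)
      convert h1 using 3
      funext i
      refine Fin.cases ?_ (fun i => ?_) i <;> rfl

lemma VPoly.ofWd {Φ : (ℕ → k) → Wd (CQ k)} (h : IsPoly Φ) (n : ℕ) :
    VPoly fun t => ofWd n (Φ t) := by
  intro w hw
  induction n generalizing Φ with
  | zero => exact h [] (w 0) (by simp) (hw 0)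
  | succ n ih => exact ih (h.cons (hw 0)) (Fin.tail w) fun i => hw i.succ

end Words

/-! ### Cochains of `U(3)` as functions of points -/

section Values

variable {k : Type*} [Field k] [CharZero k] {V : Type*} [AddCommGroup V] [Module k V] {n : ℕ}

/-- A family of coefficients is determined by the values of its polynomial. -/
lemma gf_ext {u v : (Fin n → ℕ) → V} (hu : {m | u m ≠ 0}.Finite) (hv : {m | v m ≠ 0}.Finite)
    (h : ∀ l : Fin n → k, gf l u = gf l v) : u = v := by
  funext m
  refine sub_eq_zero.1 ((Module.forall_dual_apply_eq_zero_iff k _).1 fun f => ?_)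
  have hf : ∀ {w : (Fin n → ℕ) → V}, {m | w m ≠ 0}.Finite → {m | f (w m) ≠ 0}.Finite :=
    fun hw => hw.subset fun m hm h => hm (by rw [h, map_zero])
  obtain ⟨P, hP⟩ := exists_fa (k := k) (hf hu)
  obtain ⟨Q, hQ⟩ := exists_fa (k := k) (hf hv)
  have h1 : P = Q := MvPolynomial.funext fun l => by
    have h2 := gf_fa l P
    have h3 := gf_fa l Q
    rw [hP, gf_map l hu, h] at h2
    rw [hQ, gf_map l hv] at h3
    exact h2.symm.trans h3
  rw [map_sub, sub_eq_zero]
  exact congrFun (hP.symm.trans ((congrArg _ h1).trans hQ)) m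

omit [CharZero k] in
lemma gf_smul (l : Fin n → k) {u : (Fin n → ℕ) → V} (hu : {m | u m ≠ 0}.Finite) (c : k) :
    gf l (c • u) = c • gf l u := gf_map l hu (c • LinearMap.id)

omit [CharZero k] in
lemma finite_deriv {u : (Fin n → ℕ) → V} (hu : {m | u m ≠ 0}.Finite) (i : Fin n) :
    {m | m i • u (Function.update m i (m i - 1)) ≠ 0}.Finite := by
  obtain ⟨N, hN⟩ := exists_bound hu
  refine finite_of_bound (N := N + 1) fun m j hj => ?_
  rw [hN _ j, smul_zero]
  rcases eq_or_ne j i with rfl | h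
  · rw [Function.update_self]; omega
  · rw [Function.update_of_ne h]; omega

/-- The shift in the `i`-th exponent multiplies the value by the `i`-th variable. -/
lemma gf_deriv {u : (Fin n → ℕ) → V} (hu : {m | u m ≠ 0}.Finite) (i : Fin n) (l : Fin n → k) :
    gf l (fun m => m i • u (Function.update m i (m i - 1))) = l i • gf l u := by
  refine sub_eq_zero.1 ((Module.forall_dual_apply_eq_zero_iff k _).1 fun f => ?_)
  have hf : {m | f (u m) ≠ 0}.Finite := hu.subset fun m hm h => hm (by rw [h, map_zero])
  obtain ⟨P, hP⟩ := exists_fa (k := k) hf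
  have h1 := gf_fa l P
  have h2 := gf_fa l (MvPolynomial.X i * P)
  rw [hP, gf_map l hu] at h1
  have h3 : fa k n k (MvPolynomial.X i * P) =
      fun m => f (m i • u (Function.update m i (m i - 1))) := by
    funext m
    rw [fa_X_mul, hP, map_nsmul]
  rw [h3, gf_map l (finite_deriv hu i)] at h2
  rw [map_sub, h2, map_smul, h1]
  simp

end Values

section Cochains

open ConformalHochschild

variable {k : Type*} [Field k] {n : ℕ}

variable (k) in
/-- The module `M_(0,0)`. -/
abbrev M0 := VirModule k 0 0

variable [CharZero k]

/-- A family of polynomials in the variables that is antilinear in all entries comes from a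
cochain. -/
lemma exists_cochain (F : (Fin n → U3 k) → (Fin n → k) → M0 k)
    (hF : ∀ a, ∃ u : (Fin n → ℕ) → M0 k, {m | u m ≠ 0}.Finite ∧ ∀ l, gf l u = F a l)
    (hadd : ∀ a i x y l, F (Function.update a i (x + y)) l =
      F (Function.update a i x) l + F (Function.update a i y) l)
    (hsmul : ∀ a i (c : k) x l, F (Function.update a i (c • x)) l =
      c • F (Function.update a i x) l)
    (hD : ∀ a i l, F (Function.update a i (U3.D k (a i))) l = -(l i • F a l)) :
    ∃ φ : BasicCochain k (U3 k) (M0 k) n, ∀ a l, gf l (φ.1 a) = F a l := by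
  choose u hu huF using hF
  refine ⟨⟨{ toFun := u, map_update_add' := ?_, map_update_smul' := ?_ }, hu, ?_⟩, huF⟩
  · intro inst a i x y
    obtain rfl : inst = instDecidableEqFin n := Subsingleton.elim _ _
    refine gf_ext (k := k) (hu _) (((hu (Function.update a i x)).union
      (hu (Function.update a i y))).subset fun m hm => ?_) fun l => ?_
    · by_contra h
      simp only [Set.mem_union, not_or] at h
      exact hm (by rw [Pi.add_apply, show u _ m = 0 from not_not.1 h.1,
        show u _ m = 0 from not_not.1 h.2, add_zero])
    · rw [gf_add _ (hu _) (hu _), huF, huF, huF, hadd]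
  · intro inst a i c x
    obtain rfl : inst = instDecidableEqFin n := Subsingleton.elim _ _
    refine gf_ext (k := k) (hu _)
      ((hu (Function.update a i x)).subset fun m hm h => hm ?_) fun l => ?_
    · rw [Pi.smul_apply, show u _ m = 0 from h, smul_zero]
    · rw [gf_smul _ (hu _), huF, huF, hsmul]
  · intro a i m
    refine congrFun (gf_ext (k := k) (hu _) ((finite_deriv (hu a) i).subset fun m hm h => hm ?_)
      fun l => ?_ : u _ = fun m => -(m i • u a (Function.update m i (m i - 1)))) m
    · rw [h, neg_zero]
    · refine ((huF _ l).trans ?_).trans (gf_map l (finite_deriv (hu a) i) (-LinearMap.id)).symm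
      rw [gf_deriv (hu a), huF]
      exact hD a i l

/-- The function of points defined by a cochain: the value of the cochain, with the variable of the
module at minus the sum of the variables. -/
noncomputable def Tv (φ : ML k (M0 k) (n + 1)) : Vf k n := fun w =>
  evalM (-∑ i, (w i).2) (gf (fun i => (w i).2) (φ fun i => symInv (w i).1))

lemma symInv_dN (a : CQ k) : symInv (dN (CQ k) a) = U3.D k (symInv a) := by
  refine symEquiv.injective (Subtype.ext ?_)
  rw [coe_symEquiv, coe_symEquiv, sym_symInv, sym_D, sym_symInv]
  rfl

lemma symInv_actN (l : k) (a b : CQ k) :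
    symInv (actN (CQ k) l a b) = egf l fun s => U3.prod k s (symInv a) (symInv b) := by
  refine symEquiv.injective (Subtype.ext ?_)
  rw [coe_symEquiv, coe_symEquiv, sym_symInv, ← lam_sym, sym_symInv, sym_symInv]
  rfl

lemma Tv_update (φ : ML k (M0 k) (n + 1)) (w : Fin (n + 1) → Pt (CQ k)) (i : Fin (n + 1))
    (a : CQ k) : Tv φ (Function.update w i (a, (w i).2)) =
      evalM (-∑ i, (w i).2) (gf (fun i => (w i).2)
        (φ (Function.update (fun i => symInv (w i).1) i (symInv a)))) := by
  have h1 : ∀ j, (Function.update w i (a, (w i).2) j).2 = (w j).2 := fun j => by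
    rcases eq_or_ne j i with rfl | h
    · simp
    · simp [h]
  have h2 : (fun j => symInv (Function.update w i (a, (w i).2) j).1) =
      Function.update (fun j => symInv (w j).1) i (symInv a) := funext fun j => by
    rcases eq_or_ne j i with rfl | h
    · simp
    · simp [h]
  simp only [Tv, h1, h2]

lemma slotLin_Tv (φ : BasicCochain k (U3 k) (M0 k) (n + 1)) : SlotLin (Tv φ.1) := by
  intro w i
  have hφ : FS φ.1 := φ.2.1
  refine ⟨fun a b => ?_, fun c a => ?_, fun a => ?_⟩
  · rw [Tv_update, Tv_update, Tv_update, map_add, MultilinearMap.map_update_add,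
      gf_add _ (hφ _) (hφ _), map_add]
  · rw [Tv_update, Tv_update, map_smul, MultilinearMap.map_update_smul]
    rw [gf_smul _ (hφ _), map_smul, smul_eq_mul]
  · rw [Tv_update, Tv_update, symInv_dN]
    set b := Function.update (fun i => symInv (w i).1) i (symInv a) with hb
    have h1 : φ.1 (Function.update (fun i => symInv (w i).1) i (U3.D k (symInv a))) =
        fun m => (-LinearMap.id : M0 k →ₗ[k] M0 k)
          (m i • φ.1 b (Function.update m i (m i - 1))) := funext fun m => by
      have h2 := φ.2.2 b i m
      rw [hb, Function.update_idem, Function.update_self] at h2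
      exact h2
    rw [h1, gf_map _ (finite_deriv (hφ b) i), gf_deriv (hφ b)]
    simp

omit [CharZero k] in
/-- A multilinear map with polynomial dependence on parameters preserves polynomial families. -/
lemma fam_multilinear {C V : Type*} [AddCommGroup C] [Module k C] [AddCommGroup V] [Module k V]
    {n : ℕ} (L : (ℕ → k) → MultilinearMap k (fun _ : Fin n => C) V)
    (hL : ∀ v, (fun t => L t v) ∈ Fam k V) {a : Fin n → (ℕ → k) → C} (ha : ∀ i, a i ∈ Fam k C) :
    (fun t => L t fun i => a i t) ∈ Fam k V := by
  induction n with
  | zero =>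
    have h : ∀ t, (fun i : Fin 0 => a i t) = ![] := fun t => Subsingleton.elim _ _
    simp only [h]
    exact hL _
  | succ n ih =>
    have h : ∀ t, (fun i : Fin (n + 1) => a i t) = Fin.cons (a 0 t) fun i => a i.succ t :=
      fun t => (Fin.cons_self_tail fun i : Fin (n + 1) => a i t).symm
    simp only [h]
    let ap : (ℕ → k) → C →ₗ[k] V := fun t =>
      { toFun := fun x => L t (Fin.cons x fun i => a i.succ t)
        map_add' := fun x y => (L t).cons_add _ x y
        map_smul' := fun c x => (L t).cons_smul _ c x }
    exact fam_linear ap (fun x => ih (fun t => (L t).curryLeft x) (fun v => hL (Fin.cons x v))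
      fun i => ha i.succ) (ha 0)

omit [CharZero k] in
lemma eval_mem_PF {f : (ℕ → k) → k} (hf : f ∈ PF k) (p : Polynomial k) :
    (fun t => p.eval (f t)) ∈ PF k := by
  have h : (fun t => p.eval (f t)) = Polynomial.aeval f p := by
    induction p using Polynomial.induction_on' with
    | add p q hp hq => rw [map_add, ← hp, ← hq]; funext t; simp
    | monomial n c => funext t; simp [Polynomial.aeval_monomial]
  rw [h]
  exact Polynomial.aeval_mem_adjoin_singleton k f |> (Algebra.adjoin_le (by simpa using hf) ·)

/-- The function of points of a cochain is polynomial in the variables. -/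
lemma vPoly_Tv (φ : BasicCochain k (U3 k) (M0 k) (n + 1)) : VPoly fun _ => Tv φ.1 := by
  intro w hw
  have hφ : FS φ.1 := φ.2.1
  have hd : (fun t => -∑ i, (w i t).2) ∈ PF k := by
    have : (fun t => -∑ i, (w i t).2) = -∑ i, fun t => (w i t).2 := by
      funext t; simp
    rw [this]
    exact (PF k).neg_mem (sum_mem fun i _ => (hw i).2)
  refine fam_self (fam_multilinear (fun t => (evalM (-∑ i, (w i t).2)).compMultilinearMap
    (val φ.1 hφ fun i => (w i t).2)) (fun v => ?_)
    (a := fun i t => symInv (w i t).1) fun i => fam_map symInv (hw i).1)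
  obtain ⟨Q, hQ⟩ := exists_fa (k := k) (S := Polynomial k) (hφ v)
  have h1 : ∀ l, gf l (φ.1 v) = MvPolynomial.eval (fun i => algebraMap k (Polynomial k) (l i)) Q :=
    fun l => by rw [← gf_fa, hQ]; rfl
  refine mem_fam_self ?_
  have h2 : (fun t => (evalM (-∑ i, (w i t).2)).compMultilinearMap
      (val φ.1 hφ fun i => (w i t).2) v) = fun t => ∑ d ∈ Q.support,
        (Q.coeff d).eval (-∑ i, (w i t).2) * ∏ i, (w i t).2 ^ d i := by
    funext t
    rw [LinearMap.compMultilinearMap_apply, val_apply, evalM_eq]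
    refine (congrArg (Polynomial.eval _) (h1 _)).trans ?_
    rw [MvPolynomial.eval_eq']
    simp [Polynomial.eval_finsetSum, Polynomial.eval_prod]
  rw [h2]
  have h3 : (fun t => ∑ d ∈ Q.support, (Q.coeff d).eval (-∑ i, (w i t).2) *
      ∏ i, (w i t).2 ^ d i) = ∑ d ∈ Q.support, (fun t => (Q.coeff d).eval (-∑ i, (w i t).2)) *
        ∏ i, (fun t => (w i t).2) ^ d i := by
    funext t; simp
  rw [h3]
  exact sum_mem fun d _ => (PF k).mul_mem (eval_mem_PF hd _)
    (_root_.prod_mem fun i _ => (PF k).pow_mem (hw i).2 _)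

end Cochains

/-! ### The comparison of the complexes -/

section Comparison

open ConformalHochschild

variable {k : Type*} [Field k] [CharZero k] {n : ℕ}

/-! #### The differential of the comparison map -/

omit [CharZero k] in
/-- The sum of the variables is preserved when two neighbours are added. -/
lemma sum_contract {n : ℕ} (i : Fin n) (l : Fin (n + 1) → k) :
    ∑ j, Fin.contractNth i.castSucc (fun x y => x + y) l j = ∑ j, l j := by
  induction n with
  | zero => exact i.elim0
  | succ n ih =>
    obtain ⟨a, l, rfl⟩ := exists_cons l
    rcases Fin.eq_zero_or_eq_succ i with rfl | ⟨i, rfl⟩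
    · obtain ⟨b, l, rfl⟩ := exists_cons l
      rw [contract_zero_cons]
      simp [Fin.sum_univ_succ, add_assoc]
    · rw [contract_succ_cons, Fin.sum_univ_succ, Fin.sum_univ_succ]
      simp [ih]

lemma Tv_contract (φ : ML k (M0 k) (n + 1)) (w : Fin (n + 2) → Pt (CQ k)) (i : Fin (n + 1)) :
    Tv φ (Fin.contractNth i.castSucc sm w) = evalM (-∑ j, (w j).2)
      (gf (Fin.contractNth i.castSucc (fun x y => x + y) fun j => (w j).2)
        (φ (Fin.contractNth i.castSucc
          (fun x y => egf (w i.castSucc).2 fun s => U3.prod k s x y)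
          fun j => symInv (w j).1))) := by
  have h1 : (fun j => (Fin.contractNth i.castSucc sm w j).2) =
      Fin.contractNth i.castSucc (fun x y => x + y) fun j => (w j).2 :=
    Fin.comp_contractNth sm (fun x y => x + y) (f := Prod.snd) (fun _ _ => rfl) i.castSucc w
  have h2 : (fun j => symInv (Fin.contractNth i.castSucc sm w j).1) =
      Fin.contractNth i.castSucc (fun x y => egf (w i.castSucc).2 fun s => U3.prod k s x y)
        fun j => symInv (w j).1 := funext fun j => by
    rcases lt_trichotomy j i with h | rfl | h
    · rw [contract_of_lt _ h, contract_of_lt _ h]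
    · rw [contract_self, contract_self]
      exact symInv_actN _ _ _
    · rw [contract_of_gt _ h, contract_of_gt _ h]
  have h3 : ∑ j, (Fin.contractNth i.castSucc sm w j).2 = ∑ j, (w j).2 := by
    rw [← sum_contract i fun j => (w j).2]
    exact congrArg (fun f => ∑ j, f j) h1
  rw [Tv, h3, h1, h2]

lemma evalM_act (x l : k) (a : U3 k) (p : M0 k) :
    evalM x (egf l fun n => VirModule.act 0 0 n a p) = ev x (x + l) 0 (sym a) * evalM (x + l) p :=
  (egf_map l (evZero_act 0 0 a p) (evalM x)).symm.trans (hasSymbol_sym a 0 p x l)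

lemma finite_act {u : (Fin n → ℕ) → M0 k} (hu : {m | u m ≠ 0}.Finite) (a : U3 k) :
    {m : Fin (n + 1) → ℕ | VirModule.act 0 0 (m 0) a (u (Fin.tail m)) ≠ 0}.Finite := by
  obtain ⟨N, hN⟩ := exists_bound hu
  choose B hB using fun m => evZero_act (0 : k) 0 a (u m)
  refine (hu.biUnion fun m _ => (Set.finite_Iio (B m)).image fun p =>
    (Fin.cons p m : Fin (n + 1) → ℕ)).subset fun m hm => ?_
  simp only [Set.mem_iUnion]
  refine ⟨Fin.tail m, fun h => hm ?_, m 0, ?_, Fin.cons_self_tail m⟩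
  · rw [h, map_zero]
  · by_contra h
    exact hm (hB _ _ (not_lt.1 h))

lemma gf_act {u : (Fin n → ℕ) → M0 k} (hu : {m | u m ≠ 0}.Finite) (a : U3 k) (l : Fin (n + 1) → k) :
    gf l (fun m => VirModule.act 0 0 (m 0) a (u (Fin.tail m))) =
      egf (l 0) fun p => VirModule.act 0 0 p a (gf (Fin.tail l) u) := by
  rw [gf_succ l (finite_act hu a)]
  refine congrArg _ (funext fun p => ?_)
  exact gf_map (Fin.tail l) hu (VirModule.act 0 0 p a)

/-- The Hochschild differential becomes the differential of functions of points. -/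
lemma Tv_dBasic (φ : BasicCochain k (U3 k) (M0 k) (n + 1)) (w : Fin (n + 2) → Pt (CQ k)) :
    Tv (dBasic k (U3 k) (M0 k) (n + 1) φ).1 w =
      wt (w 0) (∑ i, (Fin.tail w i).2) * Tv φ.1 (Fin.tail w) -
        ∑ i : Fin (n + 1), (-1) ^ (i : ℕ) * Tv φ.1 (Fin.contractNth i.castSucc sm w) := by
  have hφ : FS φ.1 := φ.2.1
  set a : Fin (n + 2) → U3 k := fun j => symInv (w j).1 with ha
  set l : Fin (n + 2) → k := fun j => (w j).2 with hl
  have hx : -∑ j, (w j).2 + (w 0).2 = -∑ i, (Fin.tail w i).2 := by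
    rw [Fin.sum_univ_succ]
    simp [Fin.tail]
  have h1 : (dBasic k (U3 k) (M0 k) (n + 1) φ).1 a =
      (fun m => VirModule.act 0 0 (m 0) (a 0) (φ.1 (Fin.tail a) (Fin.tail m))) +
        fun m => ∑ i : Fin (n + 1), ((-1 : ℤ) ^ ((i : ℕ) + 1) • LinearMap.id : M0 k →ₗ[k] M0 k)
          (dTerm (k := k) φ.1 i a m) := rfl
  have h2 : ∀ i : Fin (n + 1), {m | ((-1 : ℤ) ^ ((i : ℕ) + 1) • LinearMap.id : M0 k →ₗ[k] M0 k)
      (dTerm (k := k) φ.1 i a m) ≠ 0}.Finite := fun i =>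
    (dTerm_finite hφ i a).subset fun m hm h => hm (by rw [h, map_zero])
  have h3 : {m | ∑ i : Fin (n + 1), ((-1 : ℤ) ^ ((i : ℕ) + 1) • LinearMap.id : M0 k →ₗ[k] M0 k)
      (dTerm (k := k) φ.1 i a m) ≠ 0}.Finite :=
    (Set.finite_iUnion h2).subset fun m hm => by
      obtain ⟨i, -, hi⟩ := Finset.exists_ne_zero_of_sum_ne_zero hm
      exact Set.mem_iUnion.2 ⟨i, hi⟩
  have h4 : ∀ i : Fin (n + 1), gf l (fun m => ((-1 : ℤ) ^ ((i : ℕ) + 1) • LinearMap.id :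
      M0 k →ₗ[k] M0 k) (dTerm (k := k) φ.1 i a m)) =
        (-1 : ℤ) ^ ((i : ℕ) + 1) • gf l (dTerm (k := k) φ.1 i a) :=
    fun i => gf_map l (dTerm_finite hφ i a) _
  rw [Tv, h1, gf_add _ (finite_act (hφ _) _) h3, gf_act (hφ _), gf_sum _ _ h2, map_add, evalM_act,
    map_sum, sub_eq_add_neg]
  congr 1
  · rw [hx, wt, ha, sym_symInv]
    congr 1
    rw [← hx]
    simp [Fin.sum_univ_succ, Fin.tail]
  · refine Eq.trans (Finset.sum_congr rfl fun i _ => ?_) (Finset.sum_neg_distrib _)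
    rw [h4, gf_dTerm hφ, map_zsmul, Tv_contract, zsmul_eq_mul, pow_succ]
    push_cast
    ring

/-! #### Surjectivity -/

omit [CharZero k] in
/-- The constant polynomials in `M_(0,0)`. -/
noncomputable def constM : k →ₗ[k] M0 k := (Polynomial.monomial 0 : k →ₗ[k] Polynomial k)

omit [CharZero k] in
lemma evalM_constM (x c : k) : evalM x (constM c) = c :=
  (Polynomial.eval_monomial (R := k)).trans (by simp)

omit [CharZero k] in
lemma VPoly.exists_poly {T : Vf k n} (h : VPoly fun _ => T) (a : Fin (n + 1) → CQ k) :
    ∃ Q : MvPolynomial (Fin (n + 1)) k, ∀ l, MvPolynomial.eval l Q = T fun i => (a i, l i) := by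
  obtain ⟨p, hp⟩ := h (fun i t => (a i, t i)) fun i => ⟨const_mem_fam _, coord_mem_PF _⟩
  refine ⟨MvPolynomial.aeval (fun j => if hj : j < n + 1 then MvPolynomial.X ⟨j, hj⟩ else 0) p,
    fun l => ?_⟩
  have h1 := congrFun hp fun j => if hj : j < n + 1 then l ⟨j, hj⟩ else 0
  simp only [Fin.is_lt, dite_true] at h1
  refine Eq.trans ?_ h1
  have h5 : (Pi.evalAlgHom k (fun _ : ℕ → k => k) fun j =>
      if hj : j < n + 1 then l ⟨j, hj⟩ else 0).comp
      (MvPolynomial.aeval (fun i (t : ℕ → k) => t i)) =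
      (MvPolynomial.aeval l).comp (MvPolynomial.aeval
        (fun j => if hj : j < n + 1 then MvPolynomial.X ⟨j, hj⟩ else 0)) := by
    refine MvPolynomial.algHom_ext fun i => ?_
    by_cases hi : i < n + 1
    · simp only [AlgHom.comp_apply, MvPolynomial.aeval_X, dif_pos hi, Pi.evalAlgHom_apply]
    · simp only [AlgHom.comp_apply, MvPolynomial.aeval_X, dif_neg hi, Pi.evalAlgHom_apply, map_zero]
  exact (DFunLike.congr_fun h5 p).symm

/-- Every antilinear and polynomial function of points comes from a cochain, with constant values in
`M_(0,0)`. -/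
lemma exists_Tv_eq {T : Vf k n} (hT : SlotLin T) (hp : VPoly fun _ => T) :
    ∃ φ : BasicCochain k (U3 k) (M0 k) (n + 1), Tv φ.1 = T := by
  have hu : ∀ (a : Fin (n + 1) → U3 k) (l : Fin (n + 1) → k) i x,
      (fun j => (symEquiv (Function.update a i x j), l j)) =
        Function.update (fun j => (symEquiv (a j), l j)) i (symEquiv x, l i) := by
    intro a l i x
    funext j
    rcases eq_or_ne j i with rfl | h
    · simp
    · simp [h]
  suffices h : ∃ φ : BasicCochain k (U3 k) (M0 k) (n + 1), ∀ a l,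
      gf l (φ.1 a) = constM (T fun i => (symEquiv (a i), l i)) by
    obtain ⟨φ, hφ⟩ := h
    refine ⟨φ, funext fun w => ?_⟩
    have h1 : ∀ i, symEquiv (symInv (w i).1) = (w i).1 := fun i =>
      Subtype.ext (sym_symInv _)
    rw [Tv, hφ, evalM_constM]
    simp only [h1]
  refine exists_cochain (fun a l => constM (T fun i => (symEquiv (a i), l i))) (fun a => ?_)
    (fun a i x y l => ?_) (fun a i c x l => ?_) (fun a i l => ?_)
  · obtain ⟨Q, hQ⟩ := hp.exists_poly fun i => symEquiv (a i)
    refine ⟨fun m => constM (fa k _ k Q m), (fa_finite (k := k) Q).subset fun m hm h => hm ?_,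
      fun l => ?_⟩
    · exact (congrArg constM h).trans (map_zero _)
    · rw [gf_map l (fa_finite Q), gf_fa, ← hQ]
      rfl
  · have h1 := (hT (fun j => (symEquiv (a j), l j)) i).add (symEquiv x) (symEquiv y)
    rw [hu, hu, hu, map_add, ← map_add constM]
    exact congrArg constM h1
  · have h1 := (hT (fun j => (symEquiv (a j), l j)) i).smul c (symEquiv x)
    rw [hu, hu, map_smul, ← map_smul constM]
    exact congrArg constM h1
  · have h1 := (hT (fun j => (symEquiv (a j), l j)) i).del (symEquiv (a i))
    have h2 : symEquiv (U3.D k (a i)) = dN (CQ k) (symEquiv (a i)) := Subtype.ext (sym_D _)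
    rw [Function.update_eq_self, ← h2, neg_mul] at h1
    rw [hu, ← map_smul, ← map_neg]
    exact congrArg constM h1

/-! #### The kernel -/

/-- A polynomial that vanishes where `x = - ∑ λᵢ` is a multiple of `x + ∑ λᵢ`. -/
lemma dvd_of_eval {Q : MvPolynomial (Fin n) (Polynomial k)}
    (h : ∀ l : Fin n → k,
      (MvPolynomial.eval (fun i => Polynomial.C (l i)) Q).eval (-∑ i, l i) = 0) :
    MvPolynomial.C Polynomial.X + ∑ i, MvPolynomial.X i ∣ Q := by
  set ε : MvPolynomial (Fin n) (Polynomial k) →+* MvPolynomial (Fin n) k :=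
    MvPolynomial.eval₂Hom (Polynomial.aeval (-∑ i, MvPolynomial.X i)).toRingHom MvPolynomial.X
    with hε
  have h1 : ε Q = 0 := MvPolynomial.funext fun l => by
    have h2 : (MvPolynomial.eval l).comp ε = (Polynomial.evalRingHom (-∑ i, l i)).comp
        (MvPolynomial.eval fun i => Polynomial.C (l i)) := by
      refine MvPolynomial.ringHom_ext' (Polynomial.ringHom_ext' (RingHom.ext fun c => ?_) ?_)
        fun i => ?_ <;> simp [hε]
    rw [map_zero]
    exact (RingHom.congr_fun h2 Q).trans (h l)
  set I := Ideal.span {(MvPolynomial.C Polynomial.X + ∑ i, MvPolynomial.X i :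
    MvPolynomial (Fin n) (Polynomial k))} with hI
  have h3 : Ideal.Quotient.mk I = (Ideal.Quotient.mk I).comp
      ((MvPolynomial.map Polynomial.C).comp ε) := by
    refine MvPolynomial.ringHom_ext' (Polynomial.ringHom_ext' (RingHom.ext fun c => ?_) ?_)
      fun i => ?_
    · simp [hε]
    · refine (Ideal.Quotient.eq).2 ?_
      simp only [hε]
      refine Ideal.mem_span_singleton.2 (dvd_of_eq ?_)
      simp
    · simp [hε]
  refine Ideal.mem_span_singleton.1 (Ideal.Quotient.eq_zero_iff_mem.1 ?_)
  rw [h3, RingHom.comp_apply, RingHom.comp_apply, h1, map_zero, map_zero]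

lemma gf_derivMulti (φ : BasicCochain k (U3 k) (M0 k) n) (a : Fin n → U3 k) (l : Fin n → k) :
    gf l ((derivBasic k (U3 k) (M0 k) n φ).1 a) =
      VirModule.D 0 0 (gf l (φ.1 a)) + (∑ i, l i) • gf l (φ.1 a) := by
  have hφ : FS φ.1 := φ.2.1
  have h1 : (derivBasic k (U3 k) (M0 k) n φ).1 a = (fun m => VirModule.D 0 0 (φ.1 a m)) +
      fun m => ∑ i, m i • φ.1 a (Function.update m i (m i - 1)) :=
    funext fun m => derivMulti_apply φ.1 a m
  have h2 : {m | ∑ i, m i • φ.1 a (Function.update m i (m i - 1)) ≠ 0}.Finite :=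
    (Set.finite_iUnion fun i => finite_deriv (hφ a) i).subset fun m hm => by
      obtain ⟨i, -, hi⟩ := Finset.exists_ne_zero_of_sum_ne_zero hm
      exact Set.mem_iUnion.2 ⟨i, hi⟩
  rw [h1, gf_add _ ((hφ a).subset fun m hm h => hm ?_) h2, gf_map l (hφ a),
    gf_sum _ _ fun i => finite_deriv (hφ a) i, Finset.sum_smul]
  · exact congrArg _ (Finset.sum_congr rfl fun i _ => gf_deriv (hφ a) i l)
  · rw [h, map_zero]

/-- The operator `∂` in terms of polynomials. -/
lemma gf_derivBasic (φ : BasicCochain k (U3 k) (M0 k) n) (a : Fin n → U3 k) (l : Fin n → k) :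
    @Eq (Polynomial k) (gf l ((derivBasic k (U3 k) (M0 k) n φ).1 a))
      ((Polynomial.X - Polynomial.C (-∑ i, l i)) * (show Polynomial k from gf l (φ.1 a))) := by
  refine (gf_derivMulti φ a l).trans ?_
  rw [map_neg, sub_neg_eq_add, add_mul, ← Polynomial.smul_eq_C_mul]
  rfl

lemma Tv_derivBasic (φ : BasicCochain k (U3 k) (M0 k) (n + 1)) :
    Tv (derivBasic k (U3 k) (M0 k) (n + 1) φ).1 = 0 := by
  funext w
  rw [Tv, evalM_eq]
  refine (congrArg (Polynomial.eval _) (gf_derivBasic φ _ _)).trans ?_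
  rw [Polynomial.eval_mul, Polynomial.eval_sub, Polynomial.eval_X, Polynomial.eval_C, sub_self,
    zero_mul]
  rfl

/-- A cochain that vanishes where `∂ = - ∑ λᵢ` is divisible by the operator `∂`. -/
lemma exists_derivBasic_eq (φ : BasicCochain k (U3 k) (M0 k) n)
    (h : ∀ a l, evalM (-∑ i, l i) (gf l (φ.1 a)) = 0) :
    ∃ ψ, derivBasic k (U3 k) (M0 k) n ψ = φ := by
  have hφ : FS φ.1 := φ.2.1
  let g : (Fin n → U3 k) → (Fin n → k) → Polynomial k := fun a l => gf l (φ.1 a)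
  let F : (Fin n → U3 k) → (Fin n → k) → Polynomial k := fun a l =>
    g a l /ₘ (Polynomial.X - Polynomial.C (-∑ i, l i))
  have hF : ∀ a l, (Polynomial.X - Polynomial.C (-∑ i, l i)) * F a l = g a l := fun a l =>
    Polynomial.mul_divByMonic_eq_iff_isRoot.2 (h a l)
  have hF' : ∀ a l p, (Polynomial.X - Polynomial.C (-∑ i, l i)) * p = g a l → p = F a l :=
    fun a l p hp => mul_left_cancel₀ (Polynomial.X_sub_C_ne_zero _) (hp.trans (hF a l).symm)
  have key : ∃ ψ : BasicCochain k (U3 k) (M0 k) n, ∀ a l, gf l (ψ.1 a) = F a l := by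
    refine exists_cochain (fun a l => F a l) (fun a => ?_) (fun a i x y l => ?_)
      (fun a i c x l => ?_) (fun a i l => ?_)
    · obtain ⟨Q, hQ⟩ := exists_fa (k := k) (S := Polynomial k) (hφ a)
      have h1 : ∀ l, g a l = MvPolynomial.eval (fun i => Polynomial.C (l i)) Q := fun l => by
        have h2 := gf_fa (S := Polynomial k) l Q
        rw [hQ] at h2
        exact h2
      obtain ⟨P, rfl⟩ := dvd_of_eval (Q := Q) fun l => by
        rw [← h1]
        exact h a l
      refine ⟨fa k n (Polynomial k) P, fa_finite (k := k) P, fun l => ?_⟩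
      refine (gf_fa (S := Polynomial k) l P).trans (hF' a l _ ?_)
      rw [h1]
      simp [Polynomial.algebraMap_eq]
    · refine (hF' _ l _ ?_).symm
      change _ * (F _ l + F _ l) = _
      rw [mul_add, hF, hF]
      have h1 : gf l (φ.1 (Function.update a i (x + y))) =
          gf l (φ.1 (Function.update a i x)) + gf l (φ.1 (Function.update a i y)) := by
        rw [MultilinearMap.map_update_add, gf_add _ (hφ _) (hφ _)]
      exact h1.symm
    · refine (hF' _ l _ ?_).symm
      change _ * (c • F _ l) = _
      rw [mul_smul_comm, hF]
      have h1 : gf l (φ.1 (Function.update a i (c • x))) =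
          c • gf l (φ.1 (Function.update a i x)) := by
        rw [MultilinearMap.map_update_smul, gf_smul _ (hφ _)]
      exact h1.symm
    · refine (hF' _ l _ ?_).symm
      change _ * (-(l i • F _ l)) = _
      rw [mul_neg, mul_smul_comm, hF]
      have h1 : gf l (φ.1 (Function.update a i (U3.D k (a i)))) = -(l i • gf l (φ.1 a)) := by
        rw [← gf_deriv (hφ a)]
        refine Eq.trans ?_ (gf_map l (finite_deriv (hφ a) i) (-LinearMap.id))
        exact congrArg _ (funext fun m => φ.2.2 a i m)
      exact h1.symm
  obtain ⟨ψ, hψ⟩ := key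
  refine ⟨ψ, Subtype.ext (MultilinearMap.ext fun a => gf_ext (k := k)
    ((derivBasic k (U3 k) (M0 k) n ψ).2.1 a) (hφ a) fun l => ?_)⟩
  refine (gf_derivBasic ψ a l).trans (Eq.trans ?_ (hF a l))
  exact congrArg (fun p : Polynomial k => (Polynomial.X - Polynomial.C (-∑ i, l i)) * p) (hψ a l)

/-! #### The comparison map -/

variable (k n) in
/-- The comparison map from cochains with `n + 1` entries to functions on words. -/
noncomputable def cmp : BasicCochain k (U3 k) (M0 k) (n + 1) →ₗ[k] Wd (CQ k) where
  toFun φ := toWd n (Tv φ.1)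
  map_add' φ ψ := by
    rw [← toWd_add]
    congr 1
    funext w
    change evalM _ (gf _ (φ.1 _ + ψ.1 _)) = _
    rw [gf_add _ (φ.2.1 _) (ψ.2.1 _), map_add]
    rfl
  map_smul' c φ := by
    rw [RingHom.id_apply, ← toWd_smul]
    congr 1
    funext w
    change evalM _ (gf _ (c • φ.1 _)) = _
    rw [gf_smul _ (φ.2.1 _), map_smul]
    rfl

lemma cmp_apply (φ : BasicCochain k (U3 k) (M0 k) (n + 1)) : cmp k n φ = toWd n (Tv φ.1) := rfl

lemma cmp_mem (φ : BasicCochain k (U3 k) (M0 k) (n + 1)) : cmp k n φ ∈ R (CQ k) n :=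
  ⟨toWd_supp n _, (slotLin_Tv φ).toWd, (vPoly_Tv φ).toWd⟩

lemma exists_cmp_eq {Φ : Wd (CQ k)} (h : Φ ∈ R (CQ k) n) : ∃ φ, cmp k n φ = Φ := by
  obtain ⟨φ, hφ⟩ := exists_Tv_eq (SlotLin.ofWd h.2.1 n) (VPoly.ofWd h.2.2 n)
  exact ⟨φ, by rw [cmp_apply, hφ, toWd_ofWd h.1]⟩

/-- The reduction modulo `∂` is the substitution of `-∑ λᵢ` for `∂`. -/
lemma ker_cmp : LinearMap.ker (cmp k n) = LinearMap.range (derivBasic k (U3 k) (M0 k) (n + 1)) := by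
  ext φ
  rw [LinearMap.mem_ker, cmp_apply, toWd_eq_zero_iff]
  constructor
  · intro h
    refine exists_derivBasic_eq φ fun a l => ?_
    have h1 := congrFun h fun i => (symEquiv (a i), l i)
    have h2 : ∀ i, symInv (symEquiv (a i)) = a i := fun i => symInv_sym (a i)
    simp only [Tv, h2] at h1
    exact h1
  · rintro ⟨ψ, rfl⟩
    exact Tv_derivBasic ψ

lemma cmp_dBasic (φ : BasicCochain k (U3 k) (M0 k) (n + 1)) :
    cmp k (n + 1) (dBasic k (U3 k) (M0 k) (n + 1) φ) = dW (CQ k) (cmp k n φ) := by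
  rw [cmp_apply, cmp_apply, dW_toWd]
  congr 1
  funext w
  exact Tv_dBasic φ w

/-- The differential of a vector of `M_(0,0)` is a multiple of `aug`; the multiples of `aug` are the
coboundaries in degree one. -/
lemma cmp_dBasic_zero (φ : BasicCochain k (U3 k) (M0 k) 0) :
    cmp k 0 (dBasic k (U3 k) (M0 k) 0 φ) = evalM 0 (φ.1 ![] ![]) • aug (CQ k) := by
  funext l y
  cases l with
  | nil =>
    set a : Fin 1 → U3 k := fun _ => symInv y.1 with ha
    have h1 : (dBasic k (U3 k) (M0 k) 0 φ).1 a =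
        (fun m => VirModule.act 0 0 (m 0) (a 0) (φ.1 (Fin.tail a) (Fin.tail m))) +
          fun m => ∑ i : Fin 0, (-1 : ℤ) ^ ((i : ℕ) + 1) • dTerm (k := k) φ.1 i a m := rfl
    have h2 : (fun m => ∑ i : Fin 0, (-1 : ℤ) ^ ((i : ℕ) + 1) • dTerm (k := k) φ.1 i a m) = 0 :=
      rfl
    have h3 : Tv (dBasic k (U3 k) (M0 k) 0 φ).1 (fun _ => y) = evalM (-∑ i : Fin 1, y.2)
        (gf (fun _ => y.2) ((dBasic k (U3 k) (M0 k) 0 φ).1 a)) := rfl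
    rw [cmp_apply]
    change Tv (dBasic k (U3 k) (M0 k) 0 φ).1 (fun _ => y) = _
    rw [h3, h1, h2, add_zero, gf_act (φ.2.1 _), evalM_act, gf_nil, ha, sym_symInv,
      Subsingleton.elim (Fin.tail fun _ => symInv y.1) ![]]
    simp [aug_nil, mul_comm]
  | cons s l => simp [cmp_apply, toWd, aug_cons]

end Comparison

/-! ### The cohomology of `U(3)` -/

section Final

open ConformalHochschild

universe u

variable {k : Type u} [Field k] [CharZero k]

variable (k) in
/-- The comparison map on the reduced cochains. -/
noncomputable def cmpR (n : ℕ) : ReducedCochain k (U3 k) (M0 k) (n + 1) →ₗ[k] Wd (CQ k) :=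
  Submodule.liftQ _ (cmp k n) ker_cmp.ge

lemma cmpR_injective (n : ℕ) : Function.Injective (cmpR k n) := by
  rw [← LinearMap.ker_eq_bot, cmpR]
  exact Submodule.ker_liftQ_eq_bot _ _ _ ker_cmp.le

lemma cmpR_mem {n : ℕ} (z : ReducedCochain k (U3 k) (M0 k) (n + 1)) : cmpR k n z ∈ R (CQ k) n := by
  obtain ⟨φ, rfl⟩ := Submodule.Quotient.mk_surjective _ z
  exact cmp_mem φ

lemma exists_cmpR_eq {n : ℕ} {Φ : Wd (CQ k)} (h : Φ ∈ R (CQ k) n) : ∃ z, cmpR k n z = Φ := by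
  obtain ⟨φ, hφ⟩ := exists_cmp_eq h
  exact ⟨Submodule.Quotient.mk φ, hφ⟩

lemma cmpR_dReduced {n : ℕ} (z : ReducedCochain k (U3 k) (M0 k) (n + 1)) :
    cmpR k (n + 1) (dReduced k (U3 k) (M0 k) (n + 1) z) = dW (CQ k) (cmpR k n z) := by
  obtain ⟨φ, rfl⟩ := Submodule.Quotient.mk_surjective _ z
  exact cmp_dBasic φ

/-- Comparison of the cohomology of the reduced complex with the cohomology of functions on
words. -/
lemma rank_reduced (n : ℕ) (B : Submodule k (Wd (CQ k)))
    (hB : ∀ z, z ∈ coboundaries k (U3 k) (M0 k) (n + 1) ↔ cmpR k n z ∈ B) :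
    Module.rank k (ReducedCohomology k (U3 k) (M0 k) (n + 1)) =
      Module.rank k (HQ (Zc (CQ k) n) B) := by
  refine rank_HQ_eq (LinearMap.ker (dReduced k (U3 k) (M0 k) (n + 1))) LinearMap.id (cmpR k n)
    (fun w hw => hw) (fun w hw => ⟨cmpR_mem w, ?_⟩) (fun z hz => ⟨z, hz, rfl⟩)
    (fun Φ hΦ => ?_) (fun w _ => hB w)
  · change dW (CQ k) (cmpR k n w) = 0
    rw [← cmpR_dReduced, LinearMap.mem_ker.1 hw, map_zero]
  · obtain ⟨z, rfl⟩ := exists_cmpR_eq hΦ.1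
    refine ⟨z, cmpR_injective (n + 1) ?_, rfl⟩
    rw [cmpR_dReduced, map_zero]
    exact hΦ.2

lemma rank_reduced_one : Module.rank k (ReducedCohomology k (U3 k) (M0 k) 1) = 1 := by
  refine (rank_reduced 0 (Submodule.span k {aug (CQ k)}) fun z => ?_).trans rank_CQ_zero
  rw [Submodule.mem_span_singleton]
  constructor
  · rintro ⟨w, rfl⟩
    obtain ⟨φ, rfl⟩ := Submodule.Quotient.mk_surjective _ w
    exact ⟨_, (cmp_dBasic_zero φ).symm⟩
  · rintro ⟨c, hc⟩
    obtain ⟨φ, hφ⟩ := exists_cochain (k := k) (n := 0) (fun _ _ => constM c)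
      (fun a => ⟨fun _ => constM c, Set.toFinite _, fun l => gf_nil l _⟩) (fun a i => i.elim0)
      (fun a i => i.elim0) (fun a i => i.elim0)
    refine ⟨Submodule.Quotient.mk φ, cmpR_injective 0 ?_⟩
    refine (cmp_dBasic_zero φ).trans (Eq.trans ?_ hc)
    have h1 := hφ ![] ![]
    rw [gf_nil] at h1
    rw [h1, evalM_constM]

/-- From degree two on, the cohomology of `U(3)` is the cohomology of `K`. -/
lemma rank_reduced_succ (n : ℕ) : Module.rank k (ReducedCohomology k (U3 k) (M0 k) (n + 2)) =
    Module.rank k (HQ (Zc (Km k) n) (Bc (Km k) n)) := by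
  refine (rank_reduced (n + 1) (Bc (CQ k) (n + 1)) fun z => ?_).trans (rank_CQ_succ n)
  rw [mem_Bc_succ]
  constructor
  · rintro ⟨w, rfl⟩
    exact ⟨cmpR k n w, cmpR_mem w, (cmpR_dReduced w).symm⟩
  · rintro ⟨ψ, hψ, h⟩
    obtain ⟨w, rfl⟩ := exists_cmpR_eq hψ
    exact ⟨w, cmpR_injective (n + 1) ((cmpR_dReduced w).trans h)⟩

end Final

end VirHoch

/-- Dimensions of the reduced Hochschild cohomology of `U(3)` with values in `M_(0,0)`. -/
theorem mainTheorem1 (k : Type*) [Field k] [CharZero k] :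
    Module.rank k (ConformalHochschild.ReducedCohomology k (U3 k) (VirModule k 0 0) 1) = 1 ∧
    Module.rank k (ConformalHochschild.ReducedCohomology k (U3 k) (VirModule k 0 0) 2) = 2 ∧
    Module.rank k (ConformalHochschild.ReducedCohomology k (U3 k) (VirModule k 0 0) 3) = 1 ∧
    ∀ n : ℕ, 4 ≤ n →
      Module.rank k (ConformalHochschild.ReducedCohomology k (U3 k) (VirModule k 0 0) n) = 0 := by
  refine ⟨VirHoch.rank_reduced_one, (VirHoch.rank_reduced_succ 0).trans VirHoch.rank_Km_zero,
    (VirHoch.rank_reduced_succ 1).trans VirHoch.rank_Km_one, fun n hn => ?_⟩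
  obtain ⟨m, rfl⟩ : ∃ m, n = m + 2 + 2 := ⟨n - 4, by omega⟩
  exact (VirHoch.rank_reduced_succ (m + 2)).trans
    (VirHoch.rank_HQ_eq_zero (VirHoch.Zc_Km_le m))
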